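/- For a finite abelian group $G$, written additively, with exponent $\exp(G)$, a sequence over $G$ means a finite unordered sequence (multiset) of elements of $G$, with repetition allowed; its length is the number of its terms counted with multiplicity, subsequences are sub-multisets, and a sequence is zero-sum if the sum of its terms is $0$. Let $\eta(G)$ be the smallest positive integer $l$ such that every sequence over $G$ of length at least $l$ has a zero-sum subsequence $T$ of length $|T|\in[1,\exp(G)]$, and let $\mathsf s(G)$ be the smallest positive integer $l$ such that every sequence over $G$ of length at least $l$ has a zero-sum subsequence $T$ of length $|T|=\exp(G)$. Let $C_m$ denote the cyclic group of order $m$. **Theorem.** Let $n\ge 2$ be an integer. 1. $\eta(C_2^2\oplus C_{2n})=2n+4$ and $\mathsf s(C_2^2\oplus C_{2n})=4n+3$. 2. $\eta(C_2^3\oplus C_{2n})=2n+6$, and if $n\ge 36$, then $\mathsf s(C_2^3\oplus C_{2n})=4n+5$. -/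

import Mathlib

/-- The length `l` forces a short zero-sum subsequence over `G`: every sequence over `G` (a finite
multiset of elements of `G`) of length at least `l` has a zero-sum subsequence whose length lies in
`[1, exp G]`. -/
def ForcesShortZeroSum (G : Type*) [AddCommGroup G] (l : ℕ) : Prop :=
  ∀ S : Multiset G, l ≤ S.card →
    ∃ T : Multiset G, T ≤ S ∧ 1 ≤ T.card ∧ T.card ≤ AddMonoid.exponent G ∧ T.sum = 0

/-- The length `l` forces a zero-sum subsequence of length exactly `exp G` over `G`. -/
def ForcesExpZeroSum (G : Type*) [AddCommGroup G] (l : ℕ) : Prop :=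
  ∀ S : Multiset G, l ≤ S.card →
    ∃ T : Multiset G, T ≤ S ∧ T.card = AddMonoid.exponent G ∧ T.sum = 0

/-- The invariant `η(G)`: the smallest positive integer forcing a short zero-sum subsequence. -/
noncomputable def etaConst (G : Type*) [AddCommGroup G] : ℕ :=
  sInf {l : ℕ | 0 < l ∧ ForcesShortZeroSum G l}

/-- The Erdős–Ginzburg–Ziv constant `s(G)`: the smallest positive integer forcing a zero-sum
subsequence of length `exp G`. -/
noncomputable def egzConst (G : Type*) [AddCommGroup G] : ℕ :=
  sInf {l : ℕ | 0 < l ∧ ForcesExpZeroSum G l}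

/-- The group `C_2^r ⊕ C_m`, where `C_m` is the cyclic group of order `m`. -/
abbrev ElemTwoSumCyclic (r m : ℕ) : Type := (Fin r → ZMod 2) × ZMod m

/-!
Write `η` and `s` for the two invariants. The lower bounds come from `extremalSeq`: the element
`(0, 1)` repeated `2 n - 1` times together with `(e_i, 0)` and `(e_i, 1)` for each `i`; for `s`, the
zero element repeated `2 n - 1` times is added.

For the upper bounds, write `n = p m` with `p` prime. A long sequence over `C_2^r ⊕ C_{2n}` contains
many disjoint subsequences that become short zero-sum sequences over `C_2^r ⊕ C_{2p}`. Their sums lie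
in the kernel `C_m` of the projection, and the Erdős–Ginzburg–Ziv theorem in `C_m` combines them
(`ForcesShortZeroSum.mul`, `ForcesExpZeroSum.mul`). So `n = p` may be assumed. For `p = 2` a
pigeonhole argument on sums of pairs suffices (`exists_sum_eq_zero_of_choose`).

Let `p` be odd. Then `C_2^r ⊕ C_{2p} = V ⊕ C_p` with `V = C_2^{r+1}`, and a sequence is given by a
class `x i` in `V` and a value `f i` in `C_p` for each index `i`. The central question is which sets of
`2 p + 2 r + 1` indices have no nonempty zero-sum part of even size at most `2 p`
(`NoShortEven`). Take a maximal family of disjoint pairs of equal class. There are fewer than `p`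
pairs, because their values are zero-sum free in `C_p`, and the indices left over have distinct
classes. Hence at most `2 ^ (r + 1)` are left over, and there are at least `p - 4` pairs. By
Cauchy–Davenport the sums of pairs cover nearly all of `C_p`. A set of left-over classes that has even
size and sum zero in `V` can be combined with these pairs, so its value is confined to very few
elements: `γ, 2 γ, …` if all pairs have the same value `γ`, and even fewer possibilities otherwise.
For `r = 2`, seven classes are left over and all zero-sum `4`-subsets have value `γ`, which makes `f`
constant on them and gives a contradiction (`not_noShortEven_of_card_eight`). For `r = 3` the possible
values are played off against the geometry of `𝔽₂⁴`: a set of nine or more points has a zero-sum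
`6`-subset, or it is an affine hyperplane with one further point (`exists_hyperplane_of_no_hexad`). The
outcome is `NoShortEven.exists_const`: the only sets without short even zero-sum part contain `2 p - 1`
equal elements, and none of their values is zero. The case `p = 3` without any pairs, thirteen points
with values modulo `3`, needs a separate count (`false_of_mod_three`).

The bound for `η` follows upon adjoining the zero element: an even zero-sum part remains nonempty when
the zero is dropped, and the exceptional sets have no element of value zero. For `s`, the family of
pairs is so large that, by a Cauchy–Davenport type bound for sums of `h` terms
(`exists_popular_value`), some value is taken by at least `(p - 1) / 2` pairs; translating `f`, which
does not affect zero-sum sets of size `2 p`, this value becomes zero. These pairs can be used to pad an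
even zero-sum set to size exactly `2 p` (`exists_noShortEven`). In the exceptional case the
`2 p - 1` equal elements serve the same purpose.
-/

open Finset
open scoped Pointwise

/-! ### Subset sums in `ℤ/pℤ` -/

lemma sum_univ_zmod_five : ∑ a : ZMod 5, a = 0 := by decide

section SubsetSums

variable {κ : Type*} {p : ℕ}

/-- The set of all sums `∑ i ∈ Q, F i` with `Q ⊆ P`, the empty sum included. -/
def subsetSums (F : κ → ZMod p) (P : Finset κ) : Finset (ZMod p) :=
  P.powerset.image fun Q => ∑ i ∈ Q, F i

/-- The set of all sums `∑ i ∈ Q, F i` with `Q ⊆ P` of cardinality `h`. -/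
def sumsOfCard (F : κ → ZMod p) (P : Finset κ) (h : ℕ) : Finset (ZMod p) :=
  (P.powersetCard h).image fun Q => ∑ i ∈ Q, F i

lemma mem_subsetSums {F : κ → ZMod p} {P : Finset κ} {a : ZMod p} :
    a ∈ subsetSums F P ↔ ∃ Q ⊆ P, ∑ i ∈ Q, F i = a := by
  simp [subsetSums]

lemma mem_sumsOfCard {F : κ → ZMod p} {P : Finset κ} {h : ℕ} {a : ZMod p} :
    a ∈ sumsOfCard F P h ↔ ∃ Q ⊆ P, Q.card = h ∧ ∑ i ∈ Q, F i = a := by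
  simp [sumsOfCard, mem_powersetCard, and_assoc]

lemma zero_mem_subsetSums (F : κ → ZMod p) (P : Finset κ) : (0 : ZMod p) ∈ subsetSums F P :=
  mem_subsetSums.2 ⟨∅, by simp, by simp⟩

variable [DecidableEq κ]

lemma subsetSums_add_subset {F : κ → ZMod p} {P A B : Finset κ} (hA : A ⊆ P) (hB : B ⊆ P)
    (hAB : Disjoint A B) : subsetSums F A + subsetSums F B ⊆ subsetSums F P := by
  intro a ha
  obtain ⟨u, hu, v, hv, rfl⟩ := mem_add.1 ha
  obtain ⟨Q, hQ, rfl⟩ := mem_subsetSums.1 hu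
  obtain ⟨R, hR, rfl⟩ := mem_subsetSums.1 hv
  refine mem_subsetSums.2 ⟨Q ∪ R, union_subset (hQ.trans hA) (hR.trans hB), ?_⟩
  exact sum_union (disjoint_of_subset_left hQ (disjoint_of_subset_right hR hAB))

variable [hp : Fact p.Prime]

lemma card_subsetSums {F : κ → ZMod p} {P : Finset κ} (hF : ∀ i ∈ P, F i ≠ 0) :
    min p (P.card + 1) ≤ (subsetSums F P).card := by
  induction P using Finset.induction_on with
  | empty =>
    have : 0 < (subsetSums F (∅ : Finset κ)).card := card_pos.2 ⟨0, zero_mem_subsetSums F _⟩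
    simp only [card_empty]
    omega
  | insert a P ha ih =>
    have h1 := ih fun i hi => hF i (mem_insert_of_mem hi)
    have h2 : ({0, F a} : Finset (ZMod p)) ⊆ subsetSums F {a} := by
      intro x hx
      rcases mem_insert.1 hx with rfl | hx
      · exact zero_mem_subsetSums F _
      · rw [mem_singleton.1 hx]
        exact mem_subsetSums.2 ⟨{a}, subset_rfl, by simp⟩
    have h3 : ({0, F a} : Finset (ZMod p)).card = 2 :=
      card_pair (hF a (mem_insert_self _ _)).symm
    have h4 := card_le_card h2
    have h5 := card_le_card (subsetSums_add_subset (F := F) (P := insert a P) (A := P) (B := {a})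
      (subset_insert _ _) (by simp) (by simpa using ha))
    have h6 := ZMod.cauchy_davenport hp.out ⟨0, zero_mem_subsetSums F P⟩
      ⟨0, zero_mem_subsetSums F {a}⟩
    rw [card_insert_of_notMem ha]
    omega

/-- Two terms `u ≠ v`, `u + v ≠ 0` contribute four sums instead of three, so a non-constant family
has one more subset sum than Cauchy–Davenport gives for a constant one. -/
lemma card_subsetSums_of_ne {F : κ → ZMod p} {P : Finset κ} (hF : ∀ i ∈ P, F i ≠ 0)
    {a b : κ} (ha : a ∈ P) (hb : b ∈ P) (hab : F a ≠ F b) (hs : F a + F b ≠ 0) :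
    min p (P.card + 2) ≤ (subsetSums F P).card := by
  have hne : a ≠ b := fun h => hab (by rw [h])
  have hsub : ({a, b} : Finset κ) ⊆ P := by
    intro x hx
    rcases mem_insert.1 hx with rfl | hx
    · exact ha
    · rw [mem_singleton.1 hx]; exact hb
  have h1 := card_subsetSums (F := F) (P := P \ {a, b}) fun i hi => hF i (mem_sdiff.1 hi).1
  have h2 : ({0, F a, F b, F a + F b} : Finset (ZMod p)) ⊆ subsetSums F {a, b} := by
    intro x hx
    simp only [mem_insert, mem_singleton] at hx
    rcases hx with rfl | rfl | rfl | rfl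
    · exact zero_mem_subsetSums F _
    · exact mem_subsetSums.2 ⟨{a}, by simp, by simp⟩
    · exact mem_subsetSums.2 ⟨{b}, by simp, by simp⟩
    · exact mem_subsetSums.2 ⟨{a, b}, subset_rfl, sum_pair hne⟩
  have h3 : ({0, F a, F b, F a + F b} : Finset (ZMod p)).card = 4 := by
    have ha0 := hF a ha
    have hb0 := hF b hb
    rw [card_insert_of_notMem, card_insert_of_notMem, card_insert_of_notMem, card_singleton]
    · simpa using fun h : F b = F a + F b => ha0 (by simpa using h)
    · simp only [mem_insert, mem_singleton, not_or]
      exact ⟨hab, fun h => hb0 (by simpa using h)⟩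
    · simp only [mem_insert, mem_singleton, not_or]
      exact ⟨ha0.symm, hb0.symm, hs.symm⟩
  have h4 := card_le_card h2
  have h5 := card_le_card (subsetSums_add_subset (F := F) (P := P) (A := P \ {a, b}) (B := {a, b})
    sdiff_subset hsub sdiff_disjoint)
  have h6 := ZMod.cauchy_davenport hp.out ⟨0, zero_mem_subsetSums F (P \ {a, b})⟩
    ⟨0, zero_mem_subsetSums F {a, b}⟩
  have h7 := card_sdiff_add_card_eq_card hsub
  rw [card_pair hne] at h7
  omega

/-- A zero-sum free family of `p - 1` elements of `ℤ/pℤ` is constant. -/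
lemma eq_of_zeroSumFree {F : κ → ZMod p} {P : Finset κ} (hcard : p ≤ P.card + 1)
    (hF : ∀ Q ⊆ P, Q.Nonempty → ∑ i ∈ Q, F i ≠ 0) {a b : κ} (ha : a ∈ P) (hb : b ∈ P) :
    F a = F b := by
  by_contra hab
  have hne : a ≠ b := fun h => hab (by rw [h])
  have hF1 : ∀ i ∈ P, F i ≠ 0 := fun i hi => by
    simpa using hF {i} (by simpa using hi) (singleton_nonempty i)
  have hsub : ({a, b} : Finset κ) ⊆ P := by
    intro x hx
    rcases mem_insert.1 hx with rfl | hx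
    · exact ha
    · rw [mem_singleton.1 hx]; exact hb
  have h1 := card_subsetSums (F := F) (P := P \ {a, b}) fun i hi => hF1 i (mem_sdiff.1 hi).1
  have h3 : ({F a, F b, F a + F b} : Finset (ZMod p)).card = 3 := by
    have ha0 := hF1 a ha
    have hb0 := hF1 b hb
    rw [card_insert_of_notMem, card_insert_of_notMem, card_singleton]
    · simpa using fun h : F b = F a + F b => ha0 (by simpa using h)
    · simp only [mem_insert, mem_singleton, not_or]
      exact ⟨hab, fun h => hb0 (by simpa using h)⟩
  have h6 := ZMod.cauchy_davenport hp.out ⟨0, zero_mem_subsetSums F (P \ {a, b})⟩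
    (t := {F a, F b, F a + F b}) ⟨F a, by simp⟩
  have h7 := card_sdiff_add_card_eq_card hsub
  rw [card_pair hne] at h7
  have h8 : subsetSums F (P \ {a, b}) + {F a, F b, F a + F b} = univ := by
    apply eq_univ_of_card
    have := card_le_univ (subsetSums F (P \ {a, b}) + {F a, F b, F a + F b})
    rw [ZMod.card] at this ⊢
    omega
  obtain ⟨u, hu, v, hv, huv⟩ := mem_add.1 (h8 ▸ mem_univ (0 : ZMod p))
  obtain ⟨Q, hQ, rfl⟩ := mem_subsetSums.1 hu
  have key : ∀ R : Finset κ, R.Nonempty → R ⊆ {a, b} → ∑ i ∈ R, F i = v → False := by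
    intro R hR hRs hRv
    refine hF (Q ∪ R) (union_subset (hQ.trans sdiff_subset) (hRs.trans hsub)) (hR.inr) ?_
    rw [sum_union, hRv, huv]
    exact disjoint_of_subset_left hQ (disjoint_of_subset_right hRs sdiff_disjoint)
  simp only [mem_insert, mem_singleton] at hv
  rcases hv with rfl | rfl | rfl
  · exact key {a} (by simp) (by simp) (by simp)
  · exact key {b} (by simp) (by simp) (by simp)
  · exact key {a, b} (by simp) subset_rfl (sum_pair hne)

/-- A family of `p` elements of `ℤ/pℤ` is not zero-sum free. -/
lemma exists_zeroSum_of_card {F : κ → ZMod p} {P : Finset κ} (hcard : p ≤ P.card) :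
    ∃ Q ⊆ P, Q.Nonempty ∧ ∑ i ∈ Q, F i = 0 := by
  by_contra! hF
  have hF1 : ∀ i ∈ P, F i ≠ 0 := fun i hi => by
    simpa using hF {i} (by simpa using hi) (singleton_nonempty i)
  obtain ⟨a, ha⟩ : P.Nonempty := card_pos.1 (hp.out.pos.trans_le hcard)
  have h1 := card_subsetSums (F := F) (P := P.erase a) fun i hi => hF1 i (mem_of_mem_erase hi)
  rw [card_erase_of_mem ha] at h1
  have h2 : subsetSums F (P.erase a) = univ := by
    apply eq_univ_of_card
    have := card_le_univ (subsetSums F (P.erase a))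
    rw [ZMod.card] at this ⊢
    have := hp.out.pos
    omega
  obtain ⟨Q, hQ, hs⟩ := mem_subsetSums.1 (h2 ▸ mem_univ (-F a))
  have haQ : a ∉ Q := fun h => notMem_erase a P (hQ h)
  refine hF (insert a Q) (insert_subset ha (hQ.trans (erase_subset _ _))) (by simp) ?_
  rw [sum_insert haQ, hs, add_neg_cancel]

/-- If no value is taken more than `h` times, the elements can be distributed over `h` sets on each
of which the family is injective; adding these sets up gives the bound. The induction splits off
one set at a time: a full transversal of the values if some value is taken `h` times, and a
single element otherwise. -/
lemma card_sumsOfCard (F : κ → ZMod p) (h : ℕ) (P : Finset κ) (hh : h ≤ P.card)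
    (hm : ∀ a, (P.filter fun i => F i = a).card ≤ h) :
    min p (P.card - h + 1) ≤ (sumsOfCard F P h).card := by
  induction h generalizing P with
  | zero =>
    have hP : P = ∅ := by
      by_contra hne
      obtain ⟨i, hi⟩ := nonempty_iff_ne_empty.2 hne
      have := hm (F i)
      rw [Nat.le_zero, card_eq_zero] at this
      exact notMem_empty i (this ▸ mem_filter.2 ⟨hi, rfl⟩)
    have : 0 < (sumsOfCard F P 0).card :=
      card_pos.2 ⟨0, mem_sumsOfCard.2 ⟨∅, by simp, by simp, by simp⟩⟩
    rw [hP] at this ⊢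
    simp only [card_empty]
    omega
  | succ h ih =>
    -- it suffices to split off a suitable set `A`
    suffices H : ∃ A ⊆ P, A.Nonempty ∧ Set.InjOn F A ∧ h ≤ (P \ A).card ∧
        ∀ a, ((P \ A).filter fun i => F i = a).card ≤ h by
      obtain ⟨A, hAP, hA, hinj, h1, h2⟩ := H
      have h3 := ih (P \ A) h1 h2
      have h4 : A.image F + sumsOfCard F (P \ A) h ⊆ sumsOfCard F P (h + 1) := by
        intro x hx
        obtain ⟨u, hu, v, hv, rfl⟩ := mem_add.1 hx
        obtain ⟨i, hi, rfl⟩ := mem_image.1 hu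
        obtain ⟨Q, hQ, hQc, rfl⟩ := mem_sumsOfCard.1 hv
        have hiQ : i ∉ Q := fun h => (mem_sdiff.1 (hQ h)).2 hi
        exact mem_sumsOfCard.2 ⟨insert i Q, insert_subset (hAP hi) (hQ.trans sdiff_subset),
          by rw [card_insert_of_notMem hiQ, hQc], sum_insert hiQ⟩
      have h5 : (sumsOfCard F (P \ A) h).Nonempty := by
        obtain ⟨Q, hQ, hQc⟩ := exists_subset_card_eq h1
        exact ⟨_, mem_sumsOfCard.2 ⟨Q, hQ, hQc, rfl⟩⟩
      have h6 := ZMod.cauchy_davenport hp.out (hA.image F) h5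
      have h7 := card_le_card h4
      have h8 := card_sdiff_add_card_eq_card hAP
      have h9 := card_image_of_injOn hinj
      have h10 := hA.card_pos
      omega
    by_cases hmax : ∃ a, (P.filter fun i => F i = a).card = h + 1
    · obtain ⟨a₀, ha₀⟩ := hmax
      obtain ⟨A, hAP, hinj, himg⟩ : ∃ A ⊆ P, Set.InjOn F A ∧ A.image F = P.image F := by
        obtain ⟨A, hA, hinj, himg⟩ := exists_subset_injOn_image_eq_of_surjOn P (P.image F)
          (f := F) (by rw [coe_image]; exact Set.surjOn_image F P)
        exact ⟨A, hA, hinj, himg⟩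
      have hdrop : ∀ a, ((P \ A).filter fun i => F i = a).card + 1 ≤ h + 1 := by
        intro a
        by_cases hemp : (P.filter fun i => F i = a) = ∅
        · have : (P \ A).filter (fun i => F i = a) = ∅ :=
            subset_empty.1 (hemp ▸ filter_subset_filter _ sdiff_subset)
          rw [this]; simp
        · obtain ⟨i, hi⟩ := nonempty_iff_ne_empty.2 hemp
          have hi' := mem_filter.1 hi
          obtain ⟨j, hj, hji⟩ := mem_image.1 (himg ▸ mem_image_of_mem F hi'.1)
          have hlt : (P \ A).filter (fun i => F i = a) ⊂ P.filter fun i => F i = a := by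
            refine (ssubset_iff_of_subset (filter_subset_filter _ sdiff_subset)).2 ⟨j, ?_, ?_⟩
            · exact mem_filter.2 ⟨hAP hj, hji.trans hi'.2⟩
            · simp [hj]
          exact (card_lt_card hlt).trans_le (hm a)
      refine ⟨A, hAP, ?_, hinj, ?_, fun a => by have := hdrop a; omega⟩
      · rw [← image_nonempty (f := F), himg, image_nonempty]
        exact card_pos.1 (by omega)
      · -- `A` meets the fibre of `a₀` at most once
        have h1 : (A.filter fun i => F i = a₀).card ≤ 1 := by
          refine card_le_one.2 fun i hi j hj => hinj (mem_filter.1 hi).1 (mem_filter.1 hj).1 ?_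
          rw [(mem_filter.1 hi).2, (mem_filter.1 hj).2]
        have h2 : (P.filter fun i => F i = a₀).card ≤
            (A.filter fun i => F i = a₀).card + (P \ A).card := by
          refine (card_le_card ?_).trans (card_union_le _ _)
          intro i hi
          by_cases hiA : i ∈ A
          · exact mem_union_left _ (mem_filter.2 ⟨hiA, (mem_filter.1 hi).2⟩)
          · exact mem_union_right _ (mem_sdiff.2 ⟨(mem_filter.1 hi).1, hiA⟩)
        omega
    · push Not at hmax
      obtain ⟨i, hi⟩ : P.Nonempty := card_pos.1 (by omega)
      refine ⟨{i}, by simpa using hi, singleton_nonempty i, by simp, ?_, fun a => ?_⟩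
      · rw [card_sdiff_of_subset (by simpa using hi), card_singleton]; omega
      · have := card_le_card (filter_subset_filter (fun i => F i = a)
          (sdiff_subset : P \ {i} ⊆ P))
        have := hm a
        have := hmax a
        omega

/-- If no value is taken more than `|P| - p` times, some `p` elements sum to zero: their
complement is a set of `|P| - p` elements with the same sum as all of `P`. -/
lemma exists_card_eq_sum_zero {F : κ → ZMod p} {P : Finset κ} (hP : p ≤ P.card)
    (hm : ∀ a, (P.filter fun i => F i = a).card ≤ P.card - p) :
    ∃ Q ⊆ P, Q.card = p ∧ ∑ i ∈ Q, F i = 0 := by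
  have h1 := card_sumsOfCard F (P.card - p) P (Nat.sub_le _ _) hm
  have h2 : sumsOfCard F P (P.card - p) = univ := by
    apply eq_univ_of_card
    have := card_le_univ (sumsOfCard F P (P.card - p))
    rw [ZMod.card] at this ⊢
    omega
  obtain ⟨B, hB, hBc, hBs⟩ := mem_sumsOfCard.1 (h2 ▸ mem_univ (∑ i ∈ P, F i))
  refine ⟨P \ B, sdiff_subset, ?_, ?_⟩
  · rw [card_sdiff_of_subset hB, hBc]; omega
  · have := sum_sdiff (f := F) hB
    rw [hBs] at this
    simpa using this

/-- A family with at least `2p - 5` members and no `p` of them summing to zero takes some value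
at least `(p - 1) / 2` times. -/
lemma exists_popular_value {F : κ → ZMod p} {P : Finset κ} (hp3 : 3 ≤ p) (hP : 2 * p ≤ P.card + 5)
    (hno : ∀ Q ⊆ P, Q.card = p → ∑ i ∈ Q, F i ≠ 0) :
    ∃ a, p ≤ 2 * (P.filter fun i => F i = a).card + 1 := by
  by_contra! hlt
  by_cases hbig : ∀ a, (P.filter fun i => F i = a).card ≤ P.card - p
  · obtain hP' | hP' := le_or_gt p P.card
    · obtain ⟨Q, hQ, hQc, hQs⟩ := exists_card_eq_sum_zero hP' hbig
      exact hno Q hQ hQc hQs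
    · obtain ⟨i, hi⟩ : P.Nonempty := card_pos.1 (by omega)
      have h1 : 0 < (P.filter fun j => F j = F i).card :=
        card_pos.2 ⟨i, mem_filter.2 ⟨hi, rfl⟩⟩
      have := hbig (F i)
      omega
  · push Not at hbig
    obtain ⟨a, ha⟩ := hbig
    have h1 := hlt a
    have hp7 : p = 3 ∨ p = 5 := by
      have h7 : p < 7 := by omega
      have h4 : p ≠ 4 := fun h => by have := hp.out; rw [h] at this; revert this; decide
      have h6 : p ≠ 6 := fun h => by have := hp.out; rw [h] at this; revert this; decide
      omega
    rcases hp7 with rfl | rfl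
    · omega
    -- for `p = 5` the family runs through all residues once, and these sum to zero
    · have hinj : Set.InjOn F P := by
        intro i hi j hj hij
        have := hlt (F i)
        have h2 : (P.filter fun k => F k = F i).card ≤ 1 := by omega
        exact card_le_one.1 h2 i (mem_filter.2 ⟨hi, rfl⟩) j (mem_filter.2 ⟨hj, hij.symm⟩)
      have hc := card_image_of_injOn hinj
      have hle := card_le_univ (P.image F)
      rw [ZMod.card] at hle
      have huniv : P.image F = univ := eq_univ_of_card _ (by rw [ZMod.card]; omega)
      refine hno P subset_rfl (by omega) ?_
      rw [← sum_image (f := fun a => a) hinj, huniv]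
      convert sum_univ_zmod_five

end SubsetSums

/-! ### Point sets in elementary abelian `2`-groups -/

section PointSets

lemma sum_quad {α K : Type*} [DecidableEq α] [AddCommMonoid K] {a b c d : α}
    (h : ({a, b, c, d} : Finset α).card = 4) (f : α → K) :
    ∑ v ∈ ({a, b, c, d} : Finset α), f v = f a + f b + f c + f d := by
  have ha : a ∉ ({b, c, d} : Finset α) := fun ha => by
    rw [insert_eq_of_mem ha] at h
    have := card_le_three (a := b) (b := c) (c := d)
    omega
  rw [card_insert_of_notMem ha] at h
  have hb : b ∉ ({c, d} : Finset α) := fun hb => by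
    rw [insert_eq_of_mem hb] at h
    have := card_le_two (a := c) (b := d)
    omega
  have hcd : c ≠ d := by
    rintro rfl
    have := card_le_two (a := b) (b := c)
    simp only [pair_eq_singleton] at h
    omega
  rw [sum_insert ha, sum_insert hb, sum_pair hcd]
  simp only [add_assoc]

variable {V : Type*} [AddCommGroup V] [DecidableEq V]

lemma card_quad {a b c d : V} (hV : ∀ v : V, v + v = 0) (hab : a ≠ b) (hac : a ≠ c)
    (hbc : b ≠ c) (hd : a + b + c + d = 0) : ({a, b, c, d} : Finset V).card = 4 := by
  have had : a ≠ d := by grind [hV a, hV b, hV c, hV d]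
  have hbd : b ≠ d := by grind [hV a, hV b, hV c, hV d]
  have hcd : c ≠ d := by grind [hV a, hV b, hV c, hV d]
  rw [card_insert_of_notMem (by simp [hab, hac, had]),
    card_insert_of_notMem (by simp [hbc, hbd]), card_pair hcd]

/-- Evaluation of a condition on zero-sum `4`-subsets at explicitly given points. -/
lemma quad_apply {K : Type*} [AddCommMonoid K] (hV : ∀ v : V, v + v = 0) {X : Finset V}
    {f : V → K} {C : Set K}
    (hQ : ∀ B ⊆ X, B.card = 4 → ∑ v ∈ B, v = 0 → ∑ v ∈ B, f v ∈ C) {a b c d : V}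
    (ha : a ∈ X) (hb : b ∈ X) (hc : c ∈ X) (hd : d ∈ X) (hab : a ≠ b) (hac : a ≠ c) (hbc : b ≠ c)
    (h : a + b + c + d = 0) : f a + f b + f c + f d ∈ C := by
  have h1 := card_quad hV hab hac hbc h
  rw [← sum_quad h1 f]
  refine hQ _ ?_ h1 ((sum_quad h1 fun v => v).trans h)
  intro x hx
  simp only [mem_insert, mem_singleton] at hx
  rcases hx with rfl | rfl | rfl | rfl <;> assumption

/-- If every direction `a + b` occurs at least three times in `X`, and all zero-sum `4`-subsets of
`X` have the same `f`-sum `c`, then `f` is constant on `X`, equal to `c / 4`. -/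
lemma four_mul_eq_of_quads {K : Type*} [CommRing K] (hV : ∀ v : V, v + v = 0)
    {X : Finset V} {f : V → K} {c : K} (hX3 : 3 ≤ X.card)
    (hX : ∀ a ∈ X, ∀ b ∈ X, a ≠ b → 6 ≤ (X.filter fun v => v + (a + b) ∈ X).card)
    (hQ : ∀ B ⊆ X, B.card = 4 → ∑ v ∈ B, v = 0 → ∑ v ∈ B, f v = c) {a : V} (ha : a ∈ X) :
    4 * f a = c := by
  have hpair : ∀ a ∈ X, ∀ b ∈ X, a ≠ b → 2 * (f a + f b) = c := by
    intro a ha b hb hab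
    obtain ⟨u, hu, hu'⟩ : ∃ u ∈ X.filter (fun v => v + (a + b) ∈ X), u ∉ ({a, b} : Finset V) :=
      exists_mem_notMem_of_card_lt_card
        ((card_le_two).trans_lt (by have := hX a ha b hb hab; omega))
    obtain ⟨w, hw, hw'⟩ : ∃ w ∈ X.filter (fun v => v + (a + b) ∈ X),
        w ∉ ({a, b, u, u + (a + b)} : Finset V) :=
      exists_mem_notMem_of_card_lt_card
        ((card_le_four).trans_lt (by have := hX a ha b hb hab; omega))
    simp only [mem_insert, mem_singleton, not_or, mem_filter] at hu hu' hw hw'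
    have q1 := quad_apply (C := {c}) hV hQ ha hb hu.1 hu.2 hab (Ne.symm hu'.1) (Ne.symm hu'.2)
      (by grind [hV a, hV b, hV u])
    have q2 := quad_apply (C := {c}) hV hQ ha hb hw.1 hw.2 hab (Ne.symm hw'.1) (Ne.symm hw'.2.1)
      (by grind [hV a, hV b, hV w])
    have q3 := quad_apply (C := {c}) hV hQ hu.1 hu.2 hw.1 hw.2 (by grind [hV a, hV b, hV u])
      (Ne.symm hw'.2.2.1) (Ne.symm hw'.2.2.2) (by grind [hV a, hV b, hV u, hV w])
    simp only [Set.mem_singleton_iff] at q1 q2 q3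
    linear_combination q1 + q2 - q3
  obtain ⟨b, hb, hb'⟩ : ∃ b ∈ X, b ∉ ({a} : Finset V) :=
    exists_mem_notMem_of_card_lt_card (by rw [card_singleton]; omega)
  obtain ⟨e, he, he'⟩ : ∃ e ∈ X, e ∉ ({a, b} : Finset V) :=
    exists_mem_notMem_of_card_lt_card ((card_le_two).trans_lt (by omega))
  simp only [mem_insert, mem_singleton, not_or] at hb' he'
  have e1 := hpair a ha b hb (Ne.symm hb')
  have e2 := hpair a ha e he (Ne.symm he'.1)
  have e3 := hpair b hb e he (Ne.symm he'.2)
  linear_combination e1 + e2 - e3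

/-- A set missing few points of `V` contains every direction at least three times. -/
lemma six_le_card_filter [Fintype V] {X : Finset V} (hX : Fintype.card V + 6 ≤ 2 * X.card)
    (m : V) : 6 ≤ (X.filter fun v => v + m ∈ X).card := by
  have h1 : (X.filter fun v => v + m ∉ X).card ≤ (univ \ X).card := by
    refine card_le_card_of_injOn (fun v => v + m) (fun v hv => ?_)
      (fun v _ w _ h => add_right_cancel h)
    simpa using (mem_filter.1 hv).2
  rw [card_univ_sdiff] at h1
  have h2 := card_filter_add_card_filter_not (s := X) (fun v => v + m ∈ X)
  have := card_le_univ X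
  omega

/-- More `2`-subsets than values force two disjoint pairs with the same sum. -/
lemma exists_pair_sum_eq {ι G : Type*} [DecidableEq ι] [AddCommGroup G] [DecidableEq G]
    {z : ι → G} {s : Finset ι} {P : Finset (Finset ι)} {t : Finset G} (hinj : Set.InjOn z s)
    (hP : ∀ B ∈ P, B ⊆ s ∧ B.card = 2) (hz : ∀ B ∈ P, ∑ i ∈ B, z i ∈ t) (ht : t.card < P.card) :
    ∃ B ∈ P, ∃ C ∈ P, Disjoint B C ∧ ∑ i ∈ B, z i = ∑ i ∈ C, z i := by
  obtain ⟨B, hB, C, hC, hne, hs⟩ := exists_ne_map_eq_of_card_lt_of_maps_to ht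
    (f := fun B => ∑ i ∈ B, z i) hz
  refine ⟨B, hB, C, hC, ?_, hs⟩
  rw [disjoint_left]
  intro a haB haC
  obtain ⟨b, hb⟩ := card_eq_one.1 (show (B.erase a).card = 1 by
    rw [card_erase_of_mem haB, (hP B hB).2])
  obtain ⟨c, hc⟩ := card_eq_one.1 (show (C.erase a).card = 1 by
    rw [card_erase_of_mem haC, (hP C hC).2])
  have hB' : B = insert a {b} := by rw [← hb, insert_erase haB]
  have hC' : C = insert a {c} := by rw [← hc, insert_erase haC]
  have hab : a ∉ ({b} : Finset ι) := hb ▸ notMem_erase a B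
  have hac : a ∉ ({c} : Finset ι) := hc ▸ notMem_erase a C
  have hs' : ∑ i ∈ B, z i = ∑ i ∈ C, z i := hs
  rw [hB', hC', sum_insert hab, sum_insert hac, sum_singleton, sum_singleton] at hs'
  have hbc : b = c := hinj ((hP B hB).1 (by simp [hB'])) ((hP C hC).1 (by simp [hC']))
    (add_left_cancel hs')
  exact hne (by rw [hB', hC', hbc])

end PointSets

/-! ### Zero-sum `6`-subsets -/

section Hexads

variable {V : Type*} [AddCommGroup V] [DecidableEq V]

/-- The only relation between the six points of a zero-sum set is the sum of all of them:
two disjoint pairs have different sums. -/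
lemma pair_eq_of_hexad (hV : ∀ v : V, v + v = 0) {H : Finset V} (hH : H.card = 6)
    (hH0 : ∑ v ∈ H, v = 0) {a b c d : V} (ha : a ∈ H) (hb : b ∈ H) (hc : c ∈ H) (hd : d ∈ H)
    (hab : a ≠ b) (h : a + b = c + d) : (a = c ∧ b = d) ∨ (a = d ∧ b = c) := by
  by_cases hac : a = c
  · subst hac
    exact Or.inl ⟨rfl, add_left_cancel h⟩
  by_cases hbc : b = c
  · subst hbc
    exact Or.inr ⟨by rw [add_comm b d] at h; exact add_right_cancel h, rfl⟩
  exfalso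
  have h0 : a + b + c + d = 0 := by grind [hV c, hV d]
  have h4 := card_quad hV hab hac hbc h0
  have hsub : ({a, b, c, d} : Finset V) ⊆ H := by
    intro x hx
    simp only [mem_insert, mem_singleton] at hx
    rcases hx with rfl | rfl | rfl | rfl <;> assumption
  have h5 : (H \ {a, b, c, d}).card = 2 := by rw [card_sdiff_of_subset hsub]; omega
  obtain ⟨u, v, huv, h6⟩ := card_eq_two.1 h5
  have h7 := sum_sdiff (f := fun v => v) hsub
  rw [h6, sum_pair huv, sum_quad h4, h0, hH0, add_zero] at h7
  exact huv (by grind [hV v])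

/-- Fifteen pairs, fifteen nonzero vectors: every nonzero vector is the sum of a pair. -/
lemma exists_pair_of_hexad [Fintype V] (hcard : Fintype.card V = 16) (hV : ∀ v : V, v + v = 0)
    {H : Finset V} (hH : H.card = 6) (hH0 : ∑ v ∈ H, v = 0) {m : V} (hm : m ≠ 0) :
    ∃ a ∈ H, ∃ b ∈ H, a ≠ b ∧ a + b = m := by
  have h1 : Set.InjOn (fun B : Finset V => ∑ v ∈ B, v) (H.powersetCard 2) := by
    intro B hB C hC hBC
    obtain ⟨hBH, hB2⟩ := mem_powersetCard.1 (mem_coe.1 hB)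
    obtain ⟨hCH, hC2⟩ := mem_powersetCard.1 (mem_coe.1 hC)
    obtain ⟨a, b, hab, rfl⟩ := card_eq_two.1 hB2
    obtain ⟨c, d, hcd, rfl⟩ := card_eq_two.1 hC2
    simp only [sum_pair hab, sum_pair hcd] at hBC
    rcases pair_eq_of_hexad hV hH hH0 (hBH (by simp)) (hBH (by simp)) (hCH (by simp))
      (hCH (by simp)) hab hBC with ⟨rfl, rfl⟩ | ⟨rfl, rfl⟩
    · rfl
    · exact pair_comm _ _
  have h2 : (H.powersetCard 2).image (fun B => ∑ v ∈ B, v) = univ.erase 0 := by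
    apply eq_of_subset_of_card_le
    · intro x hx
      obtain ⟨B, hB, rfl⟩ := mem_image.1 hx
      obtain ⟨-, hB2⟩ := mem_powersetCard.1 hB
      obtain ⟨a, b, hab, rfl⟩ := card_eq_two.1 hB2
      rw [sum_pair hab]
      exact mem_erase.2 ⟨fun h => hab (by grind [hV b]), mem_univ _⟩
    · rw [card_image_of_injOn h1, card_powersetCard, hH, card_erase_of_mem (mem_univ _),
        card_univ, hcard]
      decide
  obtain ⟨B, hB, hBm⟩ := mem_image.1 (h2 ▸ mem_erase.2 ⟨hm, mem_univ m⟩)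
  obtain ⟨hBH, hB2⟩ := mem_powersetCard.1 hB
  obtain ⟨a, b, hab, rfl⟩ := card_eq_two.1 hB2
  exact ⟨a, hBH (by simp), b, hBH (by simp), hab, by rw [← hBm, sum_pair hab]⟩

/-- Every point outside a zero-sum `6`-set is a sum of three of its points, one of which may be
prescribed. -/
lemma exists_triple_of_hexad [Fintype V] (hcard : Fintype.card V = 16)
    (hV : ∀ v : V, v + v = 0) {H : Finset V} (hH : H.card = 6) (hH0 : ∑ v ∈ H, v = 0)
    {y c : V} (hy : y ∉ H) (hc : c ∈ H) :
    ∃ a ∈ H, ∃ b ∈ H, a ≠ b ∧ a ≠ c ∧ b ≠ c ∧ y = a + b + c := by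
  have hyc : y + c ≠ 0 := fun h => hy (by have : y = c := by grind [hV c]
                                          rwa [this])
  obtain ⟨a, ha, b, hb, hab, h⟩ := exists_pair_of_hexad hcard hV hH hH0 hyc
  have hy' : y = a + b + c := by grind [hV c]
  refine ⟨a, ha, b, hb, hab, ?_, ?_, hy'⟩
  · rintro rfl
    exact hy (by have : y = b := by grind [hV a]
                 rwa [this])
  · rintro rfl
    exact hy (by have : y = a := by grind [hV b]
                 rwa [this])

variable {K : Type*} [Field K]

/-- Let all zero-sum `4`-subsets of `X` have `h`-sum `0`, and let the zero-sum `6`-subset `H` of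
`X` have `h`-sum `2 e`. A point `y` outside `H` is the sum of a triple of `H` and of the
complementary triple, so both triples have `h`-sum `e`, and `h y = -e`. -/
lemma hexad_triple (hV : ∀ v : V, v + v = 0) (h2 : (2 : K) ≠ 0) {X H : Finset V} {h : V → K}
    {e : K} (hQ : ∀ B ⊆ X, B.card = 4 → ∑ v ∈ B, v = 0 → ∑ v ∈ B, h v = 0) (hHX : H ⊆ X)
    (hH : H.card = 6) (hH0 : ∑ v ∈ H, v = 0) (hHe : ∑ v ∈ H, h v = 2 * e) {y a b c : V}
    (hyX : y ∈ X) (hy : y ∉ H) (ha : a ∈ H) (hb : b ∈ H) (hc : c ∈ H) (hab : a ≠ b)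
    (hac : a ≠ c) (hbc : b ≠ c) (hyT : y = a + b + c) :
    h y = -e ∧ h a + h b + h c = e ∧ ∑ v ∈ H \ {a, b, c}, h v = e ∧
      ∑ v ∈ H \ {a, b, c}, v = y := by
  have hsub : ({a, b, c} : Finset V) ⊆ H := by
    intro x hx
    simp only [mem_insert, mem_singleton] at hx
    rcases hx with rfl | rfl | rfl <;> assumption
  have h3 : ({a, b, c} : Finset V).card = 3 := card_eq_three.2 ⟨a, b, c, hab, hac, hbc, rfl⟩
  have hT : ∑ v ∈ H \ {a, b, c}, v = y := by
    have := sum_sdiff (f := fun v => v) hsub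
    rw [hH0, sum_insert (by simp [hab, hac]), sum_pair hbc] at this
    grind [hV a, hV b, hV c]
  have hhT := sum_sdiff (f := h) hsub
  rw [hHe, sum_insert (by simp [hab, hac]), sum_pair hbc] at hhT
  have q1 : h a + h b + h c + h y = 0 :=
    quad_apply (C := {0}) hV hQ (hHX ha) (hHX hb) (hHX hc) hyX hab hac hbc
      (by rw [hyT]; grind [hV a, hV b, hV c])
  have hyS : y ∉ H \ {a, b, c} := fun h => hy (mem_sdiff.1 h).1
  have q2 := hQ (insert y (H \ {a, b, c}))
    (insert_subset hyX (sdiff_subset.trans hHX))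
    (by rw [card_insert_of_notMem hyS, card_sdiff_of_subset hsub, hH, h3])
    (by rw [sum_insert hyS, hT, hV])
  rw [sum_insert hyS] at q2
  have hye : h y = -e := by
    apply mul_left_cancel₀ h2
    linear_combination q1 + q2 - hhT
  refine ⟨hye, by linear_combination q1 - hye, by linear_combination q2 - hye, hT⟩

/-- Two points outside `H` differ by a pair `c, d` of `H`, and `h c = h d = e`: exchanging `c`
for `d` turns a triple for the first point into a triple for the second. -/
lemma hexad_edge [Fintype V] (hcard : Fintype.card V = 16) (hV : ∀ v : V, v + v = 0)
    (h2 : (2 : K) ≠ 0) {X H : Finset V} {h : V → K} {e : K}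
    (hQ : ∀ B ⊆ X, B.card = 4 → ∑ v ∈ B, v = 0 → ∑ v ∈ B, h v = 0) (hHX : H ⊆ X)
    (hH : H.card = 6) (hH0 : ∑ v ∈ H, v = 0) (hHe : ∑ v ∈ H, h v = 2 * e) {y z : V}
    (hyX : y ∈ X) (hy : y ∉ H) (hzX : z ∈ X) (hz : z ∉ H) (hyz : y ≠ z) :
    ∃ c ∈ H, ∃ d ∈ H, c ≠ d ∧ c + d = y + z ∧ h c = e ∧ h d = e := by
  obtain ⟨c, hc, d, hd, hcd, hs⟩ := exists_pair_of_hexad hcard hV hH hH0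
    (m := y + z) (fun h => hyz (by grind [hV z]))
  obtain ⟨a, ha, b, hb, hab, hac, hbc, hyT⟩ := exists_triple_of_hexad hcard hV hH hH0 hy hc
  have hz' : z = a + b + d := by grind [hV y, hV c]
  have had : a ≠ d := by
    rintro rfl
    exact hz (by have : z = b := by grind [hV a]
                 rwa [this])
  have hbd : b ≠ d := by
    rintro rfl
    exact hz (by have : z = a := by grind [hV b]
                 rwa [this])
  obtain ⟨h3, h4, -⟩ := hexad_triple hV h2 hQ hHX hH hH0 hHe hyX hy ha hb hc hab hac hbc hyT
  obtain ⟨h5, h6, -⟩ := hexad_triple hV h2 hQ hHX hH hH0 hHe hzX hz ha hb hd hab had hbd hz'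
  have q : h c + h d + h y + h z = 0 :=
    quad_apply (C := {0}) hV hQ (hHX hc) (hHX hd) hyX hzX hcd (fun h => hy (h ▸ hc))
      (fun h => hy (h ▸ hd)) (by grind [hV y, hV z])
  refine ⟨c, hc, d, hd, hcd, hs, ?_, ?_⟩
  · apply mul_left_cancel₀ h2
    linear_combination q - h3 - h5 + h4 - h6
  · apply mul_left_cancel₀ h2
    linear_combination q - h3 - h5 - h4 + h6

/-- The case of three further points whose differences form a triangle in `H`: they lie in a
zero-sum `4`-set with the remaining point of a complementary triple. -/
lemma hexad_triangle [Fintype V] (hcard : Fintype.card V = 16) (hV : ∀ v : V, v + v = 0)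
    (h2 : (2 : K) ≠ 0) {X H : Finset V} {h : V → K} {e : K} (he : e ≠ 0)
    (hQ : ∀ B ⊆ X, B.card = 4 → ∑ v ∈ B, v = 0 → ∑ v ∈ B, h v = 0) (hHX : H ⊆ X)
    (hH : H.card = 6) (hH0 : ∑ v ∈ H, v = 0) (hHe : ∑ v ∈ H, h v = 2 * e) {x y z : V}
    (hxX : x ∈ X) (hx : x ∉ H) (hyX : y ∈ X) (hy : y ∉ H) (hzX : z ∈ X) (hz : z ∉ H)
    (hxy : x ≠ y) (hxz : x ≠ z) (hyz : y ≠ z) {c d d' : V} (hc : c ∈ H) (hd : d ∈ H)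
    (hd' : d' ∈ H) (hcd : c ≠ d) (hcd' : c ≠ d') (hs : c + d = x + y) (hs' : c + d' = x + z)
    (hec : h c = e) (hed : h d = e) (hed' : h d' = e) : False := by
  obtain ⟨a, ha, b, hb, hab, hac, hbc, hxT⟩ := exists_triple_of_hexad hcard hV hH hH0 hx hc
  have hy' : y = a + b + d := by grind [hV x, hV c]
  have hz' : z = a + b + d' := by grind [hV x, hV c]
  have hdd : d ≠ d' := fun h => hyz (by rw [hy', hz', h])
  have key : ∀ {u v t w : V}, w = u + v + t → u = t → v ∈ H → w ∉ H → False := by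
    intro u v t w h1 h2 h3 h4
    exact h4 (by have : w = v := by rw [h1, h2]; grind [hV t]
                 rwa [this])
  have had : a ≠ d := fun h => key hy' h hb hy
  have hbd : b ≠ d := fun h => key (by rw [hy', add_comm a b]) h ha hy
  have had' : a ≠ d' := fun h => key hz' h hb hz
  have hbd' : b ≠ d' := fun h => key (by rw [hz', add_comm a b]) h ha hz
  obtain ⟨h3, h4, h5, h6⟩ :=
    hexad_triple hV h2 hQ hHX hH hH0 hHe hxX hx ha hb hc hab hac hbc hxT
  obtain ⟨h3y, -⟩ := hexad_triple hV h2 hQ hHX hH hH0 hHe hyX hy ha hb hd hab had hbd hy'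
  obtain ⟨h3z, -⟩ := hexad_triple hV h2 hQ hHX hH hH0 hHe hzX hz ha hb hd' hab had' hbd' hz'
  -- `t` is the sixth point of `H`
  have hsub : ({d, d'} : Finset V) ⊆ H \ {a, b, c} := by
    intro v hv
    simp only [mem_insert, mem_singleton] at hv
    rcases hv with rfl | rfl
    · simp [hd, had.symm, hbd.symm, hcd.symm]
    · simp [hd', had'.symm, hbd'.symm, hcd'.symm]
  have h7 : ((H \ {a, b, c}) \ {d, d'}).card = 1 := by
    rw [card_sdiff_of_subset hsub, card_sdiff_of_subset, hH,
      card_eq_three.2 ⟨a, b, c, hab, hac, hbc, rfl⟩, card_pair hdd]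
    intro v hv
    simp only [mem_insert, mem_singleton] at hv
    rcases hv with rfl | rfl | rfl <;> assumption
  obtain ⟨t, ht⟩ := card_eq_one.1 h7
  have htH : t ∈ H := by
    have : t ∈ (H \ {a, b, c}) \ {d, d'} := by rw [ht]; exact mem_singleton_self t
    exact (mem_sdiff.1 (mem_sdiff.1 this).1).1
  have h8 := sum_sdiff (f := h) hsub
  have h9 := sum_sdiff (f := fun v => v) hsub
  rw [ht, sum_singleton, sum_pair hdd] at h8 h9
  have q : h x + h y + h z + h t = 0 :=
    quad_apply (C := {0}) hV hQ hxX hyX hzX (hHX htH) hxy hxz hyz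
      (by grind [hV x, hV d, hV d', hV t, hV c])
  have : (2 * 2) * e = 0 := by
    linear_combination h3 + h3y + h3z + h8 + h5 - q - hed - hed'
  exact he ((mul_eq_zero.1 this).resolve_left (mul_ne_zero h2 h2))

lemma add_eq_of_add_add_eq_zero {V : Type*} [AddCommGroup V] (hV : ∀ v : V, v + v = 0)
    {u v c d c' d' x y z : V} (h : u + v + (c + d + c' + d') = 0) (hs : c + d = x + y)
    (hs' : c' + d' = x + z) : u + v = y + z := by
  grind [hV x, hV u, hV v, hV c, hV d, hV c', hV d']

/-- At most two points of `X` lie outside a zero-sum `6`-set with `h`-sum `2 e ≠ 0`, if the zero-sum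
`4`-sets have `h`-sum `0`. -/
lemma card_lt_of_hexad [Fintype V] (hcard : Fintype.card V = 16) (hV : ∀ v : V, v + v = 0)
    (h2 : (2 : K) ≠ 0) {X H : Finset V} {h : V → K} {e : K} (he : e ≠ 0)
    (hQ : ∀ B ⊆ X, B.card = 4 → ∑ v ∈ B, v = 0 → ∑ v ∈ B, h v = 0) (hHX : H ⊆ X)
    (hH : H.card = 6) (hH0 : ∑ v ∈ H, v = 0) (hHe : ∑ v ∈ H, h v = 2 * e) : X.card < 9 := by
  by_contra! hX
  obtain ⟨x, hx, y, hy, z, hz, hxy, hxz, hyz⟩ := two_lt_card.1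
    (show 2 < (X \ H).card by rw [card_sdiff_of_subset hHX]; omega)
  rw [mem_sdiff] at hx hy hz
  obtain ⟨c, hc, d, hd, hcd, hs, hec, hed⟩ := hexad_edge hcard hV h2 hQ hHX hH hH0 hHe
    hx.1 hx.2 hy.1 hy.2 hxy
  obtain ⟨c', hc', d', hd', hcd', hs', hec', hed'⟩ := hexad_edge hcard hV h2 hQ hHX hH hH0 hHe
    hx.1 hx.2 hz.1 hz.2 hxz
  have T := fun {c d d' : V} => hexad_triangle hcard hV h2 he hQ hHX hH hH0 hHe hx.1 hx.2
    hy.1 hy.2 hz.1 hz.2 hxy hxz hyz (c := c) (d := d) (d' := d')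
  by_cases h1 : c = c'
  · subst h1
    exact T hc hd hd' hcd hcd' hs hs' hec hed hed'
  by_cases h3 : c = d'
  · subst h3
    exact T hc hd hc' hcd hcd'.symm hs (by rw [add_comm, hs']) hec hed hec'
  by_cases h4 : d = c'
  · subst h4
    exact T hd hc hd' hcd.symm hcd' (by rw [add_comm, hs]) hs' hed hec hed'
  by_cases h5 : d = d'
  · subst h5
    exact T hd hc hc' hcd.symm hcd'.symm (by rw [add_comm, hs]) (by rw [add_comm, hs'])
      hed hec hec'
  -- disjoint differences: then `h = e` on all of `H`
  have h4card : ({c, d, c', d'} : Finset V).card = 4 := by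
    rw [card_insert_of_notMem (by simp [hcd, h1, h3]), card_insert_of_notMem (by simp [h4, h5]),
      card_pair hcd']
  have hsub : ({c, d, c', d'} : Finset V) ⊆ H := by
    intro v hv
    simp only [mem_insert, mem_singleton] at hv
    rcases hv with rfl | rfl | rfl | rfl <;> assumption
  have h6 : (H \ {c, d, c', d'}).card = 2 := by rw [card_sdiff_of_subset hsub]; omega
  obtain ⟨u, v, huv, h7⟩ := card_eq_two.1 h6
  have huH : u ∈ H := (mem_sdiff.1 (h7 ▸ mem_insert_self u {v} : u ∈ H \ {c, d, c', d'})).1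
  have hvH : v ∈ H := (mem_sdiff.1 (h7 ▸ by simp : v ∈ H \ {c, d, c', d'})).1
  have h8 := sum_sdiff (f := fun v => v) hsub
  have h9 := sum_sdiff (f := h) hsub
  rw [h7, sum_pair huv, sum_quad h4card] at h8 h9
  obtain ⟨c'', hc'', d'', hd'', hcd'', hs'', hec'', hed''⟩ :=
    hexad_edge hcard hV h2 hQ hHX hH hH0 hHe hy.1 hy.2 hz.1 hz.2 hyz
  have huv' : h u = e ∧ h v = e := by
    rcases pair_eq_of_hexad hV hH hH0 huH hvH hc'' hd'' huv
      ((add_eq_of_add_add_eq_zero hV (h8.trans hH0) hs hs').trans hs''.symm) with ⟨rfl, rfl⟩ | ⟨rfl, rfl⟩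
    · exact ⟨hec'', hed''⟩
    · exact ⟨hed'', hec''⟩
  have : (2 * 2) * e = 0 := by
    linear_combination h9 + hHe - huv'.1 - huv'.2 - hec - hed - hec' - hed'
  exact he ((mul_eq_zero.1 this).resolve_left (mul_ne_zero h2 h2))

end Hexads

/-! ### Sets without zero-sum `6`-subsets -/

section NoHexad

/-- A set closed under `a + b + c`: in an elementary abelian `2`-group, an affine subspace (or the
empty set). -/
def TripleClosed {V : Type*} [AddCommGroup V] (A : Finset V) : Prop :=
  ∀ a ∈ A, ∀ b ∈ A, ∀ c ∈ A, a + b + c ∈ A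

lemma add_add_eq_zero_of_card_four {W : Type*} [AddCommGroup W] (hW : Nat.card W = 4)
    (hW2 : ∀ w : W, w + w = 0) {x y z : W} (hx : x ≠ 0) (hy : y ≠ 0) (hz : z ≠ 0) (hxy : x ≠ y)
    (hxz : x ≠ z) (hyz : y ≠ z) : x + y + z = 0 := by
  classical
  have : Finite W := Nat.finite_of_card_ne_zero (by omega)
  have : Fintype W := Fintype.ofFinite W
  rw [Nat.card_eq_fintype_card] at hW
  by_contra h
  have h5 : ({0, x, y, z, x + y} : Finset W).card = 5 := by
    have h1 : x + y ≠ 0 := fun h => hxy (by grind [hW2 y])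
    have h2 : x ≠ x + y := fun h => hy (by simpa using h)
    have h3 : y ≠ x + y := fun h => hx (by simpa using h)
    have h4 : z ≠ x + y := fun h' => h (by rw [← h']; exact hW2 z)
    rw [card_insert_of_notMem (by simp [hx.symm, hy.symm, hz.symm, h1.symm]),
      card_insert_of_notMem (by simp only [mem_insert, mem_singleton, not_or]; exact ⟨hxy, hxz, h2⟩),
      card_insert_of_notMem (by simp only [mem_insert, mem_singleton, not_or]; exact ⟨hyz, h3⟩),
      card_insert_of_notMem (by simpa using h4), card_singleton]
  have := card_le_univ ({0, x, y, z, x + y} : Finset W)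
  omega

variable {V : Type*} [AddCommGroup V] [DecidableEq V]

lemma sum_hexad {a b c d e f : V} {X : Finset V}
    (hno : ∀ B ⊆ X, B.card = 6 → ∑ v ∈ B, v ≠ 0) (h : ({a, b, c, d, e, f} : Finset V) ⊆ X)
    (hab : a ≠ b) (hcd : c ≠ d) (hef : e ≠ f) (h1 : a ∉ ({c, d, e, f} : Finset V))
    (h2 : b ∉ ({c, d, e, f} : Finset V)) (h3 : c ∉ ({e, f} : Finset V))
    (h4 : d ∉ ({e, f} : Finset V)) : a + b + c + d + e + f ≠ 0 := by
  have hc : c ∉ ({d, e, f} : Finset V) := by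
    rw [mem_insert, not_or]; exact ⟨hcd, h3⟩
  have ha : a ∉ ({b, c, d, e, f} : Finset V) := by
    rw [mem_insert, not_or]; exact ⟨hab, h1⟩
  have hcard : ({a, b, c, d, e, f} : Finset V).card = 6 := by
    rw [card_insert_of_notMem ha, card_insert_of_notMem h2, card_insert_of_notMem hc,
      card_insert_of_notMem h4, card_pair hef]
  have := hno _ h hcard
  rw [sum_insert ha, sum_insert h2, sum_insert hc, sum_insert h4, sum_pair hef] at this
  intro h0
  apply this
  rw [← h0]
  abel

/-- Nine points of a space of order `16` without zero-sum `6`-subset form an affine hyperplane and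
one further point. Relative to a zero-sum `4`-subset, a coset of a subgroup `D` of order `4`: if all
three other cosets of `D` are hit, or if one is hit three times and another one twice, there is a
zero-sum `6`-subset. -/
lemma exists_hyperplane_of_no_hexad [Fintype V] (hcard : Fintype.card V = 16)
    (hV : ∀ v : V, v + v = 0) {X : Finset V} (hX : 9 ≤ X.card)
    (hno : ∀ B ⊆ X, B.card = 6 → ∑ v ∈ B, v ≠ 0) :
    ∃ A q, q ∉ A ∧ X = insert q A ∧ A.card = 8 ∧ TripleClosed A := by
  classical
  obtain ⟨B, hB, C, hC, hBC, hs⟩ := exists_pair_sum_eq (z := fun v : V => v) (s := X)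
    (P := X.powersetCard 2) (t := univ) (fun _ _ _ _ h => h) (fun B hB => mem_powersetCard.1 hB)
    (fun _ _ => mem_univ _) (by
      rw [card_univ, hcard, card_powersetCard]
      exact lt_of_lt_of_le (by decide) (Nat.choose_le_choose 2 hX))
  obtain ⟨hBX, hB2⟩ := mem_powersetCard.1 hB
  obtain ⟨hCX, hC2⟩ := mem_powersetCard.1 hC
  obtain ⟨a, b, hab, rfl⟩ := card_eq_two.1 hB2
  obtain ⟨c, d, hcd, rfl⟩ := card_eq_two.1 hC2
  rw [sum_pair hab, sum_pair hcd] at hs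
  have haX : a ∈ X := hBX (by simp)
  have hbX : b ∈ X := hBX (by simp)
  have hcX : c ∈ X := hCX (by simp)
  have hdX : d ∈ X := hCX (by simp)
  have hac : a ≠ c := fun h => disjoint_left.1 hBC (show a ∈ _ by simp) (by simp [h])
  have hbc : b ≠ c := fun h => disjoint_left.1 hBC (show b ∈ _ by simp) (by simp [h])
  have hd : d = a + b + c := by grind [hV c]
  clear hB hC hB2 hC2 hBC
  -- the subgroup `D` of directions of the `4`-set and the quotient map
  let D : AddSubgroup V :=
    { carrier := {v | v = 0 ∨ v = a + b ∨ v = a + c ∨ v = b + c}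
      zero_mem' := Or.inl rfl
      add_mem' := by
        intro x y hx hy
        simp only [Set.mem_ofPred_eq] at hx hy ⊢
        grind [hV a, hV b, hV c]
      neg_mem' := by
        intro x hx
        have : -x = x := by grind [hV x]
        rwa [this] }
  have hD : ∀ v, v ∈ D ↔ v = 0 ∨ v = a + b ∨ v = a + c ∨ v = b + c := fun v => Iff.rfl
  have hab0 : a + b ≠ 0 := fun h => hab (by grind [hV b])
  have hac0 : a + c ≠ 0 := fun h => hac (by grind [hV c])
  have hbc0 : b + c ≠ 0 := fun h => hbc (by grind [hV c])
  have hD4 : Nat.card D = 4 := by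
    have : (D : Set V) = (({0, a + b, a + c, b + c} : Finset V) : Set V) := by
      ext v; simp [hD]
    rw [← SetLike.coe_sort_coe, this, Nat.card_coe_set_eq, Set.ncard_coe_finset,
      card_insert_of_notMem, card_insert_of_notMem, card_pair]
    · exact fun h => hab (add_right_cancel h)
    · simp only [mem_insert, mem_singleton, not_or]
      exact ⟨fun h => hbc (add_left_cancel h), fun h => hac (add_left_cancel ((add_comm b a).trans h))⟩
    · simp only [mem_insert, mem_singleton, not_or]
      exact ⟨hab0.symm, hac0.symm, hbc0.symm⟩
  have hW : Nat.card (V ⧸ D) = 4 := by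
    have := D.card_eq_card_quotient_mul_card_addSubgroup
    rw [hD4, Nat.card_eq_fintype_card, hcard] at this
    omega
  have hW2 : ∀ w : V ⧸ D, w + w = 0 := by
    intro w
    obtain ⟨v, rfl⟩ := QuotientAddGroup.mk_surjective w
    rw [← QuotientAddGroup.mk_add, hV, QuotientAddGroup.mk_zero]
  let ψ : V → V ⧸ D := fun v => ((v + a : V) : V ⧸ D)
  have hψ : ∀ u v, ψ u = ψ v ↔ u + v ∈ D := by
    intro u v
    have h1 : ψ u + ψ v = ((u + v : V) : V ⧸ D) := by
      simp only [ψ, ← QuotientAddGroup.mk_add]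
      congr 1
      grind [hV a]
    rw [← QuotientAddGroup.eq_zero_iff, ← h1]
    constructor
    · intro h; rw [h, hW2]
    · intro h
      rw [← add_right_cancel_iff (a := ψ v), h, hW2]
  have hψ3 : ∀ u v w, ψ (u + v + w) = ψ u + ψ v + ψ w := by
    intro u v w
    simp only [ψ, ← QuotientAddGroup.mk_add]
    congr 1
    grind [hV a]
  let Q : Finset V := {a, b, c, d}
  have hQX : Q ⊆ X := by
    intro v hv
    simp only [Q, mem_insert, mem_singleton] at hv
    rcases hv with rfl | rfl | rfl | rfl <;> assumption
  have hQ4 : Q.card = 4 := card_quad hV hab hac hbc (by rw [hd]; grind [hV a, hV b, hV c])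
  have hψ0 : ∀ v, ψ v = 0 ↔ v ∈ Q := by
    intro v
    have h1 : ψ v = 0 ↔ v + a ∈ D := QuotientAddGroup.eq_zero_iff _
    rw [h1, hD]
    simp only [Q, mem_insert, mem_singleton]
    constructor
    · rintro (h | h | h | h)
      · exact Or.inl (by grind [hV a])
      · exact Or.inr (Or.inl (by grind [hV a]))
      · exact Or.inr (Or.inr (Or.inl (by grind [hV a])))
      · exact Or.inr (Or.inr (Or.inr (by grind [hV a])))
    · rintro (h | h | h | h)
      · exact Or.inl (by grind [hV a])
      · exact Or.inr (Or.inl (by grind [hV a]))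
      · exact Or.inr (Or.inr (Or.inl (by grind [hV a])))
      · exact Or.inr (Or.inr (Or.inr (by grind [hV a])))
  have hdir : ∀ m ∈ D, a + m ∈ Q := by
    intro m hm
    rw [← hψ0]
    have : ψ (a + m) = ((m : V) : V ⧸ D) := by
      simp only [ψ]
      congr 1
      grind [hV a]
    rw [this]
    exact (QuotientAddGroup.eq_zero_iff m).2 hm
  -- one point in each of the three other cosets: with three points of `Q` they have sum zero
  have hthree : ∀ s ∈ X, ∀ u ∈ X, ∀ w ∈ X, ψ s ≠ 0 → ψ u ≠ 0 → ψ w ≠ 0 → ψ s ≠ ψ u →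
      ψ s ≠ ψ w → ψ u ≠ ψ w → False := by
    intro s hs u hu w hw hs0 hu0 hw0 hsu hsw huw
    have hz : s + u + w ∈ Q := by
      rw [← hψ0, hψ3]
      exact add_add_eq_zero_of_card_four hW hW2 hs0 hu0 hw0 hsu hsw huw
    have hT : ({s, u, w} : Finset V).card = 3 :=
      card_eq_three.2 ⟨s, u, w, fun h => hsu (by rw [h]), fun h => hsw (by rw [h]),
        fun h => huw (by rw [h]), rfl⟩
    have hdisj : Disjoint ({s, u, w} : Finset V) (Q.erase (s + u + w)) := by
      rw [disjoint_left]
      intro v hv hvQ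
      have hv0 := (hψ0 v).2 (mem_of_mem_erase hvQ)
      simp only [mem_insert, mem_singleton] at hv
      rcases hv with rfl | rfl | rfl
      · exact hs0 hv0
      · exact hu0 hv0
      · exact hw0 hv0
    refine hno ({s, u, w} ∪ Q.erase (s + u + w)) (union_subset ?_ ((erase_subset _ _).trans hQX))
      ?_ ?_
    · intro v hv
      simp only [mem_insert, mem_singleton] at hv
      rcases hv with rfl | rfl | rfl <;> assumption
    · rw [card_union_of_disjoint hdisj, hT, card_erase_of_mem hz, hQ4]
    · have h1 := add_sum_erase Q (fun v => v) hz
      have h2 : ∑ v ∈ Q, v = 0 := by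
        rw [sum_quad hQ4, hd]; grind [hV a, hV b, hV c]
      rw [sum_union hdisj, sum_insert, sum_pair, ← add_assoc, h1, h2]
      · exact fun h => huw (by rw [h])
      · simp only [mem_insert, mem_singleton, not_or]
        exact ⟨fun h => hsu (by rw [h]), fun h => hsw (by rw [h])⟩
  -- three points in one coset and two in another: two pairs with different directions in `D`,
  -- and two points of `Q`, have sum zero
  have hthree_two : ∀ s ∈ X, ∀ t ∈ X, ∀ r ∈ X, ∀ u ∈ X, ∀ w ∈ X, ψ s ≠ 0 → ψ u ≠ 0 → ψ s = ψ t →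
      ψ s = ψ r → ψ u = ψ w → ψ s ≠ ψ u → s ≠ t → s ≠ r → t ≠ r → u ≠ w → False := by
    have key : ∀ s ∈ X, ∀ t ∈ X, ∀ u ∈ X, ∀ w ∈ X, ψ s ≠ 0 → ψ u ≠ 0 → ψ s = ψ t →
        ψ u = ψ w → ψ s ≠ ψ u → s ≠ t → u ≠ w → s + t ≠ u + w → False := by
      intro s hs t ht u hu w hw hs0 hu0 hst huw hsu hst' huw' hne
      have hm : s + t + (u + w) ∈ D := D.add_mem ((hψ s t).1 hst) ((hψ u w).1 huw)
      have hmQ := hdir _ hm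
      have haQ : a ∈ Q := by simp [Q]
      have hneq : ∀ x y, ψ x ≠ ψ y → x ≠ y := fun x y h h' => h (by rw [h'])
      have h0 : ∀ x ∈ Q, ψ x = 0 := fun x hx => (hψ0 x).2 hx
      refine sum_hexad hno (a := s) (b := t) (c := u) (d := w) (e := a)
        (f := a + (s + t + (u + w))) ?_ hst' huw' ?_ ?_ ?_ ?_ ?_ ?_
      · intro v hv
        simp only [mem_insert, mem_singleton] at hv
        rcases hv with rfl | rfl | rfl | rfl | rfl | rfl
        all_goals first | assumption | exact hQX hmQ
      · intro h
        exact hne (by grind [hV u, hV w])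
      · simp only [mem_insert, mem_singleton, not_or]
        exact ⟨hneq _ _ hsu, hneq _ _ (huw ▸ hsu), hneq _ _ (h0 a haQ ▸ hs0),
          hneq _ _ (h0 _ hmQ ▸ hs0)⟩
      · simp only [mem_insert, mem_singleton, not_or]
        exact ⟨hneq _ _ (hst ▸ hsu), hneq _ _ (hst ▸ huw ▸ hsu), hneq _ _ (h0 a haQ ▸ hst ▸ hs0),
          hneq _ _ (h0 _ hmQ ▸ hst ▸ hs0)⟩
      · simp only [mem_insert, mem_singleton, not_or]
        exact ⟨hneq _ _ (h0 a haQ ▸ hu0), hneq _ _ (h0 _ hmQ ▸ hu0)⟩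
      · simp only [mem_insert, mem_singleton, not_or]
        exact ⟨hneq _ _ (h0 a haQ ▸ huw ▸ hu0), hneq _ _ (h0 _ hmQ ▸ huw ▸ hu0)⟩
      · grind [hV s, hV t, hV u, hV w, hV a]
    intro s hs t ht r hr u hu w hw hs0 hu0 hst hsr huw hsu hst' hsr' htr huw'
    by_cases h : s + t = u + w
    · refine key s hs r hr u hu w hw hs0 hu0 hsr huw hsu hsr' huw' fun h' => htr ?_
      exact add_left_cancel (h.trans h'.symm)
    · exact key s hs t ht u hu w hw hs0 hu0 hst huw hsu hst' huw' h
  have hfib : ∀ u, (univ.filter fun v => ψ v = ψ u).card ≤ 4 := by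
    intro u
    refine (card_le_card ?_).trans (card_le_four (a := u) (b := u + (a + b)) (c := u + (a + c))
      (d := u + (b + c)))
    intro v hv
    have := (hD _).1 ((hψ v u).1 (mem_filter.1 hv).2)
    simp only [mem_insert, mem_singleton]
    grind [hV u]
  let R : Finset V := X \ Q
  have hR : 5 ≤ R.card := by rw [card_sdiff_of_subset hQX]; omega
  have hR0 : ∀ v ∈ R, v ∈ X ∧ ψ v ≠ 0 := fun v hv =>
    ⟨(mem_sdiff.1 hv).1, fun h => (mem_sdiff.1 hv).2 ((hψ0 v).1 h)⟩
  have hfibR : ∀ u, (R.filter fun v => ψ v = ψ u).card ≤ 4 := fun u =>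
    (card_le_card (filter_subset_filter _ (subset_univ R))).trans (hfib u)
  -- `R` meets exactly two cosets
  obtain ⟨u, hu⟩ : R.Nonempty := card_pos.1 (by omega)
  obtain ⟨w, hw, hwu⟩ : ∃ w ∈ R, ψ w ≠ ψ u := by
    by_contra! h
    have := hfibR u
    rw [filter_true_of_mem h] at this
    omega
  have hsplit : ∀ v ∈ R, ψ v = ψ u ∨ ψ v = ψ w := by
    intro v hv
    by_contra! h
    exact hthree v (hR0 v hv).1 u (hR0 u hu).1 w (hR0 w hw).1 (hR0 v hv).2 (hR0 u hu).2
      (hR0 w hw).2 h.1 h.2 hwu.symm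
  have hRcard : (R.filter fun v => ψ v = ψ u).card + (R.filter fun v => ψ v = ψ w).card =
      R.card := by
    rw [← card_union_of_disjoint, ← filter_or, filter_true_of_mem hsplit]
    rw [disjoint_left]
    intro v hv hv'
    exact hwu ((mem_filter.1 hv').2.symm.trans (mem_filter.1 hv).2)
  have main : ∀ u ∈ R, ∀ w ∈ R, ψ w ≠ ψ u → (∀ v ∈ R, ψ v = ψ u ∨ ψ v = ψ w) →
      5 ≤ (R.filter fun v => ψ v = ψ u).card + (R.filter fun v => ψ v = ψ w).card →
      3 ≤ (R.filter fun v => ψ v = ψ u).card →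
      ∃ A q, q ∉ A ∧ X = insert q A ∧ A.card = 8 ∧ TripleClosed A := by
    intro u hu w hw hwu hsplit h5 h3
    obtain ⟨s, hs, t, ht, r, hr, hst, hsr, htr⟩ := two_lt_card.1
      (show 2 < (R.filter fun v => ψ v = ψ u).card by omega)
    rw [mem_filter] at hs ht hr
    have h1 : (R.filter fun v => ψ v = ψ w).card ≤ 1 := by
      by_contra! h
      obtain ⟨x, hx, y, hy, hxy⟩ := one_lt_card.1 h
      rw [mem_filter] at hx hy
      exact hthree_two s (hR0 s hs.1).1 t (hR0 t ht.1).1 r (hR0 r hr.1).1 x (hR0 x hx.1).1 y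
        (hR0 y hy.1).1 (hR0 s hs.1).2 (hR0 x hx.1).2 (hs.2.trans ht.2.symm)
        (hs.2.trans hr.2.symm) (hx.2.trans hy.2.symm)
        (fun h => hwu (hx.2.symm.trans (h.symm.trans hs.2))) hst hsr htr hxy
    have hw' : (R.filter fun v => ψ v = ψ w) = {w} := by
      refine (eq_of_subset_of_card_le (by simpa using hw) ?_).symm
      simpa using h1
    have hu4 : (R.filter fun v => ψ v = ψ u).card = 4 := by
      have := hfibR u
      omega
    have hfull : (R.filter fun v => ψ v = ψ u) = univ.filter fun v => ψ v = ψ u :=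
      eq_of_subset_of_card_le (filter_subset_filter _ (subset_univ R)) (by rw [hu4]; exact hfib u)
    have hA : ∀ v, v ∈ Q ∪ R.filter (fun v => ψ v = ψ u) ↔ ψ v = 0 ∨ ψ v = ψ u := by
      intro v
      rw [hfull, mem_union, hψ0]
      simp
    refine ⟨Q ∪ R.filter (fun v => ψ v = ψ u), w, ?_, ?_, ?_, ?_⟩
    · rw [hA, not_or]
      exact ⟨(hR0 w hw).2, hwu⟩
    · ext v
      rw [mem_insert, mem_union]
      constructor
      · intro hv
        by_cases hvQ : v ∈ Q
        · exact Or.inr (Or.inl hvQ)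
        · have hvR : v ∈ R := mem_sdiff.2 ⟨hv, hvQ⟩
          rcases hsplit v hvR with h | h
          · exact Or.inr (Or.inr (mem_filter.2 ⟨hvR, h⟩))
          · left
            exact mem_singleton.1 (hw' ▸ mem_filter.2 ⟨hvR, h⟩)
      · rintro (rfl | hv | hv)
        · exact (hR0 _ hw).1
        · exact hQX hv
        · exact (hR0 _ (mem_filter.1 hv).1).1
    · rw [card_union_of_disjoint, hQ4, hu4]
      rw [disjoint_left]
      intro v hv hv'
      exact (hR0 v (mem_filter.1 hv').1).2 ((hψ0 v).2 hv)
    · intro x hx y hy z hz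
      rw [hA] at hx hy hz ⊢
      rw [hψ3]
      have := hW2 (ψ u)
      rcases hx with hx | hx <;> rcases hy with hy | hy <;> rcases hz with hz | hz <;>
        simp [hx, hy, hz, this]
  rcases le_total (R.filter fun v => ψ v = ψ w).card (R.filter fun v => ψ v = ψ u).card with h | h
  · exact main u hu w hw hwu hsplit (by omega) (by omega)
  · exact main w hw u hu hwu.symm (fun v hv => (hsplit v hv).symm) (by omega) (by omega)

end NoHexad

/-! ### Affine hyperplanes and values on zero-sum sets -/

section Hyperplane

variable {V : Type*} [AddCommGroup V] [DecidableEq V]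

/-- Translation by `s + a` maps the hyperplane `A` onto its complement. -/
lemma TripleClosed.add_mem [Fintype V] (hcard : Fintype.card V = 16) (hV : ∀ v : V, v + v = 0)
    {A : Finset V} (hA : TripleClosed A) (hA8 : A.card = 8) {s t a : V} (hs : s ∉ A) (ht : t ∉ A)
    (ha : a ∈ A) : s + t + a ∈ A := by
  have h1 : A.image (fun v => v + (s + a)) = univ \ A := by
    apply eq_of_subset_of_card_le
    · intro x hx
      obtain ⟨v, hv, rfl⟩ := mem_image.1 hx
      refine mem_sdiff.2 ⟨mem_univ _, fun h => hs ?_⟩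
      have := hA _ h _ hv _ ha
      rwa [show v + (s + a) + v + a = s by grind [hV v, hV a]] at this
    · rw [card_image_of_injective _ (add_left_injective _), card_univ_sdiff, hcard, hA8]
  obtain ⟨v, hv, hvt⟩ := mem_image.1 (h1 ▸ mem_sdiff.2 ⟨mem_univ t, ht⟩)
  rwa [show s + t + a = v by grind [hV s, hV a]]

/-- A direction of the complement of a hyperplane `A` is a sum of two points of `A`, and also a sum
of four points of `A`. -/
lemma TripleClosed.exists_sums [Fintype V] (hcard : Fintype.card V = 16)
    (hV : ∀ v : V, v + v = 0) {A : Finset V} (hA : TripleClosed A) (hA8 : A.card = 8) {s t : V}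
    (hs : s ∉ A) (ht : t ∉ A) (hst : s ≠ t) :
    (∃ a ∈ A, ∃ b ∈ A, a ≠ b ∧ a + b = s + t) ∧
      ∃ C ⊆ A, C.card = 4 ∧ ∑ v ∈ C, v = s + t := by
  have hm : s + t ≠ 0 := fun h => hst (by grind [hV t])
  obtain ⟨a, ha⟩ : A.Nonempty := card_pos.1 (by omega)
  have ha' := hA.add_mem hcard hV hA8 hs ht ha
  refine ⟨⟨a, ha, _, ha', fun h => hm (by simpa using h), by grind [hV a]⟩, ?_⟩
  obtain ⟨b, hb, hb'⟩ : ∃ b ∈ A, b ∉ ({a, s + t + a} : Finset V) :=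
    exists_mem_notMem_of_card_lt_card ((card_le_two).trans_lt (by omega))
  obtain ⟨c, hc, hc'⟩ : ∃ c ∈ A, c ∉ ({a, s + t + a, b, s + t + b} : Finset V) :=
    exists_mem_notMem_of_card_lt_card ((card_le_four).trans_lt (by omega))
  simp only [mem_insert, mem_singleton, not_or] at hb' hc'
  have hd := hA _ ha' _ hb _ hc
  have h1 : a ∉ ({b, c, s + t + a + b + c} : Finset V) := by
    simp only [mem_insert, mem_singleton, not_or]
    exact ⟨Ne.symm hb'.1, Ne.symm hc'.1,
      fun h => hc'.2.2.2 (by grind [hV s, hV t, hV b])⟩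
  have h2 : b ∉ ({c, s + t + a + b + c} : Finset V) := by
    simp only [mem_insert, mem_singleton, not_or]
    exact ⟨Ne.symm hc'.2.2.1, fun h => hc'.2.1 (by grind [hV s, hV t, hV a])⟩
  have h3 : c ≠ s + t + a + b + c := fun h => hb'.2 (by grind [hV s, hV t, hV a])
  refine ⟨{a, b, c, s + t + a + b + c}, ?_, ?_, ?_⟩
  · intro v hv
    simp only [mem_insert, mem_singleton] at hv
    rcases hv with rfl | rfl | rfl | rfl <;> assumption
  · rw [card_insert_of_notMem h1, card_insert_of_notMem h2, card_pair h3]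
  · rw [sum_insert h1, sum_insert h2, sum_pair h3]
    grind [hV a, hV b, hV c]

lemma TripleClosed.six_le_card_filter {A : Finset V} (hA : TripleClosed A) (hA6 : 6 ≤ A.card)
    {a b : V} (ha : a ∈ A) (hb : b ∈ A) : 6 ≤ (A.filter fun v => v + (a + b) ∈ A).card := by
  rwa [filter_true_of_mem fun v hv => by rw [← add_assoc]; exact hA v hv a ha b hb]

variable {K : Type*} [Field K]

/-- Nine or more points such that all zero-sum `4`-subsets have `f`-sum `g` and all zero-sum
`6`-subsets have `f`-sum `g` or `2 g` form an affine hyperplane with one further point. -/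
lemma exists_hyperplane_of_sums [Fintype V] (hcard : Fintype.card V = 16)
    (hV : ∀ v : V, v + v = 0) (h2 : (2 : K) ≠ 0) {X : Finset V} {f : V → K} {g : K} (hg : g ≠ 0)
    (hX : 9 ≤ X.card) (hQ : ∀ B ⊆ X, B.card = 4 → ∑ v ∈ B, v = 0 → ∑ v ∈ B, f v = g)
    (hH : ∀ B ⊆ X, B.card = 6 → ∑ v ∈ B, v = 0 → ∑ v ∈ B, f v = g ∨ ∑ v ∈ B, f v = 2 * g) :
    ∃ A q, q ∉ A ∧ X = insert q A ∧ A.card = 8 ∧ TripleClosed A := by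
  refine exists_hyperplane_of_no_hexad hcard hV hX fun B hB hB6 hB0 => ?_
  -- the normalization `4 f - g` has sum `0` on the zero-sum `4`-sets and `± 2 g` on `6`-sets
  have hsum : ∀ C : Finset V, ∑ v ∈ C, (4 * f v - g) = 4 * ∑ v ∈ C, f v - C.card * g := by
    intro C
    rw [sum_sub_distrib, ← mul_sum, sum_const, nsmul_eq_mul]
  have hQ' : ∀ C ⊆ X, C.card = 4 → ∑ v ∈ C, v = 0 → ∑ v ∈ C, (4 * f v - g) = 0 := by
    intro C hC hC4 hC0
    rw [hsum, hQ C hC hC4 hC0, hC4]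
    push_cast
    ring
  have key : ∀ e : K, e ≠ 0 → ∑ v ∈ B, (4 * f v - g) = 2 * e → False := fun e he h =>
    absurd (card_lt_of_hexad hcard hV h2 he hQ' hB hB6 hB0 h) (not_lt.2 hX)
  rcases hH B hB hB6 hB0 with h | h
  · refine key (-g) (neg_ne_zero.2 hg) ?_
    rw [hsum, h, hB6]; push_cast; ring
  · refine key g hg ?_
    rw [hsum, h, hB6]; push_cast; ring

/-- Ten or more points contain a zero-sum `6`-subset. -/
lemma exists_hexad [Fintype V] (hcard : Fintype.card V = 16) (hV : ∀ v : V, v + v = 0)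
    {X : Finset V} (hX : 10 ≤ X.card) : ∃ B ⊆ X, B.card = 6 ∧ ∑ v ∈ B, v = 0 := by
  by_contra! hno
  obtain ⟨A, q, hq, rfl, hA8, -⟩ := exists_hyperplane_of_no_hexad hcard hV (by omega) hno
  rw [card_insert_of_notMem hq] at hX
  omega

/-- On eleven or more points whose zero-sum `4`-subsets all have `f`-sum `c` there is a zero-sum
`6`-subset, and its `f`-sum is `6 * c / 4`. -/
lemma exists_hexad_sum [Fintype V] (hcard : Fintype.card V = 16) (hV : ∀ v : V, v + v = 0)
    {X : Finset V} {f : V → K} {c : K} (hX : 11 ≤ X.card)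
    (hQ : ∀ B ⊆ X, B.card = 4 → ∑ v ∈ B, v = 0 → ∑ v ∈ B, f v = c) :
    ∃ B ⊆ X, B.card = 6 ∧ ∑ v ∈ B, v = 0 ∧ 4 * ∑ v ∈ B, f v = 6 * c := by
  obtain ⟨B, hB, hB6, hB0⟩ := exists_hexad hcard hV (X := X) (by omega)
  refine ⟨B, hB, hB6, hB0, ?_⟩
  rw [mul_sum, sum_congr rfl fun v hv => four_mul_eq_of_quads hV (by omega)
    (fun a _ b _ _ => six_le_card_filter (by omega) (a + b)) hQ (hB hv), sum_const, hB6]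
  simp

/-- If `f = g / 4` on a hyperplane `A` and `s ≠ t` lie outside `A`, then the zero-sum sets
`{s, t, a, b}` and `{s, t} ∪ C` with `a, b ∈ A`, `C ⊆ A` have `f`-sums that differ by `g / 2`. -/
lemma TripleClosed.exists_quad_hexad [Fintype V] (hcard : Fintype.card V = 16)
    (hV : ∀ v : V, v + v = 0) {A : Finset V} (hA : TripleClosed A) (hA8 : A.card = 8) {f : V → K}
    {g : K} (hf : ∀ v ∈ A, 4 * f v = g) {s t : V} (hs : s ∉ A) (ht : t ∉ A) (hst : s ≠ t) :
    ∃ B C, B ⊆ insert s (insert t A) ∧ C ⊆ insert s (insert t A) ∧ B.card = 4 ∧ C.card = 6 ∧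
      ∑ v ∈ B, v = 0 ∧ ∑ v ∈ C, v = 0 ∧ 4 * ∑ v ∈ B, f v = 4 * (f s + f t) + 2 * g ∧
      4 * ∑ v ∈ C, f v = 4 * (f s + f t) + 4 * g := by
  obtain ⟨⟨a, ha, b, hb, hab, habs⟩, C, hC, hC4, hCs⟩ := hA.exists_sums hcard hV hA8 hs ht hst
  have key : ∀ T ⊆ A, ∑ v ∈ T, v = s + t → insert s (insert t T) ⊆ insert s (insert t A) ∧
      (insert s (insert t T)).card = T.card + 2 ∧ ∑ v ∈ insert s (insert t T), v = 0 ∧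
      4 * ∑ v ∈ insert s (insert t T), f v = 4 * (f s + f t) + T.card * g := by
    intro T hT hTs
    have htT : t ∉ T := fun h => ht (hT h)
    have hsT : s ∉ insert t T := by
      rw [mem_insert, not_or]
      exact ⟨hst, fun h => hs (hT h)⟩
    refine ⟨insert_subset_insert _ (insert_subset_insert _ hT), ?_, ?_, ?_⟩
    · rw [card_insert_of_notMem hsT, card_insert_of_notMem htT]
    · rw [sum_insert hsT, sum_insert htT, hTs]
      grind [hV s, hV t]
    · rw [sum_insert hsT, sum_insert htT, mul_add, mul_add, mul_sum,
        sum_congr rfl fun v hv => hf v (hT hv), sum_const, nsmul_eq_mul]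
      ring
  have hab2 : ({a, b} : Finset V) ⊆ A := by
    intro v hv
    simp only [mem_insert, mem_singleton] at hv
    rcases hv with rfl | rfl <;> assumption
  obtain ⟨h1, h2, h3, h4⟩ := key {a, b} hab2 (by rw [sum_pair hab, habs])
  obtain ⟨h5, h6, h7, h8⟩ := key C hC hCs
  rw [card_pair hab] at h2 h4
  rw [hC4] at h6 h8
  exact ⟨_, _, h1, h5, h2, h6, h3, h7, by push_cast at h4; exact h4, by push_cast at h8; exact h8⟩

end Hyperplane

/-! ### Thirteen points with values modulo three -/

section ModThree

variable {V : Type*} [AddCommGroup V] [DecidableEq V]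

/-- If no zero-sum `4`-subset of `X` has `f`-sum `0`, every direction contains at most one pair with
`f`-sum `0`. -/
lemma eq_of_pair_sums {K : Type*} [AddCommMonoid K] (hV : ∀ v : V, v + v = 0) {X : Finset V}
    {f : V → K} (hQ : ∀ B ⊆ X, B.card = 4 → ∑ v ∈ B, v = 0 → ∑ v ∈ B, f v ≠ 0) {a b c d : V}
    (ha : a ∈ X) (hb : b ∈ X) (hc : c ∈ X) (hd : d ∈ X) (hab : a ≠ b) (hs : a + b = c + d)
    (h1 : f a + f b = 0) (h2 : f c + f d = 0) : (c = a ∧ d = b) ∨ (c = b ∧ d = a) := by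
  by_cases hac : a = c
  · subst hac
    exact Or.inl ⟨rfl, (add_left_cancel hs).symm⟩
  by_cases hbc : b = c
  · subst hbc
    rw [add_comm] at hs
    exact Or.inr ⟨rfl, (add_left_cancel hs).symm⟩
  have h3 : f a + f b + f c + f d ≠ 0 :=
    quad_apply (C := {0}ᶜ) hV hQ ha hb hc hd hab hac hbc (by grind [hV c, hV d])
  exact absurd (by rw [h1, zero_add, h2]) h3

/-- Counting the ordered pairs with `f`-sum `0`, two for each direction at most. -/
lemma card_pairs_le [Fintype V] (hcard : Fintype.card V = 16) (hV : ∀ v : V, v + v = 0)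
    {X : Finset V} {f : V → ZMod 3}
    (hQ : ∀ B ⊆ X, B.card = 4 → ∑ v ∈ B, v = 0 → ∑ v ∈ B, f v ≠ 0) :
    (X.filter fun v => f v = 0).offDiag.card +
      2 * ((X.filter fun v => f v = 1).card * (X.filter fun v => f v = 2).card) ≤ 30 := by
  let O : Finset (V × V) := X.offDiag.filter fun u => f u.1 + f u.2 = 0
  have hO : O.card ≤ 2 * (univ.erase (0 : V)).card := by
    refine card_le_mul_card_image_of_maps_to (f := fun u : V × V => u.1 + u.2) ?_ 2 ?_
    · intro u hu
      have hu := mem_offDiag.1 (mem_filter.1 hu).1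
      exact mem_erase.2 ⟨fun h => hu.2.2 (by grind [hV u.2]), mem_univ _⟩
    · intro m _
      rcases (O.filter fun u => u.1 + u.2 = m).eq_empty_or_nonempty with h | ⟨⟨a, b⟩, hab⟩
      · rw [h]; simp
      · refine (card_le_card ?_).trans (card_le_two (a := (a, b)) (b := (b, a)))
        rintro ⟨c, d⟩ hcd
        simp only [O, mem_filter, mem_offDiag] at hab hcd
        simp only [mem_insert, mem_singleton, Prod.mk.injEq]
        exact eq_of_pair_sums hV hQ hab.1.1.1 hab.1.1.2.1 hcd.1.1.1 hcd.1.1.2.1 hab.1.1.2.2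
          (hab.2.trans hcd.2.symm) hab.1.2 hcd.1.2
  rw [card_erase_of_mem (mem_univ _), card_univ, hcard] at hO
  refine le_trans ?_ hO
  have h12 : ∀ {i j : ZMod 3}, i ≠ j → i + j = 0 →
      (X.filter fun v => f v = i) ×ˢ (X.filter fun v => f v = j) ⊆ O := by
    rintro i j hij hs ⟨a, b⟩ hab
    simp only [mem_product, mem_filter] at hab
    simp only [O, mem_filter, mem_offDiag]
    refine ⟨⟨hab.1.1, hab.2.1, fun h => hij ?_⟩, by rw [hab.1.2, hab.2.2, hs]⟩
    rw [← hab.1.2, ← hab.2.2, h]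
  have h0 : (X.filter fun v => f v = 0).offDiag ⊆ O := by
    rintro ⟨a, b⟩ hab
    simp only [mem_offDiag, mem_filter] at hab
    simp only [O, mem_filter, mem_offDiag]
    exact ⟨⟨hab.1.1, hab.2.1.1, hab.2.2⟩, by rw [hab.1.2, hab.2.1.2, add_zero]⟩
  have hd1 : Disjoint ((X.filter fun v => f v = 1) ×ˢ (X.filter fun v => f v = 2))
      ((X.filter fun v => f v = 2) ×ˢ (X.filter fun v => f v = 1)) := by
    rw [disjoint_left]
    rintro ⟨a, b⟩ h h'
    simp only [mem_product, mem_filter] at h h'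
    have := h.1.2.symm.trans h'.1.2
    revert this; decide
  have hd0 : Disjoint (X.filter fun v => f v = 0).offDiag
      (((X.filter fun v => f v = 1) ×ˢ (X.filter fun v => f v = 2)) ∪
      ((X.filter fun v => f v = 2) ×ˢ (X.filter fun v => f v = 1))) := by
    rw [disjoint_left]
    rintro ⟨a, b⟩ h h'
    simp only [mem_offDiag, mem_union, mem_product, mem_filter] at h h'
    rcases h' with h' | h'
    · have := h.1.2.symm.trans h'.1.2
      revert this; decide
    · have := h.1.2.symm.trans h'.1.2
      revert this; decide
  have h3 := card_le_card (union_subset h0 (union_subset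
    (h12 (i := 1) (j := 2) (by decide) (by decide)) (h12 (i := 2) (j := 1) (by decide) (by decide))))
  rw [card_union_of_disjoint hd0, card_union_of_disjoint hd1, card_product, card_product] at h3
  linarith [mul_comm (X.filter fun v => f v = 1).card (X.filter fun v => f v = 2).card]

/-- If some value of `f` on `X` is `0`, at most eight are `1`; and eight such points form a
hyperplane. -/
lemma card_level_one_le [Fintype V] (hcard : Fintype.card V = 16) (hV : ∀ v : V, v + v = 0)
    {X : Finset V} {f : V → ZMod 3}
    (hQ : ∀ B ⊆ X, B.card = 4 → ∑ v ∈ B, v = 0 → ∑ v ∈ B, f v ≠ 0) {z : V} (hz : z ∈ X)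
    (hfz : f z = 0) : (X.filter fun v => f v = 1).card ≤ 8 ∧
      ((X.filter fun v => f v = 1).card = 8 → TripleClosed (X.filter fun v => f v = 1)) := by
  set A := X.filter fun v => f v = 1 with hA
  have hdisj : ∀ a ∈ A, Disjoint (A.image fun v => v + a) (A.image fun v => v + z) := by
    intro a ha
    rw [disjoint_left]
    intro x hx hx'
    obtain ⟨v, hv, rfl⟩ := mem_image.1 hx
    obtain ⟨w, hw, hwv⟩ := mem_image.1 hx'
    have hne : ∀ u ∈ A, u ≠ z := by
      rintro u hu rfl
      have := hfz.symm.trans (mem_filter.1 hu).2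
      revert this; decide
    have hvw : w ≠ v := by
      rintro rfl
      exact hne a ha (add_left_cancel hwv).symm
    have hwa : w ≠ a := by
      rintro rfl
      exact hne v hv (by rw [add_comm w z] at hwv; exact (add_right_cancel hwv).symm)
    have hva : v ≠ a := by
      rintro rfl
      exact hne w hw (by grind [hV v, hV z])
    rw [hA, mem_filter] at ha hv hw
    refine quad_apply (C := {0}ᶜ) hV hQ hv.1 ha.1 hw.1 hz hva hvw.symm hwa.symm
      (by grind [hV a, hV v]) ?_
    rw [hv.2, ha.2, hw.2, hfz]
    decide
  have himg : ∀ m, (A.image fun v => v + m).card = A.card := fun m =>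
    card_image_of_injective _ (add_left_injective m)
  have hle : A.card ≤ 8 := by
    rcases A.eq_empty_or_nonempty with h | ⟨a, ha⟩
    · rw [h]; simp
    · have h1 := card_le_univ ((A.image fun v => v + a) ∪ (A.image fun v => v + z))
      rw [card_union_of_disjoint (hdisj a ha), himg, himg, hcard] at h1
      omega
  refine ⟨hle, fun h8 => ?_⟩
  have hcompl : ∀ a ∈ A, (A.image fun v => v + a) = univ \ (A.image fun v => v + z) := by
    intro a ha
    apply eq_of_subset_of_card_le
    · intro x hx
      exact mem_sdiff.2 ⟨mem_univ x, disjoint_left.1 (hdisj a ha) hx⟩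
    · rw [card_univ_sdiff, himg, himg, hcard, h8]
  intro a ha b hb c hc
  have h1 : a + b ∈ A.image fun v => v + c := by
    rw [hcompl c hc, ← hcompl b hb]
    exact mem_image_of_mem _ ha
  obtain ⟨v, hv, hvab⟩ := mem_image.1 h1
  rwa [show a + b + c = v by grind [hV c]]

/-- The case of more ones than twos in `false_of_mod_three`. -/
lemma false_of_mod_three_of_le [Fintype V] (hcard : Fintype.card V = 16)
    (hV : ∀ v : V, v + v = 0) {X : Finset V} {f : V → ZMod 3} (hX : X.card = 13)
    (hQ : ∀ B ⊆ X, B.card = 4 → ∑ v ∈ B, v = 0 → ∑ v ∈ B, f v ≠ 0)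
    (hH : ∀ B ⊆ X, B.card = 6 → ∑ v ∈ B, v = 0 → ∑ v ∈ B, f v ≠ 0)
    (hle : (X.filter fun v => f v = 2).card ≤ (X.filter fun v => f v = 1).card) : False := by
  have hsum : (X.filter fun v => f v = 0).card + (X.filter fun v => f v = 1).card +
      (X.filter fun v => f v = 2).card = 13 := by
    have := card_eq_sum_card_fiberwise (s := X) (f := f) (t := univ) (fun _ _ => mem_univ _)
    rw [show (univ : Finset (ZMod 3)) = {0, 1, 2} by decide, sum_insert (by decide),
      sum_pair (by decide), hX] at this
    omega
  have hpairs := card_pairs_le hcard hV hQ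
  rw [offDiag_card] at hpairs
  have h9 : (X.filter fun v => f v = 1).card ≤ 9 := by
    by_contra! h10
    obtain ⟨B, hB, hB6, hB0⟩ := exists_hexad hcard hV h10
    refine hH B (hB.trans (filter_subset _ _)) hB6 hB0 ?_
    rw [sum_congr rfl fun v hv => (mem_filter.1 (hB hv)).2, sum_const, hB6]
    decide
  have hone : 1 ≤ (X.filter fun v => f v = 0).card → (X.filter fun v => f v = 1).card ≤ 8 := by
    intro h
    obtain ⟨z, hz⟩ := card_pos.1 h
    exact (card_level_one_le hcard hV hQ (mem_filter.1 hz).1 (mem_filter.1 hz).2).1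
  -- the counts leave two possibilities
  have hcases : (X.filter fun v => f v = 0).card = 6 ∨ ((X.filter fun v => f v = 1).card = 8 ∧
      1 ≤ (X.filter fun v => f v = 0).card) := by
    generalize (X.filter fun v => f v = 0).card = n₀ at *
    generalize (X.filter fun v => f v = 1).card = n₁ at *
    generalize (X.filter fun v => f v = 2).card = n₂ at *
    have h0 : n₀ ≤ 6 := by
      by_contra! h
      have : 7 * n₀ ≤ n₀ * n₀ := Nat.mul_le_mul_right _ h
      omega
    obtain rfl : n₂ = 13 - n₀ - n₁ := by omega
    interval_cases n₀ <;> interval_cases n₁ <;> omega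
  rcases hcases with h6 | ⟨h8, h1⟩
  -- six points with value `0`: their fifteen pairs take all fifteen directions, so that a
  -- zero-sum `4`-subset remains unless the sum of all six is zero
  · set A := X.filter fun v => f v = 0 with hA
    have hAX : A ⊆ X := filter_subset _ _
    have hA0 : ∀ B ⊆ A, ∑ v ∈ B, f v = 0 := fun B hB =>
      sum_eq_zero fun v hv => (mem_filter.1 (hB hv)).2
    have hm : ∑ v ∈ A, v ≠ 0 := fun h => hH A hAX h6 h (hA0 A subset_rfl)
    have hinj : Set.InjOn (fun B : Finset V => ∑ v ∈ B, v) (A.powersetCard 2) := by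
      intro B hB C hC hBC
      obtain ⟨hBA, hB2⟩ := mem_powersetCard.1 (mem_coe.1 hB)
      obtain ⟨hCA, hC2⟩ := mem_powersetCard.1 (mem_coe.1 hC)
      obtain ⟨a, b, hab, rfl⟩ := card_eq_two.1 hB2
      obtain ⟨c, d, hcd, rfl⟩ := card_eq_two.1 hC2
      simp only [sum_pair hab, sum_pair hcd] at hBC
      have hfab := hA0 _ hBA
      have hfcd := hA0 _ hCA
      rw [sum_pair hab] at hfab
      rw [sum_pair hcd] at hfcd
      rcases eq_of_pair_sums hV hQ (hAX (hBA (by simp))) (hAX (hBA (by simp)))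
        (hAX (hCA (by simp))) (hAX (hCA (by simp))) hab hBC hfab hfcd with
        ⟨rfl, rfl⟩ | ⟨rfl, rfl⟩
      · rfl
      · exact pair_comm _ _
    have himg : (A.powersetCard 2).image (fun B => ∑ v ∈ B, v) = univ.erase 0 := by
      apply eq_of_subset_of_card_le
      · intro x hx
        obtain ⟨B, hB, rfl⟩ := mem_image.1 hx
        obtain ⟨-, hB2⟩ := mem_powersetCard.1 hB
        obtain ⟨a, b, hab, rfl⟩ := card_eq_two.1 hB2
        rw [sum_pair hab]
        exact mem_erase.2 ⟨fun h => hab (by grind [hV b]), mem_univ _⟩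
      · rw [card_image_of_injOn hinj, card_powersetCard, h6, card_erase_of_mem (mem_univ _),
          card_univ, hcard]
        decide
    obtain ⟨B, hB, hBm⟩ := mem_image.1 (himg ▸ mem_erase.2 ⟨hm, mem_univ (∑ v ∈ A, v)⟩)
    obtain ⟨hBA, hB2⟩ := mem_powersetCard.1 hB
    refine hQ (A \ B) (sdiff_subset.trans hAX) (by rw [card_sdiff_of_subset hBA]; omega) ?_
      (hA0 _ sdiff_subset)
    have := sum_sdiff (f := fun v => v) hBA
    simpa [hBm] using this
  -- the points with value `1` form a hyperplane: all pairs of the other five points have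
  -- `f`-sum `0`, and two of these ten pairs have the same direction, one of seven
  · obtain ⟨z, hz⟩ := card_pos.1 h1
    have hcl := (card_level_one_le hcard hV hQ (mem_filter.1 hz).1 (mem_filter.1 hz).2).2 h8
    set A := X.filter fun v => f v = 1 with hA
    have hAX : A ⊆ X := filter_subset _ _
    have hW : ∀ s ∈ X \ A, ∀ t ∈ X \ A, s ≠ t → f s + f t = 0 := by
      intro s hs t ht hst
      rw [mem_sdiff] at hs ht
      obtain ⟨B, C, hB, hC, hB4, hC6, hB0, hC0, hfB, hfC⟩ := hcl.exists_quad_hexad hcard hV h8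
        (f := f) (g := 1) (fun v hv => by rw [(mem_filter.1 hv).2]; decide) hs.2 ht.2 hst
      have hsub : insert s (insert t A) ⊆ X := insert_subset hs.1 (insert_subset ht.1 hAX)
      have e1 := hQ B (hB.trans hsub) hB4 hB0
      have e2 := hH C (hC.trans hsub) hC6 hC0
      generalize f s + f t = u at *
      generalize ∑ v ∈ B, f v = u₁ at *
      generalize ∑ v ∈ C, f v = u₂ at *
      revert hfB hfC e1 e2
      clear * -
      revert u u₁ u₂
      decide
    obtain ⟨a, ha⟩ : A.Nonempty := card_pos.1 (by omega)
    obtain ⟨B, hB, C, hC, hBC, hs⟩ := exists_pair_sum_eq (z := fun v : V => v) (s := X \ A)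
      (P := (X \ A).powersetCard 2) (t := (A.image fun v => v + a).erase 0)
      (fun _ _ _ _ h => h) (fun B hB => mem_powersetCard.1 hB) (by
        intro B hB
        obtain ⟨hBX, hB2⟩ := mem_powersetCard.1 hB
        obtain ⟨s, t, hst, rfl⟩ := card_eq_two.1 hB2
        rw [sum_pair hst]
        refine mem_erase.2 ⟨fun h => hst (by grind [hV t]), mem_image.2 ⟨s + t + a, ?_, ?_⟩⟩
        · exact hcl.add_mem hcard hV h8 (mem_sdiff.1 (hBX (by simp))).2
            (mem_sdiff.1 (hBX (by simp))).2 ha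
        · grind [hV a])
      (by
        rw [card_powersetCard, card_sdiff_of_subset hAX, hX, h8, card_erase_of_mem,
          card_image_of_injective _ (add_left_injective a), h8]
        · decide
        · exact mem_image.2 ⟨a, ha, hV a⟩)
    obtain ⟨hBX, hB2⟩ := mem_powersetCard.1 hB
    obtain ⟨hCX, hC2⟩ := mem_powersetCard.1 hC
    have hf : ∀ T ⊆ X \ A, T.card = 2 → ∑ v ∈ T, f v = 0 := by
      intro T hT hT2
      obtain ⟨s, t, hst, rfl⟩ := card_eq_two.1 hT2
      rw [sum_pair hst]
      exact hW s (hT (by simp)) t (hT (by simp)) hst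
    refine hQ (B ∪ C) (union_subset (hBX.trans sdiff_subset) (hCX.trans sdiff_subset))
      (by rw [card_union_of_disjoint hBC, hB2, hC2]) ?_ ?_
    · rw [sum_union hBC, hs, hV]
    · rw [sum_union hBC, hf B hBX hB2, hf C hCX hC2, add_zero]

/-- Among thirteen points of a space of order `16` with values in `ℤ/3ℤ` there is a zero-sum set of
four or six points with zero sum of values. -/
lemma false_of_mod_three [Fintype V] (hcard : Fintype.card V = 16)
    (hV : ∀ v : V, v + v = 0) {X : Finset V} {f : V → ZMod 3} (hX : X.card = 13)
    (hQ : ∀ B ⊆ X, B.card = 4 → ∑ v ∈ B, v = 0 → ∑ v ∈ B, f v ≠ 0)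
    (hH : ∀ B ⊆ X, B.card = 6 → ∑ v ∈ B, v = 0 → ∑ v ∈ B, f v ≠ 0) : False := by
  rcases le_total (X.filter fun v => f v = 2).card (X.filter fun v => f v = 1).card with h | h
  · exact false_of_mod_three_of_le hcard hV hX hQ hH h
  · have hneg : ∀ a : ZMod 3, (-a = 1 ↔ a = 2) ∧ (-a = 2 ↔ a = 1) := by decide
    refine false_of_mod_three_of_le hcard hV (f := fun v => -f v) hX ?_ ?_ ?_
    · intro B hB h4 h0
      rw [sum_neg_distrib, neg_ne_zero]
      exact hQ B hB h4 h0
    · intro B hB h6 h0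
      rw [sum_neg_distrib, neg_ne_zero]
      exact hH B hB h6 h0
    · simpa only [hneg] using h

end ModThree

/-! ### Families of pairs -/

section PairFamilies

variable {ι V : Type*} {p : ℕ} {x : ι → V} {f : ι → ZMod p} {s : Finset ι} {P : Finset (Finset ι)}

/-- The sum of `f` over the elements of `Y` of a given class. -/
def classSum [DecidableEq V] (x : ι → V) (f : ι → ZMod p) (Y : Finset ι) (v : V) : ZMod p :=
  ∑ i ∈ Y.filter fun i => x i = v, f i

lemma classSum_apply [DecidableEq V] {Y : Finset ι} (hY : Set.InjOn x Y) {i : ι} (hi : i ∈ Y) :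
    classSum x f Y (x i) = f i := by
  have : (Y.filter fun j => x j = x i) = {i} := by
    ext j
    simp only [mem_filter, mem_singleton]
    exact ⟨fun h => hY h.1 hi h.2, fun h => by rw [h]; exact ⟨hi, rfl⟩⟩
  rw [classSum, this, sum_singleton]

variable [AddCommGroup V]

/-- A set of classes, lifted to a set of elements. -/
lemma exists_lift [DecidableEq V] {Y : Finset ι} (hY : Set.InjOn x Y) {B : Finset V}
    (hB : B ⊆ Y.image x) : ∃ C ⊆ Y, C.card = B.card ∧ ∑ i ∈ C, x i = ∑ v ∈ B, v ∧
      ∑ i ∈ C, f i = ∑ v ∈ B, classSum x f Y v := by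
  have hinj : Set.InjOn x (Y.filter fun i => x i ∈ B) :=
    hY.mono (by exact_mod_cast filter_subset _ _)
  have himg : (Y.filter fun i => x i ∈ B).image x = B := by
    ext v
    simp only [mem_image, mem_filter]
    constructor
    · rintro ⟨i, ⟨-, hi⟩, rfl⟩
      exact hi
    · intro hv
      obtain ⟨i, hi, rfl⟩ := mem_image.1 (hB hv)
      exact ⟨i, ⟨hi, hv⟩, rfl⟩
  refine ⟨Y.filter fun i => x i ∈ B, filter_subset _ _, ?_, ?_, ?_⟩
  · rw [← card_image_of_injOn hinj, himg]
  · rw [← sum_image (f := fun v => v) hinj, himg]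
  · conv_rhs => rw [← himg]
    rw [sum_image hinj]
    exact sum_congr rfl fun i hi => (classSum_apply hY (mem_filter.1 hi).1).symm

/-- No nonempty part of `s` of even size at most `2 p` has sum zero with respect to both
`x` and `f`. The pair `(x i, f i)` stands for an element of `C_2^d ⊕ C_p`, and `x i` is called the
class of `i`. -/
def NoShortEven (p : ℕ) (x : ι → V) (f : ι → ZMod p) (s : Finset ι) : Prop :=
  ∀ T ⊆ s, T.Nonempty → Even T.card → T.card ≤ 2 * p → ∑ i ∈ T, x i = 0 → ∑ i ∈ T, f i ≠ 0

/-- A family of disjoint two-element subsets of `s`, each of them with `x`-sum zero. -/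
structure PairFamily (x : ι → V) (s : Finset ι) (P : Finset (Finset ι)) : Prop where
  subset : ∀ U ∈ P, U ⊆ s
  card : ∀ U ∈ P, U.card = 2
  sum : ∀ U ∈ P, ∑ i ∈ U, x i = 0
  disjoint : (P : Set (Finset ι)).PairwiseDisjoint id

lemma PairFamily.mono (hP : PairFamily x s P) {P' : Finset (Finset ι)} (h : P' ⊆ P) :
    PairFamily x s P' :=
  ⟨fun U hU => hP.subset U (h hU), fun U hU => hP.card U (h hU), fun U hU => hP.sum U (h hU),
    hP.disjoint.subset (by exact_mod_cast h)⟩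

variable [DecidableEq ι]

lemma PairFamily.card_biUnion (hP : PairFamily x s P) : (P.biUnion id).card = 2 * P.card := by
  rw [Finset.card_biUnion fun U hU W hW h => hP.disjoint hU hW h,
    sum_congr rfl fun U hU => (hP.card U hU : (id U).card = 2), sum_const, smul_eq_mul, mul_comm]

lemma PairFamily.biUnion_subset (hP : PairFamily x s P) : P.biUnion id ⊆ s :=
  Finset.biUnion_subset.2 hP.subset

lemma PairFamily.sum_biUnion (hP : PairFamily x s P) {M : Type*} [AddCommMonoid M] (g : ι → M) :
    ∑ i ∈ P.biUnion id, g i = ∑ U ∈ P, ∑ i ∈ U, g i :=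
  Finset.sum_biUnion hP.disjoint

/-- Adjoining some of the pairs to an even zero-`x`-sum set disjoint from them. -/
lemma PairFamily.exists_union (hP : PairFamily x s P) {B : Finset ι} (hB : B ⊆ s)
    (hBP : Disjoint B (P.biUnion id)) (hBe : Even B.card) (hBx : ∑ i ∈ B, x i = 0) :
    ∃ T ⊆ s, B ⊆ T ∧ T.card = B.card + 2 * P.card ∧ Even T.card ∧ ∑ i ∈ T, x i = 0 ∧
      ∑ i ∈ T, f i = ∑ i ∈ B, f i + ∑ U ∈ P, ∑ i ∈ U, f i := by
  have hc : (B ∪ P.biUnion id).card = B.card + 2 * P.card := by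
    rw [card_union_of_disjoint hBP, hP.card_biUnion]
  refine ⟨B ∪ P.biUnion id, union_subset hB hP.biUnion_subset, subset_union_left, hc, ?_, ?_, ?_⟩
  · rw [hc]
    exact hBe.add (even_two_mul _)
  · rw [sum_union hBP, hP.sum_biUnion, hBx, zero_add]
    exact sum_eq_zero hP.sum
  · rw [sum_union hBP, hP.sum_biUnion]

lemma NoShortEven.sum_add_ne_zero (hs : NoShortEven p x f s) (hP : PairFamily x s P) {B : Finset ι}
    (hB : B ⊆ s) (hBP : Disjoint B (P.biUnion id)) (hBe : Even B.card) (hBx : ∑ i ∈ B, x i = 0)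
    {Q : Finset (Finset ι)} (hQ : Q ⊆ P) (hc : B.card + 2 * Q.card ≤ 2 * p)
    (hne : 0 < B.card + Q.card) : ∑ i ∈ B, f i + ∑ U ∈ Q, ∑ i ∈ U, f i ≠ 0 := by
  obtain ⟨T, hT, -, hTc, hTe, hTx, hTf⟩ := (hP.mono hQ).exists_union (f := f) hB
    (disjoint_of_subset_right (biUnion_subset_biUnion_of_subset_left id hQ) hBP) hBe hBx
  rw [← hTf]
  exact hs T hT (card_pos.1 (by omega)) hTe (by omega) hTx

lemma NoShortEven.sum_pairs_ne_zero (hs : NoShortEven p x f s) (hP : PairFamily x s P)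
    {Q : Finset (Finset ι)} (hQ : Q ⊆ P) (hc : Q.card ≤ p) (hne : Q.Nonempty) :
    ∑ U ∈ Q, ∑ i ∈ U, f i ≠ 0 := by
  have := hs.sum_add_ne_zero hP (empty_subset s) (disjoint_empty_left _) (by simp) (by simp) hQ
    (by rw [card_empty]; omega) (by have := hne.card_pos; omega)
  simpa using this

/-- A maximal family of pairs: no two of the remaining elements have the same class. -/
lemma exists_pairFamily (hV : ∀ v : V, v + v = 0) (x : ι → V) (s : Finset ι) :
    ∃ P, PairFamily x s P ∧ Set.InjOn x (s \ P.biUnion id : Finset ι) := by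
  classical
  induction s using Finset.strongInduction with
  | H s ih =>
    by_cases hinj : Set.InjOn x s
    · exact ⟨∅, ⟨by simp, by simp, by simp, by simp⟩, by simpa using hinj⟩
    · simp only [Set.InjOn, not_forall] at hinj
      obtain ⟨u, hu, v, hv, huv, hne⟩ := hinj
      have hu : u ∈ s := hu
      have hv : v ∈ s := hv
      have huvs : ({u, v} : Finset ι) ⊆ s := by
        intro w hw
        simp only [mem_insert, mem_singleton] at hw
        rcases hw with rfl | rfl <;> assumption
      obtain ⟨P, hP, hPi⟩ := ih (s \ {u, v}) (sdiff_ssubset huvs ⟨u, by simp⟩)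
      have hdis : ∀ U ∈ P, Disjoint {u, v} U := fun U hU =>
        disjoint_of_subset_right (hP.subset U hU) disjoint_sdiff
      have hnot : ({u, v} : Finset ι) ∉ P := fun h => by
        have := hdis _ h
        rw [disjoint_self] at this
        exact (insert_ne_empty u {v}) this
      refine ⟨insert {u, v} P, ⟨?_, ?_, ?_, ?_⟩, ?_⟩
      · intro U hU
        rcases mem_insert.1 hU with rfl | hU
        · exact huvs
        · exact (hP.subset U hU).trans sdiff_subset
      · intro U hU
        rcases mem_insert.1 hU with rfl | hU
        · exact card_pair hne
        · exact hP.card U hU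
      · intro U hU
        rcases mem_insert.1 hU with rfl | hU
        · rw [sum_pair hne, huv, hV]
        · exact hP.sum U hU
      · rw [coe_insert]
        refine hP.disjoint.insert_of_notMem hnot fun U hU => hdis U hU
      · refine hPi.mono ?_
        rw [coe_subset, biUnion_insert, id]
        intro w hw
        simp only [mem_sdiff, mem_union] at hw ⊢
        tauto

/-- The pairs in the family of a set without short even zero-sum part: fewer than `p` of them, by
the Davenport constant of `ℤ/pℤ`. -/
lemma NoShortEven.card_lt [Fact p.Prime] (hs : NoShortEven p x f s) (hP : PairFamily x s P) :
    P.card < p := by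
  by_contra! h
  obtain ⟨P', hP', hc⟩ := exists_subset_card_eq h
  obtain ⟨Q, hQ, hne, h0⟩ := exists_zeroSum_of_card (F := fun U => ∑ i ∈ U, f i) hc.ge
  exact hs.sum_pairs_ne_zero hP (hQ.trans hP') (by rw [← hc]; exact card_le_card hQ) hne h0

variable [DecidableEq V] {Y : Finset ι}

/-- If `|P| + b ≤ p`, all subsums of `P` may be added to a zero-sum set of `2 b` classes. -/
lemma NoShortEven.neg_notMem_subsetSums (hs : NoShortEven p x f s) (hP : PairFamily x s P)
    (hYs : Y ⊆ s) (hYP : Disjoint Y (P.biUnion id)) (hY : Set.InjOn x Y) {B : Finset V}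
    (hB : B ⊆ Y.image x) (hB0 : ∑ v ∈ B, v = 0) {b : ℕ} (hBb : B.card = 2 * b) (hb : 0 < b)
    (hbP : P.card + b ≤ p) :
    -∑ v ∈ B, classSum x f Y v ∉ subsetSums (fun U => ∑ i ∈ U, f i) P := by
  obtain ⟨C, hC, hCc, hCx, hCf⟩ := exists_lift (f := f) hY hB
  intro h
  obtain ⟨Q, hQ, hQs⟩ := mem_subsetSums.1 h
  have := card_le_card hQ
  refine hs.sum_add_ne_zero hP (hC.trans hYs) (disjoint_of_subset_left hC hYP)
    (by rw [hCc, hBb]; exact even_two_mul b) (by rw [hCx, hB0]) hQ (by omega) (by omega) ?_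
  rw [hCf, hQs, add_neg_cancel]

/-- If all pairs have the same sum `γ`, the `f`-sum of a zero-sum set of `2 b` classes is `k γ` for
some small positive `k`: otherwise `p - k` pairs complete it to a short zero-sum set. -/
lemma NoShortEven.exists_eq_mul [hp : Fact p.Prime] (hs : NoShortEven p x f s)
    (hP : PairFamily x s P) {γ : ZMod p} (hγ : γ ≠ 0) (hPγ : ∀ U ∈ P, ∑ i ∈ U, f i = γ)
    (hYs : Y ⊆ s) (hYP : Disjoint Y (P.biUnion id)) (hY : Set.InjOn x Y) {B : Finset V}
    (hB : B ⊆ Y.image x) (hB0 : ∑ v ∈ B, v = 0) {b : ℕ} (hBb : B.card = 2 * b) (hb : 0 < b) :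
    ∃ k : ℕ, 1 ≤ k ∧ (k < b ∨ k + P.card < p) ∧ ∑ v ∈ B, classSum x f Y v = k * γ := by
  obtain ⟨C, hC, hCc, hCx, hCf⟩ := exists_lift (f := f) hY hB
  have hp1 := hp.out.pos
  -- the residue of the quotient, chosen between `1` and `p`
  obtain ⟨k, hk1, hkp, hk⟩ : ∃ k : ℕ, 1 ≤ k ∧ k ≤ p ∧ ∑ v ∈ B, classSum x f Y v = k * γ := by
    set a := ∑ v ∈ B, classSum x f Y v
    by_cases ha : a = 0
    · exact ⟨p, hp1, le_rfl, by simp [ha]⟩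
    · refine ⟨(a / γ).val, ?_, (ZMod.val_lt _).le, ?_⟩
      · rw [Nat.one_le_iff_ne_zero, Ne, ZMod.val_eq_zero]
        exact div_ne_zero ha hγ
      · rw [ZMod.natCast_zmod_val, div_mul_cancel₀ _ hγ]
  refine ⟨k, hk1, ?_, hk⟩
  by_contra! h
  obtain ⟨Q, hQ, hQc⟩ := exists_subset_card_eq (show p - k ≤ P.card by omega)
  refine hs.sum_add_ne_zero hP (hC.trans hYs) (disjoint_of_subset_left hC hYP)
    (by rw [hCc, hBb]; exact even_two_mul b) (by rw [hCx, hB0]) hQ (by omega) (by omega) ?_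
  rw [hCf, hk, sum_congr rfl fun U hU => hPγ U (hQ hU), sum_const, hQc, nsmul_eq_mul,
    Nat.cast_sub hkp, ZMod.natCast_self]
  ring

end PairFamilies

/-! ### Few values on zero-sum sets -/

section Values

variable {V : Type*} [AddCommGroup V] [DecidableEq V]

lemma sum_union_zero {B C : Finset V} (h : Disjoint B C) (hB : ∑ v ∈ B, v = 0)
    (hC : ∑ v ∈ C, v = 0) : ∑ v ∈ B ∪ C, v = 0 := by
  rw [sum_union h, hB, hC, add_zero]

variable [Fintype V]

/-- Eleven or more points contain a zero-sum `4`-subset. -/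
lemma exists_quad (hcard : Fintype.card V = 16) (hV : ∀ v : V, v + v = 0) {X : Finset V}
    (hX : 11 ≤ X.card) : ∃ B ⊆ X, B.card = 4 ∧ ∑ v ∈ B, v = 0 := by
  by_contra! h
  obtain ⟨a, ha⟩ := card_pos.1 (show 0 < X.card by omega)
  -- otherwise the zero function would satisfy any condition on such sets
  have := four_mul_eq_of_quads (f := fun _ => (0 : ℚ)) (c := 1) hV (by omega)
    (fun a _ b _ _ => six_le_card_filter (by omega) (a + b)) (fun B hB h4 h0 => (h B hB h4 h0).elim)
    ha
  norm_num at this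

variable {K : Type*} [Field K] {X : Finset V} {f : V → K} {γ : K}

/-- If `4`- and `6`-subsets of sum zero allow a single value only, that value is zero: a `6`-subset
has `3 / 2` times the value of a `4`-subset. -/
lemma exists_hexad_of_eq (hcard : Fintype.card V = 16) (hV : ∀ v : V, v + v = 0) (h2 : (2 : K) ≠ 0)
    (hX : 11 ≤ X.card) {E : Finset K} (hE : E.card ≤ 1)
    (hQ : ∀ B ⊆ X, B.card = 4 → ∑ v ∈ B, v = 0 → ∑ v ∈ B, f v ∈ E)
    (hH : ∀ B ⊆ X, B.card = 6 → ∑ v ∈ B, v = 0 → ∑ v ∈ B, f v ∈ E) : (0 : K) ∈ E := by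
  obtain ⟨Q, hQX, hQ4, hQ0⟩ := exists_quad hcard hV hX
  have hQE := hQ Q hQX hQ4 hQ0
  set e := ∑ v ∈ Q, f v
  have heq : ∀ a ∈ E, a = e := fun a ha => card_le_one.1 hE a ha e hQE
  obtain ⟨B, hBX, hB6, hB0, hB⟩ := exists_hexad_sum (f := f) (c := e) hcard hV hX
    fun B h1 h2 h3 => heq _ (hQ B h1 h2 h3)
  rw [heq _ (hH B hBX hB6 hB0)] at hB
  have : 2 * e = 0 := by linear_combination -hB
  rw [(mul_eq_zero.1 this).resolve_left h2] at hQE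
  exact hQE

/-- Two nonzero values for the zero-sum `4`-, `6`- and `8`-subsets do not suffice: with the value
`a` of a `4`-subset, also `3 / 2 * a` and `2 * a` occur. -/
lemma false_of_two_values (hcard : Fintype.card V = 16) (hV : ∀ v : V, v + v = 0)
    (h2 : (2 : K) ≠ 0) (hX : 15 ≤ X.card) {E : Finset K} (hE : E.card ≤ 2) (hE0 : (0 : K) ∉ E)
    (hQ : ∀ B ⊆ X, B.card = 4 → ∑ v ∈ B, v = 0 → ∑ v ∈ B, f v ∈ E)
    (hH : ∀ B ⊆ X, B.card = 6 → ∑ v ∈ B, v = 0 → ∑ v ∈ B, f v ∈ E)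
    (hO : ∀ B ⊆ X, B.card = 8 → ∑ v ∈ B, v = 0 → ∑ v ∈ B, f v ∈ E) : False := by
  classical
  obtain ⟨Q, hQX, hQ4, hQ0⟩ := exists_quad hcard hV (show 11 ≤ X.card by omega)
  have hQE := hQ Q hQX hQ4 hQ0
  set a := ∑ v ∈ Q, f v with ha
  have ha0 : a ≠ 0 := fun h => hE0 (h ▸ hQE)
  -- for a `4`-subset of value `b` disjoint from `Q`, the values `a`, `b`, `a + b` are in `E`
  have hoff : ∀ B ⊆ X \ Q, B.card = 4 → ∑ v ∈ B, v = 0 → ∑ v ∈ B, f v = a := by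
    intro B hB hB4 hB0
    have hBX := hB.trans sdiff_subset
    have hd : Disjoint Q B := disjoint_of_subset_right hB disjoint_sdiff
    have hBE := hQ B hBX hB4 hB0
    have hO' := hO (Q ∪ B) (union_subset hQX hBX) (by rw [card_union_of_disjoint hd, hQ4, hB4])
      (sum_union_zero hd hQ0 hB0)
    rw [sum_union hd, ← ha] at hO'
    set b := ∑ v ∈ B, f v
    have hb0 : b ≠ 0 := fun h => hE0 (h ▸ hBE)
    by_contra hne
    have h3 : ({a, b, a + b} : Finset K).card = 3 :=
      card_eq_three.2 ⟨a, b, a + b, Ne.symm hne, by simpa using hb0, by simpa using ha0,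
        rfl⟩
    have : ({a, b, a + b} : Finset K) ⊆ E := by
      intro c hc
      simp only [mem_insert, mem_singleton] at hc
      rcases hc with rfl | rfl | rfl <;> assumption
    have := card_le_card this
    omega
  have hc11 : 11 ≤ (X \ Q).card := by rw [card_sdiff_of_subset hQX]; omega
  obtain ⟨Q', hQ'X, hQ'4, hQ'0⟩ := exists_quad hcard hV hc11
  have hd : Disjoint Q Q' := disjoint_of_subset_right hQ'X disjoint_sdiff
  have h2a := hO (Q ∪ Q') (union_subset hQX (hQ'X.trans sdiff_subset))
    (by rw [card_union_of_disjoint hd, hQ4, hQ'4]) (sum_union_zero hd hQ0 hQ'0)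
  rw [sum_union hd, hoff Q' hQ'X hQ'4 hQ'0, ← ha] at h2a
  obtain ⟨B, hBX, hB6, hB0, hB⟩ := exists_hexad_sum (f := f) (c := a) hcard hV hc11 hoff
  have hBE := hH B (hBX.trans sdiff_subset) hB6 hB0
  set h := ∑ v ∈ B, f v
  have h2a0 : 2 * a ≠ 0 := mul_ne_zero h2 ha0
  have hha : h ≠ a := fun h' => h2a0 (by rw [h'] at hB; linear_combination -hB)
  have hh2 : h ≠ a + a := fun h' => h2a0 (by rw [h'] at hB; linear_combination hB)
  have h3 : ({a, h, a + a} : Finset K).card = 3 :=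
    card_eq_three.2 ⟨a, h, a + a, hha.symm, by simpa using ha0, hh2, rfl⟩
  have : ({a, h, a + a} : Finset K) ⊆ E := by
    intro c hc
    simp only [mem_insert, mem_singleton] at hc
    rcases hc with rfl | rfl | rfl <;> assumption
  have := card_le_card this
  omega

lemma false_of_quads_eq (hcard : Fintype.card V = 16) (hV : ∀ v : V, v + v = 0) (h2 : (2 : K) ≠ 0)
    (h3 : (3 : K) ≠ 0) (hγ : γ ≠ 0) (hX : 11 ≤ X.card)
    (hQ : ∀ B ⊆ X, B.card = 4 → ∑ v ∈ B, v = 0 → ∑ v ∈ B, f v = γ)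
    (hH : ∀ B ⊆ X, B.card = 6 → ∑ v ∈ B, v = 0 →
      ∑ v ∈ B, f v = γ ∨ ∑ v ∈ B, f v = 2 * γ ∨ ∑ v ∈ B, f v = 3 * γ) : False := by
  have h2γ : 2 * γ ≠ 0 := mul_ne_zero h2 hγ
  have h6γ : 6 * γ ≠ 0 := by
    have := mul_ne_zero h3 h2γ
    rwa [← mul_assoc, show (3 : K) * 2 = 6 by norm_num] at this
  obtain ⟨B, hBX, hB6, hB0, hB⟩ := exists_hexad_sum hcard hV hX hQ
  rcases hH B hBX hB6 hB0 with h | h | h <;> rw [h] at hB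
  · exact h2γ (by linear_combination -hB)
  · exact h2γ (by linear_combination hB)
  · exact h6γ (by linear_combination hB)

/-- The values `γ, 2 γ` for `4`- and `6`-subsets and `γ, 2 γ, 3 γ` for `8`-subsets are not enough on
thirteen points. A `4`-subset `Q` of value `2 γ` forces the value `γ` on all `4`-subsets off `Q`, so
that these nine points consist of a hyperplane and one further point. Two points outside the
hyperplane then give a `4`- and a `6`-subset whose values differ by `γ / 2`. -/
lemma false_of_values_le_two (hcard : Fintype.card V = 16) (hV : ∀ v : V, v + v = 0)
    (h2 : (2 : K) ≠ 0) (h3 : (3 : K) ≠ 0) (hγ : γ ≠ 0) (hX : 13 ≤ X.card)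
    (hQ : ∀ B ⊆ X, B.card = 4 → ∑ v ∈ B, v = 0 → ∑ v ∈ B, f v = γ ∨ ∑ v ∈ B, f v = 2 * γ)
    (hH : ∀ B ⊆ X, B.card = 6 → ∑ v ∈ B, v = 0 → ∑ v ∈ B, f v = γ ∨ ∑ v ∈ B, f v = 2 * γ)
    (hO : ∀ B ⊆ X, B.card = 8 → ∑ v ∈ B, v = 0 →
      ∑ v ∈ B, f v = γ ∨ ∑ v ∈ B, f v = 2 * γ ∨ ∑ v ∈ B, f v = 3 * γ) : False := by
  have h2γ : 2 * γ ≠ 0 := mul_ne_zero h2 hγ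
  have h3γ : 3 * γ ≠ 0 := mul_ne_zero h3 hγ
  have h6γ : 6 * γ ≠ 0 := by
    have := mul_ne_zero h3 h2γ
    rwa [← mul_assoc, show (3 : K) * 2 = 6 by norm_num] at this
  by_cases hall : ∀ B ⊆ X, B.card = 4 → ∑ v ∈ B, v = 0 → ∑ v ∈ B, f v = γ
  · exact false_of_quads_eq hcard hV h2 h3 hγ (by omega) hall fun B h h' h'' =>
      (hH B h h' h'').imp_right Or.inl
  push Not at hall
  obtain ⟨Q, hQX, hQ4, hQ0, hQne⟩ := hall
  have hQ2 := (hQ Q hQX hQ4 hQ0).resolve_left hQne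
  have hoff : ∀ B ⊆ X \ Q, B.card = 4 → ∑ v ∈ B, v = 0 → ∑ v ∈ B, f v = γ := by
    intro B hB hB4 hB0
    have hBX := hB.trans sdiff_subset
    have hd : Disjoint Q B := disjoint_of_subset_right hB disjoint_sdiff
    refine (hQ B hBX hB4 hB0).resolve_right fun hB2 => ?_
    have hO' := hO (Q ∪ B) (union_subset hQX hBX) (by rw [card_union_of_disjoint hd, hQ4, hB4])
      (sum_union_zero hd hQ0 hB0)
    rw [sum_union hd, hQ2, hB2] at hO'
    rcases hO' with h | h | h
    · exact h3γ (by linear_combination h)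
    · exact h2γ (by linear_combination h)
    · exact hγ (by linear_combination h)
  obtain ⟨A, q, hq, hXA, hA8, hA⟩ := exists_hyperplane_of_sums hcard hV h2 hγ
    (by rw [card_sdiff_of_subset hQX]; omega) hoff fun B hB => hH B (hB.trans sdiff_subset)
  have hAX : A ⊆ X \ Q := by rw [hXA]; exact subset_insert _ _
  have hA4 : ∀ v ∈ A, 4 * f v = γ := fun v hv =>
    four_mul_eq_of_quads hV (by omega)
      (fun a ha b hb _ => hA.six_le_card_filter (by omega) ha hb) (fun B hB => hoff B (hB.trans hAX)) hv
  have hAX' := hAX.trans sdiff_subset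
  obtain ⟨s, hs, t, ht, hst⟩ := one_lt_card.1
    (show 1 < (X \ A).card by rw [card_sdiff_of_subset hAX']; omega)
  rw [mem_sdiff] at hs ht
  have hsub : insert s (insert t A) ⊆ X :=
    insert_subset hs.1 (insert_subset ht.1 hAX')
  obtain ⟨B, C, hBs, hCs, hB4, hC6, hB0, hC0, hBf, hCf⟩ :=
    hA.exists_quad_hexad hcard hV hA8 hA4 hs.2 ht.2 hst
  rcases hQ B (hBs.trans hsub) hB4 hB0 with hb | hb <;>
    rcases hH C (hCs.trans hsub) hC6 hC0 with hc | hc <;> rw [hb] at hBf <;> rw [hc] at hCf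
  · exact h2γ (by linear_combination hBf - hCf)
  · exact h2γ (by linear_combination hCf - hBf)
  · exact h6γ (by linear_combination hBf - hCf)
  · exact h2γ (by linear_combination hBf - hCf)

/-- The analogue of `false_of_values_le_two` for fifteen points and the values `γ, 2 γ, 3 γ`. Off a
`4`-subset of value at least `2 γ` there are eleven points whose `4`-subsets have a common value. -/
lemma false_of_values_le_three (hcard : Fintype.card V = 16) (hV : ∀ v : V, v + v = 0)
    (h2 : (2 : K) ≠ 0) (h3 : (3 : K) ≠ 0) (hγ : γ ≠ 0) (hX : 15 ≤ X.card)
    (hQ : ∀ B ⊆ X, B.card = 4 → ∑ v ∈ B, v = 0 →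
      ∑ v ∈ B, f v = γ ∨ ∑ v ∈ B, f v = 2 * γ ∨ ∑ v ∈ B, f v = 3 * γ)
    (hH : ∀ B ⊆ X, B.card = 6 → ∑ v ∈ B, v = 0 →
      ∑ v ∈ B, f v = γ ∨ ∑ v ∈ B, f v = 2 * γ ∨ ∑ v ∈ B, f v = 3 * γ)
    (hO : ∀ B ⊆ X, B.card = 8 → ∑ v ∈ B, v = 0 →
      ∑ v ∈ B, f v = γ ∨ ∑ v ∈ B, f v = 2 * γ ∨ ∑ v ∈ B, f v = 3 * γ)
    (hD : ∀ B ⊆ X, B.card = 10 → ∑ v ∈ B, v = 0 → ∑ v ∈ B, f v = γ ∨ ∑ v ∈ B, f v = 2 * γ ∨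
      ∑ v ∈ B, f v = 3 * γ ∨ ∑ v ∈ B, f v = 4 * γ) : False := by
  have h2γ : 2 * γ ≠ 0 := mul_ne_zero h2 hγ
  have h3γ : 3 * γ ≠ 0 := mul_ne_zero h3 hγ
  have h4γ : 4 * γ ≠ 0 := by
    have := mul_ne_zero h2 h2γ
    rwa [← mul_assoc, show (2 : K) * 2 = 4 by norm_num] at this
  have h6γ : 6 * γ ≠ 0 := by
    have := mul_ne_zero h3 h2γ
    rwa [← mul_assoc, show (3 : K) * 2 = 6 by norm_num] at this
  by_cases hall : ∀ B ⊆ X, B.card = 4 → ∑ v ∈ B, v = 0 → ∑ v ∈ B, f v = γ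
  · exact false_of_quads_eq hcard hV h2 h3 hγ (by omega) hall hH
  push Not at hall
  obtain ⟨Q, hQX, hQ4, hQ0, hQne⟩ := hall
  have hX11 : 11 ≤ (X \ Q).card := by rw [card_sdiff_of_subset hQX]; omega
  have hO' : ∀ B ⊆ X \ Q, B.card = 4 → ∑ v ∈ B, v = 0 →
      ∑ v ∈ Q, f v + ∑ v ∈ B, f v = γ ∨ ∑ v ∈ Q, f v + ∑ v ∈ B, f v = 2 * γ ∨
        ∑ v ∈ Q, f v + ∑ v ∈ B, f v = 3 * γ := by
    intro B hB hB4 hB0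
    have hd : Disjoint Q B := disjoint_of_subset_right hB disjoint_sdiff
    have hO' := hO (Q ∪ B) (union_subset hQX (hB.trans sdiff_subset))
      (by rw [card_union_of_disjoint hd, hQ4, hB4]) (sum_union_zero hd hQ0 hB0)
    rwa [sum_union hd] at hO'
  -- unless the characteristic is `5`, all `4`-subsets off `Q` have the value `γ`
  have key : (∀ B ⊆ X \ Q, B.card = 4 → ∑ v ∈ B, v = 0 → ∑ v ∈ B, f v = γ) ∨
      ((5 : K) = 0 ∧ ∑ v ∈ Q, f v = 3 * γ ∧
        ∀ B ⊆ X \ Q, B.card = 4 → ∑ v ∈ B, v = 0 → ∑ v ∈ B, f v = 3 * γ) := by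
    rcases (hQ Q hQX hQ4 hQ0).resolve_left hQne with hq | hq
    · refine Or.inl fun B hB hB4 hB0 => ?_
      have h := hO' B hB hB4 hB0
      rw [hq] at h
      rcases hQ B (hB.trans sdiff_subset) hB4 hB0 with hb | hb | hb
      · exact hb
      all_goals
        exfalso
        rw [hb] at h
        rcases h with h | h | h
      · exact h3γ (by linear_combination h)
      · exact h2γ (by linear_combination h)
      · exact hγ (by linear_combination h)
      · exact h4γ (by linear_combination h)
      · exact h3γ (by linear_combination h)
      · exact h2γ (by linear_combination h)
    · have hoff : ∀ B ⊆ X \ Q, B.card = 4 → ∑ v ∈ B, v = 0 →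
          (5 : K) = 0 ∧ ∑ v ∈ B, f v = 3 * γ := by
        intro B hB hB4 hB0
        have h := hO' B hB hB4 hB0
        rw [hq] at h
        rcases hQ B (hB.trans sdiff_subset) hB4 hB0 with hb | hb | hb <;> rw [hb] at h ⊢ <;>
          rcases h with h | h | h
        · exact (h3γ (by linear_combination h)).elim
        · exact (h2γ (by linear_combination h)).elim
        · exact (hγ (by linear_combination h)).elim
        · exact (h4γ (by linear_combination h)).elim
        · exact (h3γ (by linear_combination h)).elim
        · exact (h2γ (by linear_combination h)).elim
        · have : 5 * γ = 0 := by linear_combination h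
          exact ⟨(mul_eq_zero.1 this).resolve_right hγ, rfl⟩
        · exact (h4γ (by linear_combination h)).elim
        · exact (h3γ (by linear_combination h)).elim
      obtain ⟨Q', hQ'X, hQ'4, hQ'0⟩ := exists_quad hcard hV hX11
      exact Or.inr ⟨(hoff Q' hQ'X hQ'4 hQ'0).1, hq, fun B hB h4 h0 => (hoff B hB h4 h0).2⟩
  rcases key with key | ⟨h5, hq, key⟩
  · exact false_of_quads_eq hcard hV h2 h3 hγ hX11 key fun B hB => hH B (hB.trans sdiff_subset)
  obtain ⟨B, hBX, hB6, hB0, hB⟩ := exists_hexad_sum hcard hV hX11 key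
  have hBX' := hBX.trans sdiff_subset
  have hd : Disjoint Q B := disjoint_of_subset_right hBX disjoint_sdiff
  have h := hD (Q ∪ B) (union_subset hQX hBX') (by rw [card_union_of_disjoint hd, hQ4, hB6])
    (sum_union_zero hd hQ0 hB0)
  rw [sum_union hd, hq] at h
  rcases hH B hBX' hB6 hB0 with hb | hb | hb <;> rw [hb] at h hB
  · exact hγ (by linear_combination 3 * h5 * γ + hB)
  · rcases h with h | h | h | h
    · exact h4γ (by linear_combination h)
    · exact h3γ (by linear_combination h)
    · exact h2γ (by linear_combination h)
    · exact hγ (by linear_combination h)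
  · exact h6γ (by linear_combination -hB)

end Values

/-! ### Sets without short even zero-sum parts -/

section Structure

variable {ι V : Type*} [DecidableEq ι] [AddCommGroup V] {p : ℕ} {x : ι → V} {f : ι → ZMod p}
  {s : Finset ι} {P : Finset (Finset ι)}

/-- The partner of an element of a pair. -/
lemma PairFamily.exists_eq_pair (hV : ∀ v : V, v + v = 0) (hP : PairFamily x s P) {U : Finset ι}
    (hU : U ∈ P) {u : ι} (hu : u ∈ U) : ∃ w, u ≠ w ∧ U = {u, w} ∧ x u = x w := by
  obtain ⟨a, b, hab, rfl⟩ := card_eq_two.1 (hP.card U hU)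
  have hs := hP.sum _ hU
  rw [sum_pair hab] at hs
  have hx : x a = x b := by
    have := hV (x b)
    rw [← hs] at this
    exact (add_right_cancel this).symm
  rcases mem_insert.1 hu with rfl | hu
  · exact ⟨b, hab, rfl, hx⟩
  · rw [mem_singleton] at hu
    subst hu
    exact ⟨a, hab.symm, pair_comm _ _, hx.symm⟩

/-- One element of a pair may be exchanged for another element of the same class. -/
lemma PairFamily.replace (hV : ∀ v : V, v + v = 0) (hP : PairFamily x s P) {U : Finset ι}
    (hU : U ∈ P) {u i : ι} (hu : u ∈ U) (hi : i ∈ s) (hiP : i ∉ P.biUnion id) (hx : x i = x u) :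
    PairFamily x s (insert {u, i} (P.erase U)) ∧ {u, i} ∉ P.erase U := by
  have hui : u ≠ i := by
    rintro rfl
    exact hiP (mem_biUnion.2 ⟨U, hU, hu⟩)
  have hdis : ∀ W ∈ P.erase U, Disjoint {u, i} W := by
    intro W hW
    rw [mem_erase] at hW
    rw [disjoint_left]
    intro j hj hjW
    rcases mem_insert.1 hj with rfl | hj
    · exact disjoint_left.1 (hP.disjoint hU hW.2 hW.1.symm) hu hjW
    · rw [mem_singleton] at hj
      subst hj
      exact hiP (mem_biUnion.2 ⟨W, hW.2, hjW⟩)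
  have hnot : ({u, i} : Finset ι) ∉ P.erase U := fun h => by
    have := hdis _ h
    rw [disjoint_self] at this
    exact insert_ne_empty u {i} this
  have hE := hP.mono (erase_subset U P)
  refine ⟨⟨?_, ?_, ?_, ?_⟩, hnot⟩
  · intro W hW
    rcases mem_insert.1 hW with rfl | hW
    · exact insert_subset (hP.subset U hU hu) (singleton_subset_iff.2 hi)
    · exact hE.subset W hW
  · intro W hW
    rcases mem_insert.1 hW with rfl | hW
    · exact card_pair hui
    · exact hE.card W hW
  · intro W hW
    rcases mem_insert.1 hW with rfl | hW
    · rw [sum_pair hui, hx, hV]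
    · exact hE.sum W hW
  · rw [coe_insert]
    exact hE.disjoint.insert_of_notMem hnot fun W hW => hdis W hW

variable [Fact p.Prime]

/-- In a family of `p - 1` pairs all pairs have the same sum. -/
lemma NoShortEven.sum_pair_eq (hs : NoShortEven p x f s) (hP : PairFamily x s P)
    (hc : P.card + 1 = p) {U W : Finset ι} (hU : U ∈ P) (hW : W ∈ P) :
    ∑ i ∈ U, f i = ∑ i ∈ W, f i :=
  eq_of_zeroSumFree (F := fun U => ∑ i ∈ U, f i) hc.ge
    (fun Q hQ hne => hs.sum_pairs_ne_zero hP hQ (by have := card_le_card hQ; omega) hne) hU hW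

/-- In a family of `p - 1` pairs, an element which is left over and has the class of a pair has
half of the common sum as value, and so do the elements of the pair. -/
lemma NoShortEven.two_mul_eq (hV : ∀ v : V, v + v = 0) (hp3 : 3 ≤ p) (hs : NoShortEven p x f s)
    (hP : PairFamily x s P) (hc : P.card + 1 = p) {γ : ZMod p}
    (hγ : ∀ U ∈ P, ∑ i ∈ U, f i = γ) {U : Finset ι} (hU : U ∈ P) {u i : ι} (hu : u ∈ U)
    (hi : i ∈ s) (hiP : i ∉ P.biUnion id) (hx : x i = x u) : 2 * f i = γ ∧ 2 * f u = γ := by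
  have key : ∀ u ∈ U, x i = x u → f u + f i = γ := by
    intro u hu hx
    obtain ⟨hP', hnot⟩ := hP.replace hV hU hu hi hiP hx
    have hce : (P.erase U).card + 1 = P.card := card_erase_add_one hU
    obtain ⟨W, hW⟩ := card_pos.1 (show 0 < (P.erase U).card by omega)
    have h := hs.sum_pair_eq hP' (by rw [card_insert_of_notMem hnot, hce, hc])
      (mem_insert_self {u, i} _) (mem_insert_of_mem hW)
    rw [hγ W (mem_of_mem_erase hW), sum_pair] at h
    · exact h
    · rintro rfl
      exact hiP (mem_biUnion.2 ⟨U, hU, hu⟩)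
  obtain ⟨w, huw, rfl, hxw⟩ := hP.exists_eq_pair hV hU hu
  have h1 := key u (mem_insert_self _ _) hx
  have h2 := key w (by simp) (hx.trans hxw)
  have h3 := hγ _ hU
  rw [sum_pair huw] at h3
  exact ⟨by linear_combination h1 + h2 - h3, by linear_combination h1 - h2 + h3⟩

variable [DecidableEq V] {Y : Finset ι}

/-- The possible values of zero-sum sets of `2 b` classes, for a family of pairs with a common
sum. -/
lemma NoShortEven.exists_eq_mul' (hs : NoShortEven p x f s)
    (hP : PairFamily x s P) {γ : ZMod p} (hγ : γ ≠ 0) (hPγ : ∀ U ∈ P, ∑ i ∈ U, f i = γ)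
    (hYs : Y ⊆ s) (hYP : Disjoint Y (P.biUnion id)) (hY : Set.InjOn x Y) {B : Finset V}
    (hB : B ⊆ Y.image x) {c : ℕ} (hBc : B.card = c) (hB0 : ∑ v ∈ B, v = 0) {b : ℕ}
    (hcb : c = 2 * b) (hb : 0 < b) {m : ℕ} (hbm : b ≤ m + 1) (hm : p ≤ P.card + m + 1) :
    ∃ k : ℕ, 1 ≤ k ∧ k ≤ m ∧ ∑ v ∈ B, classSum x f Y v = k * γ := by
  obtain ⟨k, hk1, hk, h⟩ :=
    hs.exists_eq_mul hP hγ hPγ hYs hYP hY hB hB0 (hBc.trans hcb) hb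
  exact ⟨k, hk1, by omega, h⟩

/-- Setting free one element of a pair, in case its class does not occur among the other
elements. -/
lemma PairFamily.insert_free (hP : PairFamily x s P) {U : Finset ι} (hU : U ∈ P) {u : ι}
    (hu : u ∈ U) (hYs : Y ⊆ s) (hYP : Disjoint Y (P.biUnion id)) (hY : Set.InjOn x Y) (hux : x u ∉ Y.image x) :
    PairFamily x s (P.erase U) ∧ (P.erase U).card + 1 = P.card ∧ insert u Y ⊆ s ∧
      Disjoint (insert u Y) ((P.erase U).biUnion id) ∧ Set.InjOn x (insert u Y : Finset ι) ∧
      ((insert u Y).image x).card = Y.card + 1 := by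
  have hinj : Set.InjOn x (insert u Y : Finset ι) := by
    rw [coe_insert, Set.injOn_insert]
    · refine ⟨hY, fun h => hux ?_⟩
      rw [← mem_coe, coe_image]
      exact h
    · exact fun h => hux (mem_image_of_mem x h)
  refine ⟨hP.mono (erase_subset _ _), card_erase_add_one hU,
    insert_subset (hP.subset U hU hu) hYs, ?_, hinj, ?_⟩
  · rw [disjoint_insert_left]
    refine ⟨fun h => ?_, disjoint_of_subset_right
      (biUnion_subset_biUnion_of_subset_left id (erase_subset _ _)) hYP⟩
    obtain ⟨W, hW, huW⟩ := mem_biUnion.1 h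
    rw [mem_erase] at hW
    exact disjoint_left.1 (hP.disjoint hU hW.2 hW.1.symm) hu huW
  · rw [card_image_of_injOn hinj, card_insert_of_notMem fun h => hux (mem_image_of_mem x h)]

variable [Fintype V]

/-- Over `C_2^3 ⊕ C_p`, every set of size `2 p + 5` has a short even zero-sum part. -/
theorem not_noShortEven_of_card_eight (hcard : Fintype.card V = 8) (hV : ∀ v : V, v + v = 0)
    (hp3 : 3 ≤ p) (hsc : s.card = 2 * p + 5) : ¬ NoShortEven p x f s := by
  intro hs
  have h2 : (2 : ZMod p) ≠ 0 := by
    have := Nat.le_of_dvd two_pos |>.mt (not_le.2 hp3)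
    rwa [← ZMod.natCast_eq_zero_iff] at this
  obtain ⟨P, hP, hinj⟩ := exists_pairFamily hV x s
  set Y := s \ P.biUnion id with hYdef
  have hYs : Y ⊆ s := sdiff_subset
  have hYP : Disjoint Y (P.biUnion id) := sdiff_disjoint
  have hYc : Y.card + 2 * P.card = 2 * p + 5 := by
    rw [← hsc, ← hP.card_biUnion, card_sdiff_add_card_eq_card hP.biUnion_subset]
  have hXc : (Y.image x).card = Y.card := card_image_of_injOn hinj
  have hX8 : (Y.image x).card ≤ 8 := hcard ▸ card_le_univ _
  have hPp := hs.card_lt hP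
  have hPc : P.card + 1 = p := by omega
  obtain ⟨U, hU⟩ := card_pos.1 (show 0 < P.card by omega)
  obtain ⟨γ, hγ⟩ : ∃ γ, γ = ∑ i ∈ U, f i := ⟨_, rfl⟩
  have hPγ : ∀ W ∈ P, ∑ i ∈ W, f i = γ := fun W hW => by rw [hγ, hs.sum_pair_eq hP hPc hW hU]
  have hγ0 : γ ≠ 0 := by
    have := hs.sum_pairs_ne_zero hP (singleton_subset_iff.2 hU) (by simp; omega) (by simp)
    rwa [sum_singleton, ← hγ] at this
  obtain ⟨u, hu⟩ := card_pos.1 (show 0 < U.card by rw [hP.card U hU]; omega)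
  obtain ⟨w, huw, hUw, hxw⟩ := hP.exists_eq_pair hV hU hu
  by_cases hux : x u ∈ Y.image x
  · obtain ⟨i, hi, hix⟩ := mem_image.1 hux
    have h1 := (hs.two_mul_eq hV hp3 hP hPc hPγ hU hu (hYs hi) (disjoint_left.1 hYP hi) hix).1
    have h4 := four_mul_eq_of_quads (X := Y.image x) (f := classSum x f Y) (c := γ) hV (by omega)
      (fun a _ b _ _ => six_le_card_filter (by omega) (a + b)) (fun B hB h4 h0 => by
        obtain ⟨k, hk1, hk2, h⟩ := hs.exists_eq_mul' hP hγ0 hPγ hYs hYP hinj hB h4 h0 (b := 2)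
          (m := 1) (by norm_num) (by norm_num) (by norm_num) (by omega)
        rw [h, show k = 1 by omega, Nat.cast_one, one_mul]) (mem_image_of_mem x hi)
    rw [classSum_apply hinj hi] at h4
    exact hγ0 (by linear_combination h4 - 2 * h1)
  · have key : ∀ u ∈ U, x u ∉ Y.image x → 4 * f u = γ := by
      intro u hu hux
      obtain ⟨hP', hc', hYs', hYP', hinj', hX'⟩ := hP.insert_free hU hu hYs hYP hinj hux
      have h4 := four_mul_eq_of_quads (X := (insert u Y).image x)
        (f := classSum x f (insert u Y)) (c := γ) hV (by omega)
        (fun a _ b _ _ => six_le_card_filter (by omega) (a + b)) (fun B hB h4 h0 => by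
          obtain ⟨k, hk1, hk2, h⟩ := hs.exists_eq_mul hP' hγ0
            (fun W hW => hPγ W (mem_of_mem_erase hW)) hYs' hYP' hinj' hB h0 (b := 2)
            (by rw [h4]) (by norm_num)
          rw [h, show k = 1 by omega, Nat.cast_one, one_mul])
        (mem_image_of_mem x (mem_insert_self u Y))
      rwa [classSum_apply hinj' (mem_insert_self u Y)] at h4
    have h1 := key u hu hux
    have h2' := key w (by rw [hUw]; simp) (hxw ▸ hux)
    have h3 := hPγ U hU
    rw [hUw, sum_pair huw] at h3
    exact mul_ne_zero h2 hγ0 (by linear_combination h1 + h2' - 4 * h3)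

/-- Over `C_2^4 ⊕ C_p`, a set of size `2 p + 7` without short even zero-sum part has `2 p - 1` equal
elements, and no element with trivial `p`-part. The number of classes that are left over by a maximal
family of pairs is `9`, `11`, `13` or `15`. -/
theorem NoShortEven.exists_const (hcard : Fintype.card V = 16) (hV : ∀ v : V, v + v = 0)
    (hp3 : 3 ≤ p) (hsc : s.card = 2 * p + 7) (hs : NoShortEven p x f s) :
    ∃ Z ⊆ s, Z.card = 2 * p - 1 ∧ (∃ v a, ∀ i ∈ Z, x i = v ∧ f i = a) ∧ ∀ i ∈ s, f i ≠ 0 := by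
  have h2 : (2 : ZMod p) ≠ 0 := by
    have := Nat.le_of_dvd two_pos |>.mt (not_le.2 hp3)
    rwa [← ZMod.natCast_eq_zero_iff] at this
  obtain ⟨P, hP, hinj⟩ := exists_pairFamily hV x s
  set Y := s \ P.biUnion id with hYdef
  have hYs : Y ⊆ s := sdiff_subset
  have hYP : Disjoint Y (P.biUnion id) := sdiff_disjoint
  have hYc : Y.card + 2 * P.card = 2 * p + 7 := by
    rw [← hsc, ← hP.card_biUnion, card_sdiff_add_card_eq_card hP.biUnion_subset]
  have hXc : (Y.image x).card = Y.card := card_image_of_injOn hinj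
  have hX16 : (Y.image x).card ≤ 16 := hcard ▸ card_le_univ _
  have hPp := hs.card_lt hP
  set F : Finset ι → ZMod p := fun U => ∑ i ∈ U, f i with hF
  have hF0 : ∀ U ∈ P, F U ≠ 0 := fun U hU => by
    have := hs.sum_pairs_ne_zero hP (singleton_subset_iff.2 hU) (by simp; omega) (by simp)
    rwa [sum_singleton] at this
  by_cases hconst : ∀ U ∈ P, ∀ W ∈ P, F U = F W
  swap
  · -- two different pair sums
    exfalso
    push Not at hconst
    obtain ⟨U, hU, W, hW, hUW⟩ := hconst
    have hne : U ≠ W := fun h => hUW (h ▸ rfl)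
    have hsum : F U + F W ≠ 0 := by
      have := hs.sum_pairs_ne_zero hP (Q := {U, W})
        (insert_subset hU (singleton_subset_iff.2 hW)) (by rw [card_pair hne]; omega) (by simp)
      rwa [sum_pair hne] at this
    have hN := card_subsetSums_of_ne hF0 hU hW hUW hsum
    have hc2 : 2 ≤ P.card := by
      rw [← card_pair hne]
      exact card_le_card (insert_subset hU (singleton_subset_iff.2 hW))
    set E : Finset (ZMod p) := univ.filter fun a => -a ∉ subsetSums F P with hE
    have hEc : E.card + (subsetSums F P).card = p := by
      have h1 : E = (-(subsetSums F P))ᶜ := by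
        ext a
        simp [hE]
      rw [h1, ← card_neg (subsetSums F P), card_compl_add_card, ZMod.card]
    have hE0 : (0 : ZMod p) ∉ E := by
      simp [hE, zero_mem_subsetSums]
    have hEB : ∀ b, 0 < b → P.card + b ≤ p → ∀ B ⊆ Y.image x, B.card = 2 * b →
        ∑ v ∈ B, v = 0 → ∑ v ∈ B, classSum x f Y v ∈ E := fun b hb hbp B hB hBc hB0 =>
      mem_filter.2 ⟨mem_univ _, hs.neg_notMem_subsetSums hP hYs hYP hinj hB hB0 hBc hb hbp⟩
    obtain hj | hj | hj | hj : P.card + 1 = p ∨ P.card + 2 = p ∨ P.card + 3 = p ∨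
        P.card + 4 = p := by omega
    · exact hUW (hs.sum_pair_eq hP hj hU hW)
    · obtain ⟨B, hB, hB4, hB0⟩ := exists_quad hcard hV (X := Y.image x) (by omega)
      have h := hEB 2 (by norm_num) (by omega) B hB hB4 hB0
      have := card_pos.2 ⟨_, h⟩
      omega
    · exact hE0 (exists_hexad_of_eq hcard hV h2 (X := Y.image x) (by omega) (by omega)
        (hEB 2 (by norm_num) (by omega)) (hEB 3 (by norm_num) (by omega)))
    · exact false_of_two_values hcard hV h2 (X := Y.image x) (by omega) (by omega) hE0
        (hEB 2 (by norm_num) (by omega)) (hEB 3 (by norm_num) (by omega))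
        (hEB 4 (by norm_num) (by omega))
  by_cases hP0 : P.card = 0
  · -- no pairs at all: `p = 3`
    exfalso
    have h4 : p ≠ 4 := by
      rintro rfl
      exact absurd (Fact.out : Nat.Prime 4) (by norm_num)
    obtain rfl : p = 3 := by omega
    refine false_of_mod_three (f := classSum x f Y) hcard hV (X := Y.image x) (by omega) ?_ ?_
    all_goals
      intro B hB hBc hB0
      obtain ⟨C, hC, hCc, hCx, hCf⟩ := exists_lift (f := f) hinj hB
      rw [← hCf]
      refine hs C (hC.trans hYs) (card_pos.1 (by omega)) ?_ (by omega) (hCx.trans hB0)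
      rw [hCc, hBc]
      decide
  obtain ⟨U, hU⟩ := card_pos.1 (Nat.pos_of_ne_zero hP0)
  obtain ⟨γ, hγ⟩ : ∃ γ, γ = F U := ⟨_, rfl⟩
  have hPγ : ∀ W ∈ P, ∑ i ∈ W, f i = γ := fun W hW => hγ ▸ hconst W hW U hU
  have hγ0 : γ ≠ 0 := hγ ▸ hF0 U hU
  have hval : ∀ b m, 0 < b → b ≤ m + 1 → p ≤ P.card + m + 1 → ∀ B ⊆ Y.image x, B.card = 2 * b →
      ∑ v ∈ B, v = 0 → ∃ k : ℕ, 1 ≤ k ∧ k ≤ m ∧ ∑ v ∈ B, classSum x f Y v = k * γ :=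
    fun b m hb hbm hm B hB hBc hB0 =>
      hs.exists_eq_mul' hP hγ0 hPγ hYs hYP hinj hB hBc hB0 rfl hb hbm hm
  have hval1 : ∀ b, 0 < b → b ≤ 2 → p ≤ P.card + 2 → ∀ B ⊆ Y.image x, B.card = 2 * b →
      ∑ v ∈ B, v = 0 → ∑ v ∈ B, classSum x f Y v = γ := by
    intro b hb hb2 hm B hB hBc hB0
    obtain ⟨k, hk1, hk2, h⟩ := hval b 1 hb hb2 hm B hB hBc hB0
    rw [h, show k = 1 by omega, Nat.cast_one, one_mul]
  have hval2 : ∀ b, 0 < b → b ≤ 3 → p ≤ P.card + 3 → ∀ B ⊆ Y.image x, B.card = 2 * b →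
      ∑ v ∈ B, v = 0 → ∑ v ∈ B, classSum x f Y v = γ ∨ ∑ v ∈ B, classSum x f Y v = 2 * γ := by
    intro b hb hb2 hm B hB hBc hB0
    obtain ⟨k, hk1, hk2, h⟩ := hval b 2 hb hb2 hm B hB hBc hB0
    interval_cases k <;> simp at h <;> simp [h]
  have hval3 : ∀ b, 0 < b → b ≤ 4 → p ≤ P.card + 4 → ∀ B ⊆ Y.image x, B.card = 2 * b →
      ∑ v ∈ B, v = 0 → ∑ v ∈ B, classSum x f Y v = γ ∨ ∑ v ∈ B, classSum x f Y v = 2 * γ ∨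
        ∑ v ∈ B, classSum x f Y v = 3 * γ := by
    intro b hb hb2 hm B hB hBc hB0
    obtain ⟨k, hk1, hk2, h⟩ := hval b 3 hb hb2 hm B hB hBc hB0
    interval_cases k <;> simp at h <;> simp [h]
  have hval4 : ∀ b, 0 < b → b ≤ 5 → p ≤ P.card + 5 → ∀ B ⊆ Y.image x, B.card = 2 * b →
      ∑ v ∈ B, v = 0 → ∑ v ∈ B, classSum x f Y v = γ ∨ ∑ v ∈ B, classSum x f Y v = 2 * γ ∨
        ∑ v ∈ B, classSum x f Y v = 3 * γ ∨ ∑ v ∈ B, classSum x f Y v = 4 * γ := by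
    intro b hb hb2 hm B hB hBc hB0
    obtain ⟨k, hk1, hk2, h⟩ := hval b 4 hb hb2 hm B hB hBc hB0
    interval_cases k <;> simp at h <;> simp [h]
  have h3 : P.card + 2 < p → (3 : ZMod p) ≠ 0 := by
    intro hlt h3
    have : ((3 : ℕ) : ZMod p) = 0 := by exact_mod_cast h3
    rw [ZMod.natCast_eq_zero_iff] at this
    have := (Nat.prime_dvd_prime_iff_eq Fact.out Nat.prime_three).1 this
    omega
  obtain hj | hj | hj | hj : P.card + 1 = p ∨ P.card + 2 = p ∨ P.card + 3 = p ∨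
      P.card + 4 = p := by omega
  rotate_left
  · obtain ⟨A, q, hq, hXA, hA8, hA⟩ := exists_hyperplane_of_sums hcard hV h2 hγ0
      (X := Y.image x) (by omega)
      (hval1 2 (by norm_num) (by norm_num) (by omega))
      (hval2 3 (by norm_num) (by norm_num) (by omega))
    rw [hXA, card_insert_of_notMem hq] at hXc
    omega
  · exact (false_of_values_le_two hcard hV h2 (h3 (by omega)) hγ0 (X := Y.image x) (by omega)
      (hval2 2 (by norm_num) (by norm_num) (by omega))
      (hval2 3 (by norm_num) (by norm_num) (by omega))
      (hval3 4 (by norm_num) (by norm_num) (by omega))).elim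
  · exact (false_of_values_le_three hcard hV h2 (h3 (by omega)) hγ0 (X := Y.image x) (by omega)
      (hval3 2 (by norm_num) (by norm_num) (by omega))
      (hval3 3 (by norm_num) (by norm_num) (by omega))
      (hval3 4 (by norm_num) (by norm_num) (by omega))
      (hval4 5 (by norm_num) (by norm_num) (by omega))).elim
  -- `p - 1` pairs and nine further classes: the hyperplane `A` and the class `q`
  have hquad := hval1 2 (by norm_num) (by norm_num) (by omega)
  obtain ⟨A, q, hq, hXA, hA8, hA⟩ := exists_hyperplane_of_sums hcard hV h2 hγ0
    (X := Y.image x) (by omega) hquad (hval2 3 (by norm_num) (by norm_num) (by omega))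
  have hAX : A ⊆ Y.image x := by rw [hXA]; exact subset_insert _ _
  have hA4 : ∀ v ∈ A, 4 * classSum x f Y v = γ := fun v hv =>
    four_mul_eq_of_quads hV (by omega)
      (fun a ha b hb _ => hA.six_le_card_filter (by omega) ha hb)
      (fun B hB => hquad B (hB.trans hAX)) hv
  have hUq : ∀ U ∈ P, ∀ u ∈ U, x u = q := by
    intro U hU u hu
    by_cases hux : x u ∈ Y.image x
    · rw [hXA] at hux
      refine (mem_insert.1 hux).resolve_right fun hxA => hγ0 ?_
      obtain ⟨i, hi, hix⟩ := mem_image.1 (hAX hxA)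
      have h1 := (hs.two_mul_eq hV hp3 hP hj hPγ hU hu (hYs hi) (disjoint_left.1 hYP hi) hix).1
      have h4 := hA4 _ hxA
      rw [← hix, classSum_apply hinj hi] at h4
      linear_combination h4 - 2 * h1
    · exfalso
      obtain ⟨hP', hc', hYs', hYP', hinj', hX'⟩ := hP.insert_free hU hu hYs hYP hinj hux
      have hPγ' : ∀ W ∈ P.erase U, ∑ i ∈ W, f i = γ := fun W hW => hPγ W (mem_of_mem_erase hW)
      obtain ⟨A', q', hq', hXA', hA8', -⟩ := exists_hyperplane_of_sums hcard hV h2 hγ0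
        (X := (insert u Y).image x) (f := classSum x f (insert u Y)) (by omega)
        (fun B hB h4 h0 => by
          obtain ⟨k, hk1, hk2, h⟩ :=
            hs.exists_eq_mul hP' hγ0 hPγ' hYs' hYP' hinj' hB h0 (b := 2) h4 (by norm_num)
          rw [h, show k = 1 by omega, Nat.cast_one, one_mul])
        (fun B hB h6 h0 => by
          obtain ⟨k, hk1, hk2, h⟩ :=
            hs.exists_eq_mul hP' hγ0 hPγ' hYs' hYP' hinj' hB h0 (b := 3) h6 (by norm_num)
          obtain rfl | rfl : k = 1 ∨ k = 2 := by omega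
          · left; simpa using h
          · right; simpa using h)
      rw [hXA', card_insert_of_notMem hq'] at hX'
      omega
  obtain ⟨i, hi, hiq⟩ := mem_image.1 (show q ∈ Y.image x by rw [hXA]; exact mem_insert_self _ _)
  have hiP := disjoint_left.1 hYP hi
  have hhalf : ∀ U ∈ P, ∀ u ∈ U, 2 * f i = γ ∧ 2 * f u = γ := fun U hU u hu =>
    hs.two_mul_eq hV hp3 hP hj hPγ hU hu (hYs hi) hiP (hiq.trans (hUq U hU u hu).symm)
  have hfi : 2 * f i = γ := by
    obtain ⟨u, hu⟩ := card_pos.1 (show 0 < U.card by rw [hP.card U hU]; omega)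
    exact (hhalf U hU u hu).1
  refine ⟨insert i (P.biUnion id), insert_subset (hYs hi) hP.biUnion_subset, ?_, ⟨q, f i, ?_⟩, ?_⟩
  · rw [card_insert_of_notMem hiP, hP.card_biUnion]
    omega
  · intro u hu
    rcases mem_insert.1 hu with rfl | hu
    · exact ⟨hiq, rfl⟩
    · obtain ⟨U, hU, hu⟩ := mem_biUnion.1 hu
      refine ⟨hUq U hU u hu, mul_left_cancel₀ h2 ?_⟩
      rw [(hhalf U hU u hu).2, hfi]
  · intro u hu hfu
    by_cases huP : u ∈ P.biUnion id
    · obtain ⟨U, hU, hu⟩ := mem_biUnion.1 huP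
      have := (hhalf U hU u hu).2
      rw [hfu, mul_zero] at this
      exact hγ0 this.symm
    · have huY : u ∈ Y := mem_sdiff.2 ⟨hu, huP⟩
      have hux : x u ∈ insert q A := hXA ▸ mem_image_of_mem x huY
      rcases mem_insert.1 hux with h | h
      · rw [hinj huY hi (h.trans hiq.symm)] at hfu
        rw [hfu, mul_zero] at hfi
        exact hγ0 hfi.symm
      · have := hA4 _ h
        rw [classSum_apply hinj huY, hfu, mul_zero] at this
        exact hγ0 this.symm

end Structure

/-! ### Zero-sum sets of size exactly `2 p` -/

section ExactLength

variable {ι V : Type*} [AddCommGroup V] [Fintype V] [DecidableEq V] {p : ℕ} [Fact p.Prime]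
  {x : ι → V} {f : ι → ZMod p} {s : Finset ι}

/-- Translating `f` does not change the sums over sets of size `2 p`. -/
lemma sum_add_const {T : Finset ι} (hT : T.card = 2 * p) (t : ZMod p) :
    ∑ i ∈ T, (f i + t) = ∑ i ∈ T, f i := by
  rw [sum_add_distrib, sum_const, hT, nsmul_eq_mul]
  simp

variable [DecidableEq ι]

/-- If `s` has no zero-sum set of size `2 p`, then, up to a translation, a large part of it has no
short even zero-sum part. Many disjoint pairs have, after the translation, sum zero; a maximal even
zero-sum set of size at most `2 p` off these pairs could be padded by them unless it is small, and
the complement of a small one has the property in question. -/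
lemma exists_noShortEven (hV : ∀ v : V, v + v = 0) (hp3 : 3 ≤ p) {N : ℕ}
    (hN : Fintype.card V ≤ N + 9) (hsc : s.card + 2 = 4 * p + N)
    (hno : ∀ T ⊆ s, T.card = 2 * p → ∑ i ∈ T, x i = 0 → ∑ i ∈ T, f i ≠ 0) :
    ∃ t : ZMod p, ∃ s' ⊆ s, s'.card = 2 * p + N ∧ NoShortEven p x (fun i => f i + t) s' := by
  have h2 : (2 : ZMod p) ≠ 0 := by
    have := Nat.le_of_dvd two_pos |>.mt (not_le.2 hp3)
    rwa [← ZMod.natCast_eq_zero_iff] at this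
  obtain ⟨w, hw⟩ : ∃ w, p = 2 * w + 1 :=
    (Fact.out : p.Prime).odd_of_ne_two (by omega)
  obtain ⟨P, hP, hinj⟩ := exists_pairFamily hV x s
  have hPc : 2 * p ≤ P.card + 5 := by
    have h1 : (s \ P.biUnion id).card ≤ Fintype.card V := by
      rw [← card_image_of_injOn hinj]
      exact card_le_univ _
    have h2 : (s \ P.biUnion id).card + 2 * P.card = s.card := by
      rw [← hP.card_biUnion, card_sdiff_add_card_eq_card hP.biUnion_subset]
    omega
  obtain ⟨a, ha⟩ := exists_popular_value (F := fun U => ∑ i ∈ U, f i) hp3 hPc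
    (fun Q hQ hQc h => by
      obtain ⟨T, hT, -, hTc, -, hTx, hTf⟩ := (hP.mono hQ).exists_union (f := f) (empty_subset s)
        (disjoint_empty_left _) (by simp) (by simp)
      exact hno T hT (by rw [hTc, hQc]; simp) hTx (by rw [hTf, h]; simp))
  obtain ⟨W, hW, hWc⟩ := exists_subset_card_eq (show w ≤ (P.filter fun U => ∑ i ∈ U, f i = a).card
    by omega)
  have hPW := hP.mono (hW.trans (filter_subset _ _))
  -- after the translation by `t`, the pairs in `W` have sum zero
  obtain ⟨t, ht⟩ : ∃ t : ZMod p, 2 * t = -a := ⟨-a / 2, mul_div_cancel₀ _ h2⟩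
  set f' : ι → ZMod p := fun i => f i + t with hf'
  have hW0 : ∀ U ∈ W, ∑ i ∈ U, f' i = 0 := by
    intro U hU
    rw [hf', sum_add_distrib, (mem_filter.1 (hW hU)).2, sum_const, hPW.card U hU, nsmul_eq_mul]
    push_cast
    rw [ht, add_neg_cancel]
  set R := s \ W.biUnion id with hR
  have hRc : R.card + 2 * w = s.card := by
    rw [← hWc, ← hPW.card_biUnion, card_sdiff_add_card_eq_card hPW.biUnion_subset]
  obtain ⟨T, hT, hTmax⟩ := exists_max_image
    (R.powerset.filter fun T => Even T.card ∧ T.card ≤ 2 * p ∧ ∑ i ∈ T, x i = 0 ∧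
      ∑ i ∈ T, f' i = 0) Finset.card ⟨∅, by simp⟩
  simp only [mem_filter, mem_powerset] at hT hTmax
  obtain ⟨hTR, hTe, hTp, hTx, hTf⟩ := hT
  obtain ⟨k, hk⟩ := hTe
  have hTs : T.card < p := by
    by_contra! hle
    obtain ⟨W', hW', hW'c⟩ := exists_subset_card_eq (show p - k ≤ W.card by omega)
    obtain ⟨T', hT', -, hT'c, -, hT'x, hT'f⟩ := (hPW.mono hW').exists_union (f := f')
      (hTR.trans sdiff_subset)
      (disjoint_of_subset_left hTR (disjoint_of_subset_right
        (biUnion_subset_biUnion_of_subset_left id hW') sdiff_disjoint)) ⟨k, hk⟩ hTx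
    have hc : T'.card = 2 * p := by omega
    refine hno T' hT' hc hT'x ?_
    rw [← sum_add_const hc t]
    refine hT'f.trans ?_
    rw [hTf, zero_add]
    exact sum_eq_zero fun U hU => hW0 U (hW' hU)
  obtain ⟨s', hs', hs'c⟩ := exists_subset_card_eq (show 2 * p + N ≤ (R \ T).card by
    rw [card_sdiff_of_subset hTR]; omega)
  refine ⟨t, s', hs'.trans (sdiff_subset.trans sdiff_subset), hs'c, ?_⟩
  intro T2 hT2 hne hT2e hT2p hT2x hT2f
  have hT2R := hT2.trans (hs'.trans sdiff_subset)
  have hd : Disjoint T T2 := disjoint_of_subset_right (hT2.trans hs') disjoint_sdiff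
  have h1 := hTmax T2 ⟨hT2R, hT2e, hT2p, hT2x, hT2f⟩
  have hc := card_union_of_disjoint hd
  have h2 := hTmax (T ∪ T2) ⟨union_subset hTR hT2R, by
    rw [hc]; exact (show Even T.card from ⟨k, hk⟩).add hT2e, by omega, by
    rw [sum_union hd, hTx, hT2x, add_zero], by rw [sum_union hd, hTf, hT2f, add_zero]⟩
  have := hne.card_pos
  omega

/-- Over `C_2^3 ⊕ C_p`, every set of size `4 p + 3` has a zero-sum part of size `2 p`. -/
theorem exists_card_eq_of_card_eight (hcard : Fintype.card V = 8) (hV : ∀ v : V, v + v = 0)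
    (hp3 : 3 ≤ p) (hsc : s.card = 4 * p + 3) :
    ∃ T ⊆ s, T.card = 2 * p ∧ ∑ i ∈ T, x i = 0 ∧ ∑ i ∈ T, f i = 0 := by
  by_contra! hno
  obtain ⟨t, s', -, hs'c, hs'⟩ := exists_noShortEven hV hp3 (N := 5) (by omega) (by omega) hno
  exact not_noShortEven_of_card_eight hcard hV hp3 hs'c hs'

/-- Over `C_2^4 ⊕ C_p`, every set of size `4 p + 5` has a zero-sum part of size `2 p`. -/
theorem exists_card_eq_of_card_sixteen (hcard : Fintype.card V = 16) (hV : ∀ v : V, v + v = 0)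
    (hp3 : 3 ≤ p) (hsc : s.card = 4 * p + 5) :
    ∃ T ⊆ s, T.card = 2 * p ∧ ∑ i ∈ T, x i = 0 ∧ ∑ i ∈ T, f i = 0 := by
  by_contra! hno
  obtain ⟨t, s', hs's, hs'c, hs'⟩ := exists_noShortEven hV hp3 (N := 7) (by omega) (by omega) hno
  obtain ⟨Z, hZ, hZc, ⟨v, a, hva⟩, -⟩ := hs'.exists_const hcard hV hp3 hs'c
  -- translate such that `f` vanishes on `Z`; then all even parts of `Z` have sum zero
  set f' : ι → ZMod p := fun i => f i + (t - a) with hf'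
  have hZ0 : ∀ i ∈ Z, f' i = 0 := by
    intro i hi
    have := (hva i hi).2
    rw [hf']
    linear_combination this
  have hZs := hZ.trans hs's
  obtain ⟨i, hi⟩ := card_pos.1 (show 0 < Z.card by omega)
  have hZe : (Z.erase i).card = 2 * p - 2 := by rw [card_erase_of_mem hi]; omega
  have hZes := (erase_subset i Z).trans hZs
  have hrest : (s \ Z.erase i).card = 2 * p + 7 := by
    rw [card_sdiff_of_subset hZes]; omega
  have hnot : ¬ NoShortEven p x f' (s \ Z.erase i) := fun h => by
    obtain ⟨-, -, -, -, h0⟩ := h.exists_const hcard hV hp3 hrest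
    exact h0 i (mem_sdiff.2 ⟨hZs hi, notMem_erase i Z⟩) (hZ0 i hi)
  unfold NoShortEven at hnot
  push Not at hnot
  obtain ⟨T, hT, hne, ⟨k, hk⟩, hTp, hTx, hTf⟩ := hnot
  have hpos := hne.card_pos
  obtain ⟨D, hD, hDc⟩ := exists_subset_card_eq (show 2 * p - T.card ≤ (Z.erase i).card by omega)
  have hd : Disjoint T D := disjoint_of_subset_left hT (disjoint_of_subset_right hD sdiff_disjoint)
  have hDZ := hD.trans (erase_subset i Z)
  have hc : (T ∪ D).card = 2 * p := by rw [card_union_of_disjoint hd]; omega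
  refine hno (T ∪ D) (union_subset (hT.trans sdiff_subset) (hD.trans hZes)) hc ?_ ?_
  · rw [sum_union hd, hTx, zero_add, sum_congr rfl fun j hj => (hva j (hDZ hj)).1, sum_const, hDc,
      hk, show 2 * p - (k + k) = (p - k) * 2 by omega, mul_nsmul', two_nsmul, hV, smul_zero]
  · rw [← sum_add_const hc (t - a)]
    change ∑ j ∈ T ∪ D, f' j = 0
    rw [sum_union hd, hTf, zero_add]
    exact sum_eq_zero fun j hj => hZ0 j (hDZ hj)

end ExactLength

/-! ### Elementary abelian groups times the cyclic group of order four -/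

section OrderFour

lemma three_mul_le_choose_two (a : ℕ) : 3 * a ≤ a.choose 2 + 6 := by
  induction a with
  | zero => simp
  | succ a ih =>
    have hs : (a + 1).choose 2 = a + a.choose 2 := by
      rw [Nat.choose_succ_succ' a 1, Nat.choose_one_right]
    rw [hs]
    obtain h | h | h | h : a = 0 ∨ a = 1 ∨ a = 2 ∨ 3 ≤ a := by omega
    · subst h; simp
    · subst h; simp
    · subst h; simp
    · omega

lemma four_mul_le_choose_two (a : ℕ) : 4 * a ≤ a.choose 2 + 10 := by
  induction a with
  | zero => simp
  | succ a ih =>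
    have hs : (a + 1).choose 2 = a + a.choose 2 := by
      rw [Nat.choose_succ_succ' a 1, Nat.choose_one_right]
    rw [hs]
    obtain h | h | h | h | h : a = 0 ∨ a = 1 ∨ a = 2 ∨ a = 3 ∨ 4 ≤ a := by omega
    · subst h; simp
    · subst h; simp
    · subst h; simp
    · subst h; simp [Nat.choose]
    · omega

variable {ι A : Type*} [DecidableEq ι] [AddCommGroup A] [Fintype A] [DecidableEq A]
  {y : ι → A × ZMod 4} {s : Finset ι}

lemma eq_zero_or_eq_two_of_castHom :
    ∀ c : ZMod 4, ZMod.castHom (show 2 ∣ 4 by norm_num) (ZMod 2) c = 0 →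
    c = 0 ∨ c = 2 := by
  decide

/-- A pigeonhole argument for the sums of pairs of elements whose last coordinates have the same
parity. -/
lemma exists_sum_eq_zero_of_choose (hA : ∀ a : A, a + a = 0)
    (hc : ∀ a b, s.card ≤ a + b + 2 → 2 * (Fintype.card A - 1) < a.choose 2 + b.choose 2) :
    ∃ T ⊆ s, (T.card = 2 ∨ T.card = 4) ∧ ∑ i ∈ T, y i = 0 := by
  set π := ZMod.castHom (show 2 ∣ 4 by norm_num) (ZMod 2) with hπ
  set x : ι → A × ZMod 2 := fun i => ((y i).1, π (y i).2) with hx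
  have hV : ∀ v : A × ZMod 2, v + v = 0 := fun v => Prod.ext (hA v.1) (CharTwo.add_self_eq_zero v.2)
  obtain ⟨P, hP, hinj⟩ := exists_pairFamily hV x s
  by_cases hP0 : ∃ U ∈ P, ∑ i ∈ U, y i = 0
  · obtain ⟨U, hU, h0⟩ := hP0
    exact ⟨U, hP.subset U hU, Or.inl (hP.card U hU), h0⟩
  push Not at hP0
  have hP2 : ∀ U ∈ P, ∑ i ∈ U, y i = (0, 2) := by
    intro U hU
    have h := hP.sum U hU
    have h1 : (∑ i ∈ U, y i).1 = 0 := by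
      rw [Prod.fst_sum]
      simpa [hx, Prod.fst_sum] using congrArg Prod.fst h
    have h2 : π (∑ i ∈ U, y i).2 = 0 := by
      rw [Prod.snd_sum, map_sum]
      simpa [hx, Prod.snd_sum] using congrArg Prod.snd h
    rcases eq_zero_or_eq_two_of_castHom _ h2 with h2 | h2
    · exact (hP0 U hU (Prod.ext h1 h2)).elim
    · exact Prod.ext h1 h2
  by_cases hPc : 1 < P.card
  · obtain ⟨U, hU, W, hW, hUW⟩ := one_lt_card.1 hPc
    have hd : Disjoint U W := hP.disjoint hU hW hUW
    refine ⟨U ∪ W, union_subset (hP.subset U hU) (hP.subset W hW), Or.inr ?_, ?_⟩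
    · rw [card_union_of_disjoint hd, hP.card U hU, hP.card W hW]
    · rw [sum_union hd, hP2 U hU, hP2 W hW]
      exact Prod.ext (add_zero 0) (show (2 : ZMod 4) + 2 = 0 by decide)
  set Y := s \ P.biUnion id with hY
  have hYs : Y ⊆ s := sdiff_subset
  have hYc : Y.card + 2 * P.card = s.card := by
    rw [← hP.card_biUnion, card_sdiff_add_card_eq_card hP.biUnion_subset]
  set Y₀ := Y.filter fun i => π (y i).2 = 0 with hY₀
  set Y₁ := Y.filter fun i => ¬ π (y i).2 = 0 with hY₁
  have hY01 : Y₀.card + Y₁.card = Y.card := card_filter_add_card_filter_not _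
  have hd01 : Disjoint (powersetCard 2 Y₀) (powersetCard 2 Y₁) := by
    rw [disjoint_left]
    intro B hB hB'
    rw [mem_powersetCard] at hB hB'
    obtain ⟨i, hi⟩ := card_pos.1 (show 0 < B.card by omega)
    exact (mem_filter.1 (hB'.1 hi)).2 (mem_filter.1 (hB.1 hi)).2
  have hinjy : Set.InjOn y Y := fun i hi j hj h => hinj hi hj (by simp only [hx, h])
  have hpar : ∀ B ∈ powersetCard 2 Y₀ ∪ powersetCard 2 Y₁, B ⊆ Y ∧ B.card = 2 ∧
      (∑ i ∈ B, y i).1 ≠ 0 ∧ π (∑ i ∈ B, y i).2 = 0 := by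
    intro B hB
    have h1 : B ⊆ Y ∧ B.card = 2 ∧ ∀ i ∈ B, ∀ j ∈ B, π (y i).2 = π (y j).2 := by
      rw [mem_union, mem_powersetCard, mem_powersetCard] at hB
      rcases hB with ⟨hB, hBc⟩ | ⟨hB, hBc⟩
      · exact ⟨hB.trans (filter_subset _ _), hBc, fun i hi j hj =>
          (mem_filter.1 (hB hi)).2.trans (mem_filter.1 (hB hj)).2.symm⟩
      · refine ⟨hB.trans (filter_subset _ _), hBc, fun i hi j hj => ?_⟩
        have h : ∀ a b : ZMod 2, a ≠ 0 → b ≠ 0 → a = b := by decide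
        exact h _ _ (mem_filter.1 (hB hi)).2 (mem_filter.1 (hB hj)).2
    obtain ⟨hBY, hBc, hBπ⟩ := h1
    obtain ⟨i, j, hij, rfl⟩ := card_eq_two.1 hBc
    have hπij := hBπ i (by simp) j (by simp)
    refine ⟨hBY, hBc, ?_, ?_⟩
    · rw [sum_pair hij]
      intro h
      have h' : (y i).1 + (y j).1 = (y j).1 + (y j).1 := by rw [hA (y j).1]; exact h
      exact hij (hinj (hBY (by simp)) (hBY (by simp)) (Prod.ext (add_right_cancel h') hπij))
    · rw [sum_pair hij, Prod.snd_add, map_add, hπij, CharTwo.add_self_eq_zero]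
  obtain ⟨B, hB, C, hC, hBC, hs⟩ := exists_pair_sum_eq (z := y) (s := Y)
    (P := powersetCard 2 Y₀ ∪ powersetCard 2 Y₁)
    (t := (univ.erase (0 : A)) ×ˢ ({0, 2} : Finset (ZMod 4))) hinjy (fun B hB => ⟨(hpar B hB).1, (hpar B hB).2.1⟩) (fun B hB => by
      rw [mem_product, mem_insert, mem_singleton]
      exact ⟨mem_erase.2 ⟨(hpar B hB).2.2.1, mem_univ _⟩,
        eq_zero_or_eq_two_of_castHom _ (hpar B hB).2.2.2⟩) (by
      rw [card_union_of_disjoint hd01, card_powersetCard, card_powersetCard, card_product,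
        card_erase_of_mem (mem_univ _), card_univ, show ({0, 2} : Finset (ZMod 4)).card = 2 from rfl,
        mul_comm]
      exact hc _ _ (by omega))
  refine ⟨B ∪ C, union_subset ((hpar B hB).1.trans hYs) ((hpar C hC).1.trans hYs), Or.inr ?_, ?_⟩
  · rw [card_union_of_disjoint hBC, (hpar B hB).2.1, (hpar C hC).2.1]
  · rw [sum_union hBC, ← hs]
    refine Prod.ext (hA _) ?_
    rw [Prod.snd_add]
    have h4 : ∀ c : ZMod 4, c = 0 ∨ c = 2 → c + c = 0 := by decide
    exact h4 _ (eq_zero_or_eq_two_of_castHom _ (hpar B hB).2.2.2)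

lemma exists_sum_eq_zero_of_card_four (hcard : Fintype.card A = 4) (hA : ∀ a : A, a + a = 0)
    (hs : s.card = 9) : ∃ T ⊆ s, (T.card = 2 ∨ T.card = 4) ∧ ∑ i ∈ T, y i = 0 :=
  exists_sum_eq_zero_of_choose hA fun a b h => by
    have := three_mul_le_choose_two a
    have := three_mul_le_choose_two b
    omega

lemma exists_sum_eq_zero_of_card_eight (hcard : Fintype.card A = 8) (hA : ∀ a : A, a + a = 0)
    (hs : s.card = 11) : ∃ T ⊆ s, (T.card = 2 ∨ T.card = 4) ∧ ∑ i ∈ T, y i = 0 :=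
  exists_sum_eq_zero_of_choose hA fun a b h => by
    have := four_mul_le_choose_two a
    have := four_mul_le_choose_two b
    omega

end OrderFour

/-! ### From indexed families to sequences -/

section Sequences

variable {G : Type*}

lemma exists_map_univ_eq (S : Multiset G) : ∃ (k : ℕ) (y : Fin k → G),
    (univ : Finset (Fin k)).val.map y = S := by
  induction S using Quot.inductionOn with
  | h l => exact ⟨l.length, l.get, by rw [Fin.univ_val_map, List.ofFn_get]; rfl⟩

lemma map_val_le_map_univ {κ : Type*} [Fintype κ] (y : κ → G) (T : Finset κ) :
    T.val.map y ≤ univ.val.map y :=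
  Multiset.map_le_map (val_le_iff.2 (subset_univ T))

variable [AddCommGroup G]

/-- To force short zero-sum subsequences at length `N` it is enough to find nonempty zero-sum
sets of even size among `N + 1` elements one of which is zero: the zero may be discarded. -/
lemma forcesShortZeroSum_of_even {N : ℕ}
    (h : ∀ (k : ℕ) (y : Option (Fin k) → G) (s : Finset (Option (Fin k))), s.card = N + 1 →
      none ∈ s → y none = 0 → ∃ T ⊆ s, T.Nonempty ∧ Even T.card ∧
        T.card ≤ AddMonoid.exponent G ∧ ∑ i ∈ T, y i = 0) : ForcesShortZeroSum G N := by
  intro S hS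
  obtain ⟨k, y, rfl⟩ := exists_map_univ_eq S
  rw [Multiset.card_map, card_val, card_univ] at hS
  obtain ⟨s, -, hs⟩ := exists_subset_card_eq (s := (univ : Finset (Fin k))) hS
  obtain ⟨T, -, hne, ⟨c, hc⟩, hTe, hT0⟩ := h k (fun o => o.elim 0 y) (insertNone s)
    (by rw [card_insertNone, hs]) (by simp) rfl
  have hpos := hne.card_pos
  have hcard := card_eraseNone_eq_card_erase T
  have h1 := pred_card_le_card_erase (s := T) (a := none)
  have h2 := card_erase_le (s := T) (a := none)
  refine ⟨(eraseNone T).val.map y, map_val_le_map_univ y _, ?_, ?_, ?_⟩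
  · rw [Multiset.card_map, card_val]; omega
  · rw [Multiset.card_map, card_val]; omega
  · rw [← hT0, ← sum_erase T (a := none) rfl, ← map_some_eraseNone, sum_map]
    rfl

lemma forcesExpZeroSum_of_indexed {N : ℕ}
    (h : ∀ (k : ℕ) (y : Fin k → G) (s : Finset (Fin k)), s.card = N →
      ∃ T ⊆ s, T.card = AddMonoid.exponent G ∧ ∑ i ∈ T, y i = 0) : ForcesExpZeroSum G N := by
  intro S hS
  obtain ⟨k, y, rfl⟩ := exists_map_univ_eq S
  rw [Multiset.card_map, card_val, card_univ] at hS
  obtain ⟨s, -, hs⟩ := exists_subset_card_eq (s := (univ : Finset (Fin k))) hS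
  obtain ⟨T, -, hTe, hT0⟩ := h k y s hs
  exact ⟨T.val.map y, map_val_le_map_univ y T, by rw [Multiset.card_map, card_val, hTe], hT0⟩

end Sequences

/-! ### The groups `C_2^r ⊕ C_{2p}` -/

section PrimeCase

lemma exponent_elemTwoSumCyclic (r n : ℕ) :
    AddMonoid.exponent (ElemTwoSumCyclic r (2 * n)) = 2 * n := by
  have h : AddMonoid.exponent (Fin r → ZMod 2) ∣ 2 :=
    AddMonoid.exponent_dvd_of_forall_nsmul_eq_zero fun g => by
      ext i
      rw [Pi.smul_apply, two_nsmul, CharTwo.add_self_eq_zero, Pi.zero_apply]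
  rw [AddMonoid.exponent_prod, ZMod.exponent]
  exact Nat.lcm_eq_right (h.trans (dvd_mul_right 2 n))

lemma pi_zmod_two_add_self {r : ℕ} (a : Fin r → ZMod 2) : a + a = 0 :=
  funext fun i => CharTwo.add_self_eq_zero (a i)

lemma prod_zmod_two_add_self {r : ℕ} (v : (Fin r → ZMod 2) × ZMod 2) : v + v = 0 :=
  Prod.ext (pi_zmod_two_add_self v.1) (CharTwo.add_self_eq_zero v.2)

lemma card_prod_zmod_two (r : ℕ) : Fintype.card ((Fin r → ZMod 2) × ZMod 2) = 2 ^ (r + 1) := by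
  rw [Fintype.card_prod, Fintype.card_fun, ZMod.card, Fintype.card_fin, pow_succ]

variable {p : ℕ}

/-- The component of `C_2^r ⊕ C_{2p}` in its elementary `2`-part, for odd `p`. -/
def twoPart {r : ℕ} (g : ElemTwoSumCyclic r (2 * p)) : (Fin r → ZMod 2) × ZMod 2 :=
  (g.1, ZMod.castHom (dvd_mul_right 2 p) (ZMod 2) g.2)

/-- The component of `C_2^r ⊕ C_{2p}` in its `p`-part, for odd `p`. -/
def oddPart {r : ℕ} (g : ElemTwoSumCyclic r (2 * p)) : ZMod p :=
  ZMod.castHom (dvd_mul_left p 2) (ZMod p) g.2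

lemma castHom_eq_zero_iff_dvd {a b : ℕ} [NeZero b] (h : a ∣ b) (z : ZMod b) :
    ZMod.castHom h (ZMod a) z = 0 ↔ a ∣ z.val := by
  conv_lhs => rw [← ZMod.natCast_zmod_val z]
  rw [map_natCast, ZMod.natCast_eq_zero_iff]

lemma sum_eq_zero_of_parts {r : ℕ} [NeZero p] (hp2 : Nat.Coprime 2 p) {κ : Type*} {T : Finset κ}
    {y : κ → ElemTwoSumCyclic r (2 * p)} (h2 : ∑ i ∈ T, twoPart (y i) = 0)
    (hp : ∑ i ∈ T, oddPart (y i) = 0) : ∑ i ∈ T, y i = 0 := by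
  refine Prod.ext ?_ ?_
  · have := congrArg Prod.fst h2
    rw [Prod.fst_sum] at this ⊢
    exact this
  · have h := congrArg Prod.snd h2
    rw [Prod.snd_sum] at h ⊢
    simp only [twoPart, oddPart, ← map_sum] at h hp
    have hd := hp2.mul_dvd_of_dvd_of_dvd ((castHom_eq_zero_iff_dvd _ _).1 h)
      ((castHom_eq_zero_iff_dvd _ _).1 hp)
    exact (ZMod.val_eq_zero _).1 (Nat.eq_zero_of_dvd_of_lt hd (ZMod.val_lt _))

lemma exists_even_of_not_noShortEven {r : ℕ} [NeZero p] (hp2 : Nat.Coprime 2 p) {κ : Type*}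
    {s : Finset κ} {y : κ → ElemTwoSumCyclic r (2 * p)}
    (h : ¬ NoShortEven p (fun i => twoPart (y i)) (fun i => oddPart (y i)) s) :
    ∃ T ⊆ s, T.Nonempty ∧ Even T.card ∧
      T.card ≤ AddMonoid.exponent (ElemTwoSumCyclic r (2 * p)) ∧ ∑ i ∈ T, y i = 0 := by
  unfold NoShortEven at h
  push Not at h
  obtain ⟨T, hT, hne, hTe, hTp, hTx, hTf⟩ := h
  exact ⟨T, hT, hne, hTe, hTp.trans (exponent_elemTwoSumCyclic r p).ge,
    sum_eq_zero_of_parts hp2 hTx hTf⟩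

variable [Fact p.Prime]

lemma coprime_two_of_three_le (hp3 : 3 ≤ p) : Nat.Coprime 2 p :=
  Nat.coprime_two_left.2 ((Fact.out : p.Prime).odd_of_ne_two (by omega))

lemma forcesShortZeroSum_two_of_odd (hp3 : 3 ≤ p) :
    ForcesShortZeroSum (ElemTwoSumCyclic 2 (2 * p)) (2 * p + 4) :=
  forcesShortZeroSum_of_even fun _ _ _ hs _ _ =>
    exists_even_of_not_noShortEven (coprime_two_of_three_le hp3)
      (not_noShortEven_of_card_eight (card_prod_zmod_two 2) prod_zmod_two_add_self hp3 hs)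

lemma forcesShortZeroSum_three_of_odd (hp3 : 3 ≤ p) :
    ForcesShortZeroSum (ElemTwoSumCyclic 3 (2 * p)) (2 * p + 6) :=
  forcesShortZeroSum_of_even fun _ y _ hs hns hy =>
    exists_even_of_not_noShortEven (coprime_two_of_three_le hp3) fun h => by
      obtain ⟨-, -, -, -, h0⟩ := h.exists_const (card_prod_zmod_two 3) prod_zmod_two_add_self hp3 hs
      exact h0 none hns (by rw [hy]; exact map_zero _)

lemma forcesExpZeroSum_two_of_odd (hp3 : 3 ≤ p) :
    ForcesExpZeroSum (ElemTwoSumCyclic 2 (2 * p)) (4 * p + 3) :=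
  forcesExpZeroSum_of_indexed fun _ y _ hs => by
    obtain ⟨T, hT, hTc, hTx, hTf⟩ := exists_card_eq_of_card_eight (x := fun i => twoPart (y i))
      (f := fun i => oddPart (y i)) (card_prod_zmod_two 2) prod_zmod_two_add_self hp3 hs
    exact ⟨T, hT, hTc.trans (exponent_elemTwoSumCyclic 2 p).symm,
      sum_eq_zero_of_parts (coprime_two_of_three_le hp3) hTx hTf⟩

lemma forcesExpZeroSum_three_of_odd (hp3 : 3 ≤ p) :
    ForcesExpZeroSum (ElemTwoSumCyclic 3 (2 * p)) (4 * p + 5) :=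
  forcesExpZeroSum_of_indexed fun _ y _ hs => by
    obtain ⟨T, hT, hTc, hTx, hTf⟩ := exists_card_eq_of_card_sixteen (x := fun i => twoPart (y i))
      (f := fun i => oddPart (y i)) (card_prod_zmod_two 3) prod_zmod_two_add_self hp3 hs
    exact ⟨T, hT, hTc.trans (exponent_elemTwoSumCyclic 3 p).symm,
      sum_eq_zero_of_parts (coprime_two_of_three_le hp3) hTx hTf⟩

lemma forcesShortZeroSum_of_four {r N : ℕ}
    (h : ∀ {κ : Type} [DecidableEq κ] (y : κ → ElemTwoSumCyclic r (2 * 2)) (s : Finset κ),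
      s.card = N + 1 → ∃ T ⊆ s, (T.card = 2 ∨ T.card = 4) ∧ ∑ i ∈ T, y i = 0) :
    ForcesShortZeroSum (ElemTwoSumCyclic r (2 * 2)) N :=
  forcesShortZeroSum_of_even fun _ y s hs _ _ => by
    obtain ⟨T, hT, hc, h0⟩ := h y s hs
    rw [exponent_elemTwoSumCyclic]
    refine ⟨T, hT, card_pos.1 (by omega), ?_, by omega, h0⟩
    rcases hc with hc | hc <;> rw [hc] <;> decide

lemma forcesExpZeroSum_of_four {r N : ℕ}
    (h : ∀ {κ : Type} [DecidableEq κ] (y : κ → ElemTwoSumCyclic r (2 * 2)) (s : Finset κ),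
      s.card = N + 1 → ∃ T ⊆ s, (T.card = 2 ∨ T.card = 4) ∧ ∑ i ∈ T, y i = 0) :
    ForcesExpZeroSum (ElemTwoSumCyclic r (2 * 2)) (N + 3) :=
  forcesExpZeroSum_of_indexed fun _ y s hs => by
    rw [exponent_elemTwoSumCyclic]
    obtain ⟨s₁, hs₁, hs₁c⟩ := exists_subset_card_eq (show N + 1 ≤ s.card by omega)
    obtain ⟨T, hT, hc | hc, h0⟩ := h y s₁ hs₁c
    swap
    · exact ⟨T, hT.trans hs₁, hc, h0⟩
    have hTs := hT.trans hs₁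
    obtain ⟨s₂, hs₂, hs₂c⟩ := exists_subset_card_eq (show N + 1 ≤ (s \ T).card by
      rw [card_sdiff_of_subset hTs]; omega)
    obtain ⟨T', hT', hc' | hc', h0'⟩ := h y s₂ hs₂c
    · have hd : Disjoint T T' := disjoint_of_subset_right (hT'.trans hs₂) disjoint_sdiff
      refine ⟨T ∪ T', union_subset hTs ((hT'.trans hs₂).trans sdiff_subset), ?_, ?_⟩
      · rw [card_union_of_disjoint hd, hc, hc']
      · rw [sum_union hd, h0, h0', add_zero]
    · exact ⟨T', (hT'.trans hs₂).trans sdiff_subset, hc', h0'⟩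

theorem forces_two_of_prime (hp : p.Prime) :
    ForcesShortZeroSum (ElemTwoSumCyclic 2 (2 * p)) (2 * p + 4) ∧
      ForcesExpZeroSum (ElemTwoSumCyclic 2 (2 * p)) (4 * p + 3) := by
  obtain rfl | h3 : p = 2 ∨ 3 ≤ p := by have := hp.two_le; omega
  · have h {κ : Type} [DecidableEq κ] (y : κ → ElemTwoSumCyclic 2 (2 * 2)) (s : Finset κ)
        (hs : s.card = 8 + 1) : ∃ T ⊆ s, (T.card = 2 ∨ T.card = 4) ∧ ∑ i ∈ T, y i = 0 :=
      exists_sum_eq_zero_of_card_four (A := Fin 2 → ZMod 2) (by simp) pi_zmod_two_add_self hs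
    exact ⟨forcesShortZeroSum_of_four h, forcesExpZeroSum_of_four h⟩
  · exact ⟨forcesShortZeroSum_two_of_odd h3, forcesExpZeroSum_two_of_odd h3⟩

theorem forces_three_of_prime (hp : p.Prime) :
    ForcesShortZeroSum (ElemTwoSumCyclic 3 (2 * p)) (2 * p + 6) ∧
      ForcesExpZeroSum (ElemTwoSumCyclic 3 (2 * p)) (4 * p + 5) := by
  obtain rfl | h3 : p = 2 ∨ 3 ≤ p := by have := hp.two_le; omega
  · have h {κ : Type} [DecidableEq κ] (y : κ → ElemTwoSumCyclic 3 (2 * 2)) (s : Finset κ)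
        (hs : s.card = 10 + 1) : ∃ T ⊆ s, (T.card = 2 ∨ T.card = 4) ∧ ∑ i ∈ T, y i = 0 :=
      exists_sum_eq_zero_of_card_eight (A := Fin 3 → ZMod 2) (by simp) pi_zmod_two_add_self hs
    exact ⟨forcesShortZeroSum_of_four h, forcesExpZeroSum_of_four h⟩
  · exact ⟨forcesShortZeroSum_three_of_odd h3, forcesExpZeroSum_three_of_odd h3⟩

end PrimeCase

/-! ### From `n = p` to multiples of `p` -/

section Multiplicativity

/-- Disjoint good subsequences of size at most `q` can be taken out one after the other, as long
as `L` terms are left. -/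
lemma exists_disjoint_pieces {G : Type*} [DecidableEq G] {Good : Multiset G → Prop} {L q : ℕ}
    (h : ∀ S : Multiset G, L ≤ S.card → ∃ T ≤ S, Good T ∧ T.card ≤ q) (k : ℕ) (S : Multiset G)
    (hS : L + q * k ≤ S.card + q) :
    ∃ T : ℕ → Multiset G, ∑ i ∈ range k, T i ≤ S ∧ ∀ i < k, Good (T i) := by
  induction k generalizing S with
  | zero => exact ⟨fun _ => 0, by simp, by simp⟩
  | succ k ih =>
    rw [mul_add, mul_one] at hS
    obtain ⟨T₀, hT₀, hgood, hq⟩ := h S (by have := Nat.zero_le (q * k); omega)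
    obtain ⟨T, hT, hTg⟩ := ih (S - T₀) (by
      rw [Multiset.card_sub hT₀]
      have := Multiset.card_le_card hT₀
      omega)
    refine ⟨fun i => if i = k then T₀ else T i, ?_, ?_⟩
    · rw [sum_range_succ, if_pos rfl, sum_congr rfl fun i hi => if_neg (mem_range.1 hi).ne]
      exact (Multiset.add_le_add_iff_right.2 hT).trans_eq (tsub_add_cancel_of_le hT₀)
    · intro i hi
      dsimp only
      split_ifs with hik
      · exact hgood
      · exact hTg i (by omega)

/-- The Davenport constant of `ℤ/mℤ` is at most `m`: pad with `m - 1` zeros and apply the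
Erdős–Ginzburg–Ziv theorem. -/
lemma exists_sum_range_eq_zero {m : ℕ} (hm : 0 < m) (a : ℕ → ZMod m) :
    ∃ I ⊆ range m, I.Nonempty ∧ ∑ i ∈ I, a i = 0 := by
  have : NeZero m := ⟨hm.ne'⟩
  obtain ⟨t, ht, htc, ht0⟩ := ZMod.erdos_ginzburg_ziv (s := range (2 * m - 1))
    (fun i => if i < m then a i else 0) (by simp)
  refine ⟨t.filter (· < m), fun i hi => mem_range.2 (mem_filter.1 hi).2, ?_, ?_⟩
  · by_contra hne
    rw [not_nonempty_iff_eq_empty, filter_eq_empty_iff] at hne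
    have : t ⊆ Ico m (2 * m - 1) := fun i hi =>
      mem_Ico.2 ⟨not_lt.1 (hne hi), mem_range.1 (ht hi)⟩
    have := card_le_card this
    rw [Nat.card_Ico] at this
    omega
  · rw [sum_filter, ht0]

variable {r p m : ℕ}

/-- The projection of `C_2^r ⊕ C_{2pm}` onto `C_2^r ⊕ C_{2p}`. -/
def reduction (r p m : ℕ) : ElemTwoSumCyclic r (2 * (p * m)) →+ ElemTwoSumCyclic r (2 * p) :=
  (AddMonoidHom.id _).prodMap
    (ZMod.castHom (mul_dvd_mul_left 2 (dvd_mul_right p m)) (ZMod (2 * p))).toAddMonoidHom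

/-- The kernel of the projection is cyclic of order `m`. -/
lemma exists_of_reduction_eq_zero (hp : 0 < p) (hm : 0 < m)
    {g : ElemTwoSumCyclic r (2 * (p * m))} (hg : reduction r p m g = 0) :
    ∃ c : ℕ, g = (0, ((2 * p * c : ℕ) : ZMod (2 * (p * m)))) := by
  have : NeZero (2 * (p * m)) := ⟨by positivity⟩
  have h1 : g.1 = 0 := congrArg Prod.fst hg
  have h2 : ZMod.castHom (mul_dvd_mul_left 2 (dvd_mul_right p m)) (ZMod (2 * p)) g.2 = 0 :=
    congrArg Prod.snd hg
  obtain ⟨c, hc⟩ := (castHom_eq_zero_iff_dvd _ _).1 h2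
  exact ⟨c, Prod.ext h1 (by rw [← hc, ZMod.natCast_zmod_val])⟩

/-- A choice of labels in `ℤ/mℤ` for finitely many elements of the kernel of the projection, which
detects when a partial sum is zero. -/
lemma exists_labels (hp : 0 < p) (hm : 0 < m) {k : ℕ} {g : ℕ → ElemTwoSumCyclic r (2 * (p * m))}
    (hg : ∀ i < k, reduction r p m (g i) = 0) :
    ∃ a : ℕ → ZMod m, ∀ I ⊆ range k, ∑ i ∈ I, a i = 0 → ∑ i ∈ I, g i = 0 := by
  choose! c hc using fun i (hi : i < k) => exists_of_reduction_eq_zero hp hm (hg i hi)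
  refine ⟨fun i => c i, fun I hI h0 => ?_⟩
  rw [← Nat.cast_sum, ZMod.natCast_eq_zero_iff] at h0
  rw [sum_congr rfl fun i hi => hc i (mem_range.1 (hI hi))]
  refine Prod.ext ?_ ?_
  · rw [Prod.fst_sum]
    exact sum_const_zero
  · rw [Prod.snd_sum]
    change ∑ i ∈ I, ((2 * p * c i : ℕ) : ZMod (2 * (p * m))) = 0
    rw [← Nat.cast_sum, ← mul_sum, ZMod.natCast_eq_zero_iff, ← mul_assoc]
    exact mul_dvd_mul_left _ h0

lemma sum_sum_le {G : Type*} {T : ℕ → Multiset G} {S : Multiset G} {k : ℕ}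
    (hT : ∑ i ∈ range k, T i ≤ S) {I : Finset ℕ} (hI : I ⊆ range k) : ∑ i ∈ I, T i ≤ S :=
  (sum_le_sum_of_subset hI).trans hT

variable {G : Type*} [AddCommGroup G]

lemma sum_multiset_sum (I : Finset ℕ) (T : ℕ → Multiset G) :
    (∑ i ∈ I, T i).sum = ∑ i ∈ I, (T i).sum :=
  map_sum (Multiset.sumAddMonoidHom : Multiset G →+ G) T I

/-- A zero-sum subsequence of the projection, lifted. -/
lemma exists_le_of_map {H : Type*} [AddCommGroup H] (φ : G →+ H) {S : Multiset G} {U : Multiset H}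
    (hU : U ≤ S.map φ) : ∃ T ≤ S, T.card = U.card ∧ φ T.sum = U.sum := by
  obtain ⟨T, hT, rfl⟩ : ∃ T ≤ S, T.map φ = U := by
    induction S using Multiset.induction_on generalizing U with
    | empty => exact ⟨0, le_rfl, (Multiset.le_zero.1 hU).symm⟩
    | cons a S ih =>
      classical
      rw [Multiset.map_cons] at hU
      by_cases ha : φ a ∈ U
      · obtain ⟨U', rfl⟩ := Multiset.exists_cons_of_mem ha
        obtain ⟨T, hT, rfl⟩ := ih ((Multiset.cons_le_cons_iff _).1 hU)
        exact ⟨a ::ₘ T, Multiset.cons_le_cons a hT, Multiset.map_cons _ _ _⟩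
      · obtain ⟨T, hT, hTU⟩ := ih ((Multiset.le_cons_of_notMem ha).1 hU)
        exact ⟨T, hT.trans (Multiset.le_cons_self S a), hTU⟩
  exact ⟨T, hT, (Multiset.card_map _ _).symm, map_multiset_sum φ T⟩

/-- The bound for `p` yields the one for `p m`: take out `m` short subsequences with sums in the
kernel `C_m` of the projection, and combine some of them. -/
lemma ForcesShortZeroSum.mul (hp : 0 < p) (hm : 0 < m) {d : ℕ}
    (h : ForcesShortZeroSum (ElemTwoSumCyclic r (2 * p)) (2 * p + d)) :
    ForcesShortZeroSum (ElemTwoSumCyclic r (2 * (p * m))) (2 * (p * m) + d) := by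
  intro S hS
  rw [exponent_elemTwoSumCyclic]
  obtain ⟨T, hTS, hT⟩ := exists_disjoint_pieces
    (Good := fun T => 1 ≤ T.card ∧ T.card ≤ 2 * p ∧ reduction r p m T.sum = 0)
    (L := 2 * p + d) (q := 2 * p) (fun S hS => by
      obtain ⟨U, hU, hU1, hUp, hU0⟩ := h (S.map (reduction r p m)) (by rwa [Multiset.card_map])
      rw [exponent_elemTwoSumCyclic] at hUp
      obtain ⟨T, hT, hTU, hT0⟩ := exists_le_of_map _ hU
      exact ⟨T, hT, ⟨hTU ▸ hU1, hTU ▸ hUp, hT0.trans hU0⟩, hTU ▸ hUp⟩) m S (by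
      rw [mul_assoc]; omega)
  obtain ⟨a, ha⟩ := exists_labels hp hm (k := m) (g := fun i => (T i).sum) fun i hi => (hT i hi).2.2
  obtain ⟨I, hI, hne, hI0⟩ := exists_sum_range_eq_zero hm a
  refine ⟨∑ i ∈ I, T i, sum_sum_le hTS hI, ?_, ?_, ?_⟩
  · obtain ⟨i, hi⟩ := hne
    rw [Multiset.card_sum]
    exact (hT i (mem_range.1 (hI hi))).1.trans
      (single_le_sum (f := fun i => (T i).card) (fun _ _ => Nat.zero_le _) hi)
  · rw [Multiset.card_sum]
    calc ∑ i ∈ I, (T i).card ≤ I.card * (2 * p) :=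
          sum_le_card_nsmul _ _ _ fun i hi => (hT i (mem_range.1 (hI hi))).2.1
      _ ≤ m * (2 * p) := Nat.mul_le_mul_right _ (by simpa using card_le_card hI)
      _ = 2 * (p * m) := by ring
  · rw [sum_multiset_sum]
    exact ha I hI hI0

/-- As in the case of short subsequences, with `2 m - 1` subsequences of length `2 p`, of which the
Erdős–Ginzburg–Ziv theorem selects `m`. -/
lemma ForcesExpZeroSum.mul (hp : 0 < p) (hm : 0 < m) {d : ℕ}
    (h : ForcesExpZeroSum (ElemTwoSumCyclic r (2 * p)) (4 * p + d)) :
    ForcesExpZeroSum (ElemTwoSumCyclic r (2 * (p * m))) (4 * (p * m) + d) := by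
  intro S hS
  have : NeZero m := ⟨hm.ne'⟩
  rw [exponent_elemTwoSumCyclic]
  obtain ⟨T, hTS, hT⟩ := exists_disjoint_pieces
    (Good := fun T => T.card = 2 * p ∧ reduction r p m T.sum = 0)
    (L := 4 * p + d) (q := 2 * p) (fun S hS => by
      obtain ⟨U, hU, hUp, hU0⟩ := h (S.map (reduction r p m)) (by rwa [Multiset.card_map])
      rw [exponent_elemTwoSumCyclic] at hUp
      obtain ⟨T, hT, hTU, hT0⟩ := exists_le_of_map _ hU
      exact ⟨T, hT, ⟨hTU.trans hUp, hT0.trans hU0⟩, (hTU.trans hUp).le⟩) (2 * m - 1) S (by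
      obtain ⟨c, rfl⟩ : ∃ c, m = c + 1 := ⟨m - 1, by omega⟩
      rw [show 2 * (c + 1) - 1 = 2 * c + 1 by omega]
      nlinarith)
  obtain ⟨a, ha⟩ := exists_labels hp hm (k := 2 * m - 1) (g := fun i => (T i).sum)
    fun i hi => (hT i hi).2
  obtain ⟨I, hI, hIc, hI0⟩ := ZMod.erdos_ginzburg_ziv (s := range (2 * m - 1)) a (by simp)
  refine ⟨∑ i ∈ I, T i, sum_sum_le hTS hI, ?_, ?_⟩
  · rw [Multiset.card_sum, sum_congr rfl fun i hi => (hT i (mem_range.1 (hI hi))).1, sum_const, hIc,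
      smul_eq_mul]
    ring
  · rw [sum_multiset_sum]
    exact ha I hI hI0

end Multiplicativity

/-! ### Lower bounds -/

section LowerBounds

/-- A subsequence of a sum of sequences is a sum of subsequences. -/
lemma exists_eq_add_of_le_add {α : Type*} {A B T : Multiset α} (h : T ≤ A + B) :
    ∃ A' ≤ A, ∃ B' ≤ B, T = A' + B' := by
  classical
  exact ⟨T ∩ A, Multiset.inter_le_right, T - A, tsub_le_iff_left.2 h, by
    rw [add_comm, Multiset.sub_add_inter]⟩

lemma exists_eq_sum_of_le_sum {α κ : Type*} [DecidableEq κ] {I : Finset κ} {A : κ → Multiset α}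
    {T : Multiset α} (h : T ≤ ∑ i ∈ I, A i) :
    ∃ B : κ → Multiset α, (∀ i ∈ I, B i ≤ A i) ∧ T = ∑ i ∈ I, B i := by
  induction I using Finset.induction_on generalizing T with
  | empty => exact ⟨fun _ => 0, by simp, by simpa using h⟩
  | insert j I hj ih =>
    rw [sum_insert hj] at h
    obtain ⟨A', hA', T', hT', rfl⟩ := exists_eq_add_of_le_add h
    obtain ⟨B, hB, rfl⟩ := ih hT'
    refine ⟨fun i => if i = j then A' else B i, ?_, ?_⟩
    · intro i hi
      dsimp only
      split_ifs with hij
      · exact hij ▸ hA'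
      · exact hB i ((mem_insert.1 hi).resolve_left hij)
    · rw [sum_insert hj, if_pos rfl]
      congr 1
      exact sum_congr rfl fun i hi => (if_neg (ne_of_mem_of_not_mem hi hj)).symm

variable {r n : ℕ}

/-- The extremal sequence for `η`: the element `(0, 1)` repeated `2 n - 1` times, and the elements
`(e_i, 0)` and `(e_i, 1)` once each. -/
def extremalSeq (r n : ℕ) : Multiset (ElemTwoSumCyclic r (2 * n)) :=
  Multiset.replicate (2 * n - 1) (0, 1) +
    ∑ i : Fin r, (Multiset.replicate 1 (Pi.single i 1, 0) + Multiset.replicate 1 (Pi.single i 1, 1))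

lemma card_extremalSeq : (extremalSeq r n).card = 2 * n - 1 + 2 * r := by
  simp [extremalSeq, Multiset.card_sum, mul_comm]

/-- The extremal sequence has no short zero-sum subsequence: `(e_i, 0)` and `(e_i, 1)` have to
occur together, so with `a` copies of `(0, 1)` and `c` such pairs, `2 n` divides `a + c`, while the
length is `a + 2 c`. -/
lemma not_short_of_le_extremalSeq {T : Multiset (ElemTwoSumCyclic r (2 * n))}
    (hT : T ≤ extremalSeq r n) (h1 : 1 ≤ T.card) (h2 : T.card ≤ 2 * n) : T.sum ≠ 0 := by
  intro h0
  obtain ⟨A, hA, B, hB, rfl⟩ := exists_eq_add_of_le_add hT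
  obtain ⟨a, ha, rfl⟩ := Multiset.le_replicate_iff.1 hA
  obtain ⟨B, hBi, rfl⟩ := exists_eq_sum_of_le_sum hB
  have hB' : ∀ i : Fin r, ∃ b ≤ 1, ∃ c ≤ 1, B i =
      Multiset.replicate b (Pi.single i 1, 0) + Multiset.replicate c (Pi.single i 1, 1) := by
    intro i
    obtain ⟨C, hC, D, hD, h⟩ := exists_eq_add_of_le_add (hBi i (mem_univ i))
    obtain ⟨b, hb, rfl⟩ := Multiset.le_replicate_iff.1 hC
    obtain ⟨c, hc, rfl⟩ := Multiset.le_replicate_iff.1 hD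
    exact ⟨b, hb, c, hc, h⟩
  choose b hb c hc hBbc using hB'
  have hsum : (∑ i, B i).sum = ∑ i, (B i).sum :=
    map_sum (Multiset.sumAddMonoidHom : Multiset (ElemTwoSumCyclic r (2 * n)) →+ _) B univ
  rw [Multiset.sum_add, hsum, Multiset.sum_replicate] at h0
  simp only [hBbc, Multiset.sum_add, Multiset.sum_replicate] at h0
  have hfst : ∀ j, b j = c j := by
    intro j
    have h := congrFun (congrArg Prod.fst h0) j
    simp [Prod.fst_sum, Finset.sum_apply, Pi.single_apply, sum_add_distrib] at h
    obtain hb' | hb' : b j = 0 ∨ b j = 1 := by have := hb j; omega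
    all_goals obtain hc' | hc' : c j = 0 ∨ c j = 1 := by have := hc j; omega
    all_goals simp_all
  have hsnd : 2 * n ∣ a + ∑ i, c i := by
    have h := congrArg Prod.snd h0
    simp only [Prod.snd_add, Prod.snd_sum, Prod.smul_snd, smul_zero, zero_add, nsmul_one,
      Prod.snd_zero] at h
    rw [← ZMod.natCast_eq_zero_iff]
    push_cast
    exact h
  have hcard : (Multiset.replicate a ((0, 1) : ElemTwoSumCyclic r (2 * n)) + ∑ i, B i).card =
      a + 2 * ∑ i, c i := by
    rw [Multiset.card_add, Multiset.card_replicate, Multiset.card_sum, mul_sum]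
    congr 1
    refine sum_congr rfl fun i _ => ?_
    rw [hBbc i, Multiset.card_add, Multiset.card_replicate, Multiset.card_replicate, hfst i, two_mul]
  rw [hcard] at h1 h2
  have := Nat.le_of_dvd (by omega) hsnd
  omega

lemma not_forcesShortZeroSum (hn : 0 < n) {l : ℕ} (hl : l < 2 * n + 2 * r) :
    ¬ ForcesShortZeroSum (ElemTwoSumCyclic r (2 * n)) l := by
  intro h
  obtain ⟨T, hT, h1, h2, h0⟩ := h (extremalSeq r n) (by rw [card_extremalSeq]; omega)
  rw [exponent_elemTwoSumCyclic] at h2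
  exact not_short_of_le_extremalSeq hT h1 h2 h0

lemma not_forcesExpZeroSum (hn : 0 < n) {l : ℕ} (hl : l + 1 < 4 * n + 2 * r) :
    ¬ ForcesExpZeroSum (ElemTwoSumCyclic r (2 * n)) l := by
  intro h
  obtain ⟨T, hT, h2, h0⟩ := h (Multiset.replicate (2 * n - 1) 0 + extremalSeq r n) (by
    rw [Multiset.card_add, Multiset.card_replicate, card_extremalSeq]; omega)
  rw [exponent_elemTwoSumCyclic] at h2
  obtain ⟨A, hA, B, hB, rfl⟩ := exists_eq_add_of_le_add hT
  obtain ⟨a, ha, rfl⟩ := Multiset.le_replicate_iff.1 hA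
  rw [Multiset.sum_add, Multiset.sum_replicate, smul_zero, zero_add] at h0
  rw [Multiset.card_add, Multiset.card_replicate] at h2
  exact not_short_of_le_extremalSeq hB (by omega) (by omega) h0

end LowerBounds

/-! ### The invariants -/

section Invariants

lemma sInf_eq_of_not_lt {Q : ℕ → Prop} {L : ℕ} (hL : 0 < L) (h : Q L) (hlt : ∀ l < L, ¬ Q l) :
    sInf {l : ℕ | 0 < l ∧ Q l} = L :=
  le_antisymm (Nat.sInf_le ⟨hL, h⟩)
    (le_csInf ⟨L, hL, h⟩ fun l hl => not_lt.1 fun h => hlt l h hl.2)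

lemma etaConst_eq {r n : ℕ} (hn : 0 < n)
    (h : ForcesShortZeroSum (ElemTwoSumCyclic r (2 * n)) (2 * n + 2 * r)) :
    etaConst (ElemTwoSumCyclic r (2 * n)) = 2 * n + 2 * r :=
  sInf_eq_of_not_lt (by omega) h fun _ hl => not_forcesShortZeroSum hn hl

lemma egzConst_eq {r n d : ℕ} (hn : 0 < n) (hd : d + 1 = 2 * r)
    (h : ForcesExpZeroSum (ElemTwoSumCyclic r (2 * n)) (4 * n + d)) :
    egzConst (ElemTwoSumCyclic r (2 * n)) = 4 * n + d :=
  sInf_eq_of_not_lt (by omega) h fun _ hl => not_forcesExpZeroSum hn (by omega)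

end Invariants

theorem theorem1p2 (n : ℕ) (hn : 2 ≤ n) :
    (etaConst (ElemTwoSumCyclic 2 (2 * n)) = 2 * n + 4 ∧
      egzConst (ElemTwoSumCyclic 2 (2 * n)) = 4 * n + 3) ∧
    (etaConst (ElemTwoSumCyclic 3 (2 * n)) = 2 * n + 6 ∧
      (36 ≤ n → egzConst (ElemTwoSumCyclic 3 (2 * n)) = 4 * n + 5)) := by
  obtain ⟨p, hp, m, rfl⟩ := Nat.exists_prime_and_dvd (show n ≠ 1 by omega)
  have hm : 0 < m := Nat.pos_of_ne_zero (by rintro rfl; omega)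
  have hpm : 0 < p * m := by omega
  have : Fact p.Prime := ⟨hp⟩
  obtain ⟨h1, h2⟩ := forces_two_of_prime hp
  obtain ⟨h3, h4⟩ := forces_three_of_prime hp
  exact ⟨⟨etaConst_eq hpm (h1.mul hp.pos hm), egzConst_eq hpm rfl (h2.mul hp.pos hm)⟩,
    etaConst_eq hpm (h3.mul hp.pos hm), fun _ => egzConst_eq hpm rfl (h4.mul hp.pos hm)⟩
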